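/- Let $G$ be a discrete group. All $G$-CW-complexes below are proper, i.e. have finite isotropy groups. **Notation.** For $H\subseteq G$ let $WH=NH/H$ be its Weyl group, $\operatorname{consub}(G)$ the set of conjugacy classes of subgroups, $X^H$ the $H$-fixed point set and $X^{>H}$ the set of points whose isotropy group properly contains $H$; for $C\in\pi_0(X^H)$ let $WH_C\subseteq WH$ be the isotropy group of $C$. The component category $\Pi_0(G,X)$ has as objects the $G$-maps $x\colon G/H\to X$, and as morphisms $x\to y$ the $G$-maps $\sigma\colon G/H\to G/K$ with $y\circ\sigma\simeq_G x$; $X^H(x)$ is the component of $X^H$ containing $x(1H)$ and $WH_x=WH_{X^H(x)}$. Put $U^G(X)=\mathbb Z[\operatorname{Is}\Pi_0(G,X)]$. Sending $[x\colon G/H\to X]$ to the orbit of $X^H(x)$ identifies $\operatorname{Is}\Pi_0(G,X)$ with $\coprod_{(H)\in\operatorname{consub}(G)}WH\backslash\pi_0(X^H)$. * The character map $\operatorname{ch}^G(X)\colon U^G(X)\to\bigoplus_{(H)}\bigoplus_{WH\backslash\pi_0(X^H)}\mathbb Q$ sends $[x]$ to the element whose component at $[y\colon G/K\to X]$ is $\sum_{WK_y\sigma\in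 WK_y\backslash\operatorname{mor}(y,x)}|(WK_y)_\sigma|^{-1}$, where $WK_y\cong\operatorname{aut}(y)$ acts by $(\tau,\sigma)\mapsto\sigma\circ\tau^{-1}$. * $H_0^{Or(G)}(X;\underline{R_{\mathbb Q}})$ is the zeroth homology of $C_*(X^-)\otimes_{\mathbb Z Or(G;\mathcal{F}in)}\underline{R_{\mathbb Q}}$, where $C_*(X^H)$ is the cellular chain complex of $X^H$ and $\underline{R_{\mathbb Q}}$ sends $G/H$, $H$ finite, to the rational representation ring $R_{\mathbb Q}(H)$, with functoriality by induction. The map $\beta^G_{\mathbb Q}(X)\colon\operatorname{colim}_{(x\colon G/H\to X)\in\Pi_0(G,X)}R_{\mathbb Q}(H)\to H_0^{Or(G)}(X;\underline{R_{\mathbb Q}})$ is induced by the maps $R_{\mathbb Q}(H)=H_0^{Or(G)}(G/H;\underline{R_{\mathbb Q}})\to H_0^{Or(G)}(X;\underline{R_{\mathbb Q}})$ that $x$ induces, and $e_1^G(X)\colon U^G(X)\to H_0^{Or(G)}(X;\underline{R_{\mathbb Q}})$ sends $[x\colon G/H\to X]$ to the image under $\beta^G_{\mathbb Q}(X)$ of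 the class at $x$ of the trivial representation $[\mathbb Q]\in R_{\mathbb Q}(H)$. * For $H$ finite, $\operatorname{class}_{\mathbb Q}(H)$ is the rational vector space on the set $\operatorname{con}_{\mathbb Q}(H)$ of elements of $H$ modulo the relation that the generated cyclic subgroups are conjugate in $H$. The map $HS^G_{\mathbb Q}(X)\colon\mathbb Q\otimes_{\mathbb Z}\operatorname{colim}R_{\mathbb Q}(H)\to\operatorname{colim}\operatorname{class}_{\mathbb Q}(H)$ (colimits over $\Pi_0(G,X)$) is induced by the maps sending $[V]$ to the image in $\operatorname{class}_{\mathbb Q}(H)$ of the Hattori–Stallings rank of the $\mathbb QH$-module $V$. * The map $\alpha^G_{\mathbb Q}(X)\colon\bigoplus_{(L)\text{ finite cyclic}}\bigoplus_{WL\backslash\pi_0(X^L)}\mathbb Q\to\operatorname{colim}\operatorname{class}_{\mathbb Q}(H)$ sends the basis element of $(L),\ WL\cdot C$ to the class at $y\colon G/L\to X$, where $X^L(y)=C$, of the generators of $L$. The map $D^G(X)$ is multiplication by $|\operatorname{Gen}(L)|/|L|$ on the summands of $(L)$, where $\operatorname{Gen}(L)$ is the set of generators of $L$, and $\operatorname{pr}$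 is the projection onto the summands with $L$ finite cyclic. * If $X$ is finite (has finitely many $G$-orbits of cells), $\chi^G(X)\in U^G(X)$ has as component at $[x\colon G/H\to X]$ the Euler characteristic of the pair of finite CW-complexes $(WH_x\backslash X^H(x),\,WH_x\backslash(X^H(x)\cap X^{>H}))$. The orbifold Euler characteristic of a finite proper $W$-CW-complex $Y$ is $\chi^{\mathbb QW}(Y)=\sum_{p\ge0}(-1)^p\sum_{We}|W_e|^{-1}$, the inner sum running over the $W$-orbits of open $p$-cells $e$ of $Y$, with $W_e$ the isotropy group of $e$. **Theorem.** For every proper $G$-CW-complex $X$ the maps $\beta^G_{\mathbb Q}(X)$, $HS^G_{\mathbb Q}(X)$ and $\alpha^G_{\mathbb Q}(X)$ are well defined isomorphisms, so that $\gamma^G_{\mathbb Q}(X):=(\operatorname{id}_{\mathbb Q}\otimes_{\mathbb Z}\beta^G_{\mathbb Q}(X))\circ HS^G_{\mathbb Q}(X)^{-1}\circ\alpha^G_{\mathbb Q}(X)\circ D^G(X)$ is an isomorphism $$\gamma^G_{\mathbb Q}(X)\colon\bigoplus_{\substack{(L)\in\operatorname{consub}(G)\\ L\text{ finite cyclic}}}\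 \bigoplus_{WL\backslash\pi_0(X^L)}\mathbb Q\ \xrightarrow{\ \cong\ }\ \mathbb Q\otimes_{\mathbb Z}H_0^{Or(G)}(X;\underline{R_{\mathbb Q}}).$$ It is natural in $X$ with respect to $G$-maps. The map $\operatorname{id}_{\mathbb Q}\otimes_{\mathbb Z}\operatorname{ch}^G(X)\colon\mathbb Q\otimes_{\mathbb Z}U^G(X)\to\bigoplus_{(H)}\bigoplus_{WH\backslash\pi_0(X^H)}\mathbb Q$ is an isomorphism as well, and $$\operatorname{id}_{\mathbb Q}\otimes_{\mathbb Z}e_1^G(X)=\gamma^G_{\mathbb Q}(X)\circ\operatorname{pr}\circ(\operatorname{id}_{\mathbb Q}\otimes_{\mathbb Z}\operatorname{ch}^G(X)).$$ If $X$ is finite, then $\gamma^G_{\mathbb Q}(X)$ sends the collection of orbifold Euler characteristics $$\{\chi^{\mathbb QWL_C}(C)\mid (L)\in\operatorname{consub}(G),\ L\text{ finite cyclic},\ WL\cdot C\in WL\backslash\pi_0(X^L)\}$$ to $1\otimes_{\mathbb Z}e_1^G(X)(\chi^G(X))$. -/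

import Mathlib

open CategoryTheory TensorProduct
open scoped Pointwise

universe u v

namespace EquivEuler

noncomputable section



/-! ### Singular chains, relative homology, cellular chains -/

section Singular

variable {X : Type*} [TopologicalSpace X] {Y : Type*} [TopologicalSpace Y]

/-- Integral singular `n`-chains of `X`. -/
abbrev SingChain (n : ℕ) (X : Type*) [TopologicalSpace X] : Type _ :=
  C(stdSimplex ℝ (Fin (n + 1)), X) →₀ ℤ

/-- The `i`-th face of a singular simplex. -/
def face (n : ℕ) (i : Fin (n + 2)) (s : C(stdSimplex ℝ (Fin (n + 2)), X)) :
    C(stdSimplex ℝ (Fin (n + 1)), X) :=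
  s.comp ⟨stdSimplex.map i.succAbove, stdSimplex.continuous_map _⟩

/-- The singular boundary operator; it is zero on `0`-chains. -/
def bdry : (n : ℕ) → SingChain n X →ₗ[ℤ] SingChain (n - 1) X
  | 0 => 0
  | n + 1 => ∑ i : Fin (n + 2), (-1 : ℤ) ^ (i : ℕ) • Finsupp.lmapDomain ℤ ℤ (face n i)

theorem face_face (n : ℕ) {i : Fin (n + 2)} {j : Fin (n + 3)} (h : j ≤ i.castSucc)
    (s : C(stdSimplex ℝ (Fin (n + 3)), X)) :
    face n i (face (n + 1) j s)
      = face n (j.castLT (lt_of_le_of_lt (Fin.le_def.1 h) i.2)) (face (n + 1) i.succ s) := by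
  ext t
  simp only [face, ContinuousMap.comp_apply, ContinuousMap.coe_mk, stdSimplex.map_comp_apply]
  congr 2
  funext k
  simp only [Function.comp_apply, Fin.ext_iff, Fin.succAbove, Fin.lt_def] at *
  split_ifs <;> simp at * <;> grind

theorem bdry_bdry (n : ℕ) (c : SingChain (n + 1) X) : bdry n (bdry (n + 1) c) = 0 := by
  cases n with
  | zero => rfl
  | succ n =>
    induction c using Finsupp.induction_linear with
    | zero => simp
    | add a b ha hb => rw [map_add, map_add, ha, hb, add_zero]
    | single s a =>
      simp only [bdry, LinearMap.sum_apply, LinearMap.smul_apply, map_sum, map_smul,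
        Finsupp.lmapDomain_apply, Finsupp.mapDomain_single, Finset.smul_sum, smul_smul]
      rw [← Finset.sum_product', Finset.univ_product_univ]
      let S : Finset (Fin (n + 3) × Fin (n + 2)) := {p | (p.1 : ℕ) ≤ (p.2 : ℕ)}
      rw [← Finset.sum_add_sum_compl S, ← eq_neg_iff_add_eq_zero, ← Finset.sum_neg_distrib]
      refine Finset.sum_bij (fun p hp => (p.2.succ, p.1.castLT
        (lt_of_le_of_lt (Finset.mem_filter.1 hp).2 p.2.2))) ?_ ?_ ?_ ?_
      · rintro ⟨j, i⟩ h
        simp only [S, Finset.compl_filter, Finset.mem_filter_univ, Fin.val_succ,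
          Fin.val_castLT] at h ⊢
        lia
      · rintro ⟨j, i⟩ _ ⟨j', i'⟩ _ h
        simp only [Prod.mk.injEq, Fin.ext_iff, Fin.val_succ, Fin.val_castLT] at h ⊢
        lia
      · rintro ⟨j, i⟩ h
        simp only [S, Finset.compl_filter, Finset.mem_filter_univ, not_le] at h
        refine ⟨(i.castSucc, j.pred (by rintro rfl; simp at h)), ?_, ?_⟩
        · simp only [S, Finset.mem_filter_univ, Fin.val_castSucc, Fin.val_pred]
          lia
        · simp
      · rintro ⟨j, i⟩ h
        simp only [S, Finset.mem_filter_univ] at h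
        simp only [Fin.val_succ, Fin.val_castLT]
        rw [face_face n (i := i) (j := j) (Fin.le_def.2 h), pow_succ, ← neg_smul]
        congr 1
        ring

theorem bdry_map (f : C(X, Y)) : ∀ (n : ℕ) (c : SingChain n X),
    bdry n (Finsupp.lmapDomain ℤ ℤ f.comp c) = Finsupp.lmapDomain ℤ ℤ f.comp (bdry n c)
  | 0, c => by simp [bdry]
  | n + 1, c => by
    simp only [bdry, LinearMap.sum_apply, LinearMap.smul_apply, map_sum, map_smul,
      Finsupp.lmapDomain_apply, ← Finsupp.mapDomain_comp]
    rfl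

/-- The singular `n`-chains of the subspace `A`, inside those of `X`. -/
def chainsIn (n : ℕ) (A : Set X) : Submodule ℤ (SingChain n X) :=
  Finsupp.supported ℤ ℤ {s | Set.range s ⊆ A}

theorem bdry_mem_chainsIn {A : Set X} : ∀ {n : ℕ} {c : SingChain n X},
    c ∈ chainsIn n A → bdry n c ∈ chainsIn (n - 1) A
  | 0, c, _ => by simp [bdry]
  | n + 1, c, hc => by
    simp only [bdry, LinearMap.sum_apply, LinearMap.smul_apply]
    refine Submodule.sum_mem _ fun i _ => Submodule.smul_mem _ _ ?_
    refine Finsupp.supported_comap_lmapDomain ℤ ℤ (face n i) _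
      (Finsupp.supported_mono (fun s hs => ?_) hc)
    exact (Set.range_comp_subset_range _ s).trans hs

theorem map_mem_chainsIn {n : ℕ} {A : Set X} {B : Set Y} (f : C(X, Y)) (h : Set.MapsTo f A B)
    {c : SingChain n X} (hc : c ∈ chainsIn n A) :
    Finsupp.lmapDomain ℤ ℤ f.comp c ∈ chainsIn n B := by
  refine Finsupp.supported_comap_lmapDomain ℤ ℤ f.comp _ (Finsupp.supported_mono (fun s hs => ?_) hc)
  rintro _ ⟨t, rfl⟩
  exact h (hs ⟨t, rfl⟩)

/-- Relative singular `n`-cycles of the pair `(A, B)`. -/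
def relCycles (n : ℕ) (A B : Set X) : Submodule ℤ (SingChain n X) :=
  chainsIn n A ⊓ (chainsIn (n - 1) B).comap (bdry n)

/-- Relative singular `n`-boundaries of the pair `(A, B)`. -/
def relBoundaries (n : ℕ) (A B : Set X) : Submodule ℤ (SingChain n X) :=
  (chainsIn (n + 1) A).map (bdry (n + 1)) ⊔ chainsIn n B

/-- The relative singular homology group `H_n(A, B; ℤ)` of subspaces `B ⊆ A` of `X`. -/
abbrev RelHomology (n : ℕ) (A B : Set X) : Type _ :=
  relCycles n A B ⧸ (relBoundaries n A B).comap (relCycles n A B).subtype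

theorem bdry_mem_relCycles {n : ℕ} {A B B' : Set X} {c : SingChain (n + 1) X}
    (hc : c ∈ relCycles (n + 1) A B) : bdry (n + 1) c ∈ relCycles n B B' :=
  ⟨hc.2, by
    change bdry n (bdry (n + 1) c) ∈ chainsIn (n - 1) B'
    rw [bdry_bdry]; exact Submodule.zero_mem _⟩

/-- The boundary operator `H_{n+1}(A, B) → H_n(B, B')` of a triple `B' ⊆ B ⊆ A`, which sends the
class of a relative cycle `c` to the class of its boundary. -/
def tripleBdry (n : ℕ) (A B B' : Set X) :
    RelHomology (n + 1) A B →ₗ[ℤ] RelHomology n B B' :=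
  Submodule.mapQ _ _
    ((bdry (n + 1)).restrict (p := relCycles (n + 1) A B) (q := relCycles n B B')
      fun _ hc => bdry_mem_relCycles hc) (by
    rintro ⟨c, hc⟩ h
    change bdry (n + 1) c ∈ relBoundaries n B B'
    obtain ⟨_, ⟨a, _, rfl⟩, b, hb, h⟩ := Submodule.mem_sup.1 (show c ∈ relBoundaries (n + 1) A B from h)
    rw [← h, map_add, bdry_bdry, zero_add]
    exact Submodule.mem_sup_left ⟨b, hb, rfl⟩)

theorem map_mem_relCycles {n : ℕ} {A B : Set X} {A' B' : Set Y} (f : C(X, Y))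
    (hA : Set.MapsTo f A A') (hB : Set.MapsTo f B B') {c : SingChain n X}
    (hc : c ∈ relCycles n A B) : Finsupp.lmapDomain ℤ ℤ f.comp c ∈ relCycles n A' B' :=
  ⟨map_mem_chainsIn f hA hc.1, by
    change bdry n (Finsupp.lmapDomain ℤ ℤ f.comp c) ∈ chainsIn (n - 1) B'
    rw [bdry_map]; exact map_mem_chainsIn f hB hc.2⟩

/-- The map induced on relative homology by a continuous map of pairs. -/
def relMap (n : ℕ) {A B : Set X} {A' B' : Set Y} (f : C(X, Y))
    (hA : Set.MapsTo f A A') (hB : Set.MapsTo f B B') :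
    RelHomology n A B →ₗ[ℤ] RelHomology n A' B' :=
  Submodule.mapQ _ _
    ((Finsupp.lmapDomain ℤ ℤ f.comp).restrict (p := relCycles n A B) (q := relCycles n A' B')
      fun _ hc => map_mem_relCycles f hA hB hc) (by
    rintro ⟨c, hc⟩ h
    change Finsupp.lmapDomain ℤ ℤ f.comp c ∈ relBoundaries n A' B'
    obtain ⟨_, ⟨a, ha, rfl⟩, b, hb, h⟩ := Submodule.mem_sup.1 (show c ∈ relBoundaries n A B from h)
    rw [← h, map_add]
    refine Submodule.add_mem_sup ⟨_, map_mem_chainsIn f hA ha, bdry_map f (n + 1) a⟩ (map_mem_chainsIn f hB hb))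

theorem relMap_tripleBdry (n : ℕ) {A B C : Set X} {A' B' C' : Set Y} (f : C(X, Y))
    (hA : Set.MapsTo f A A') (hB : Set.MapsTo f B B') (hC : Set.MapsTo f C C')
    (z : RelHomology (n + 1) A B) :
    relMap n f hB hC (tripleBdry n A B C z) = tripleBdry n A' B' C' (relMap (n + 1) f hA hB z) := by
  induction z using Submodule.Quotient.induction_on with
  | H c =>
    refine congrArg (Submodule.Quotient.mk (p := (relBoundaries n B' C').comap _)) (Subtype.ext ?_)
    exact (bdry_map f (n + 1) c.1).symm

/-- The class of a point of `A` in `H_0(A, B)`. -/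
def ptClass {A : Set X} (B : Set X) (p : X) (hp : p ∈ A) : RelHomology 0 A B :=
  Submodule.Quotient.mk ⟨Finsupp.single (ContinuousMap.const _ p) 1, by
    refine ⟨Finsupp.single_mem_supported ℤ _ ?_, by simp [bdry]⟩
    rintro _ ⟨_, rfl⟩; exact hp⟩

end Singular

/-! ### Rational representation rings -/

section RepRing

/-- Finite-dimensional rational representations of `H`. -/
abbrev FinRep (H : Type u) [Group H] : Type (u + 1) :=
  {V : Rep.{u} ℚ H // Module.Finite ℚ V}

/-- The representation ring `R_ℚ(H)`, as an abelian group: the Grothendieck group of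
finite-dimensional rational representations of `H` under direct sum. -/
abbrev RepRing (H : Type u) [Group H] : Type (u + 1) :=
  (FinRep H →₀ ℤ) ⧸ Submodule.span ℤ {z : FinRep H →₀ ℤ | ∃ V V' V'' : FinRep H,
    Nonempty (V.1 ≅ V'.1 ⊞ V''.1) ∧
      z = Finsupp.single V 1 - Finsupp.single V' 1 - Finsupp.single V'' 1}

/-- The class of a finite-dimensional representation. -/
def repClass {H : Type u} [Group H] (V : FinRep H) : RepRing H :=
  Submodule.Quotient.mk (Finsupp.single V 1)

/-- The trivial one-dimensional rational representation. -/
def trivialRep (H : Type u) [Group H] : FinRep H :=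
  ⟨Rep.of (Representation.trivial ℚ H (ULift.{u} ℚ)), by
    change Module.Finite ℚ (ULift.{u} ℚ); infer_instance⟩

variable {H K : Type u} [Group H] [Group K]

/-- Induction of representations along a homomorphism into a finite group. -/
def indRep [Finite K] (f : H →* K) (V : FinRep H) : FinRep K :=
  ⟨Rep.ind f V.1, by
    have := V.2
    have : Module.Finite ℚ (MonoidAlgebra ℚ K) :=
      Module.Finite.equiv (MonoidAlgebra.coeffLinearEquiv ℚ).symm
    change Module.Finite ℚ (Representation.IndV f V.1.ρ)
    exact Module.Finite.of_surjective (Representation.Coinvariants.mk _)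
      (Representation.Coinvariants.mk_surjective _)⟩

/-- Induction `R_ℚ(H) → R_ℚ(K)`. -/
def indR [Finite K] (f : H →* K) : RepRing H →ₗ[ℤ] RepRing K :=
  Submodule.mapQ _ _ (Finsupp.lmapDomain ℤ ℤ (indRep f)) (by
    rw [Submodule.span_le]
    rintro _ ⟨V, V', V'', ⟨e⟩, rfl⟩
    refine Submodule.subset_span ⟨indRep f V, indRep f V', indRep f V'', ⟨?_⟩, ?_⟩
    · haveI : Limits.PreservesBinaryBiproducts (Rep.indFunctor.{u} ℚ f) :=
        Limits.preservesBinaryBiproducts_of_preservesBinaryCoproducts _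
      exact (Rep.indFunctor.{u} ℚ f).mapIso e ≪≫ (Rep.indFunctor.{u} ℚ f).mapBiprod _ _
    · simp [map_sub])

end RepRing

/-! ### Rational conjugacy classes and the Hattori-Stallings rank -/

section ClassQ

/-- `con_ℚ(H)`: elements of the (finite) group `H`, where two elements are identified if the cyclic
subgroups they generate are conjugate. -/
abbrev ConQ (H : Type u) [Group H] : Type u :=
  Quotient ((MulAction.orbitRel (ConjAct H) (Subgroup H)).comap Subgroup.zpowers)

/-- `class_ℚ(H)`: the rational vector space with basis `con_ℚ(H)`. -/
abbrev ClassQ (H : Type u) [Group H] : Type u := ConQ H →₀ ℚ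

variable {H K : Type u} [Group H] [Group K]

theorem zpowers_rel {h k : H} :
    ((MulAction.orbitRel (ConjAct H) (Subgroup H)).comap Subgroup.zpowers) h k ↔
      ∃ a : H, Subgroup.zpowers (a * k * a⁻¹) = Subgroup.zpowers h := by
  rw [Setoid.comap_rel, MulAction.orbitRel_apply, MulAction.mem_orbit_iff]
  have key (a : H) : ConjAct.toConjAct a • Subgroup.zpowers k = Subgroup.zpowers (a * k * a⁻¹) := by
    exact MonoidHom.map_zpowers (MulAut.conj a).toMonoidHom k
  constructor
  · rintro ⟨a, ha⟩
    exact ⟨ConjAct.ofConjAct a, by rw [← key, ConjAct.toConjAct_ofConjAct, ha]⟩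
  · rintro ⟨a, ha⟩
    exact ⟨ConjAct.toConjAct a, by rw [key, ha]⟩

/-- The map `con_ℚ(H) → con_ℚ(K)` induced by a homomorphism. -/
def conQMap (f : H →* K) : ConQ H → ConQ K :=
  Quotient.map f (by
    intro h k hk
    obtain ⟨a, ha⟩ := zpowers_rel.1 hk
    refine zpowers_rel.2 ⟨f a, ?_⟩
    have := congrArg (Subgroup.map f) ha
    simpa [MonoidHom.map_zpowers] using this)

/-- The map `class_ℚ(H) → class_ℚ(K)` induced by a homomorphism. -/
def classMap (f : H →* K) : ClassQ H →ₗ[ℚ] ClassQ K := Finsupp.lmapDomain ℚ ℚ (conQMap f)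

/-- The projection from conjugacy classes to rational conjugacy classes. -/
def conProj : ConjClasses H → ConQ H :=
  Quotient.lift (fun h => (⟦h⟧ : ConQ H)) (by
    intro h k hk
    obtain ⟨a, ha⟩ := isConj_iff.1 hk
    exact (Quotient.sound (zpowers_rel.2 ⟨a, by rw [ha]⟩)).symm)

/-- The sum of the universal traces of the diagonal entries of a matrix over `ℚH`; for an
idempotent matrix this is the Hattori-Stallings rank of its image. -/
def univTrace {n : ℕ} (A : Matrix (Fin n) (Fin n) (MonoidAlgebra ℚ H)) : ConjClasses H →₀ ℚ :=
  ∑ i, (A i i).coeff.mapDomain ConjClasses.mk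

/-- `A` is an idempotent matrix over `ℚH` such that the image of `x ↦ x A` is isomorphic to the
`ℚH`-module `V`. -/
def Presents {n : ℕ} (A : Matrix (Fin n) (Fin n) (MonoidAlgebra ℚ H)) (V : FinRep H) : Prop :=
  A * A = A ∧ Nonempty (LinearMap.range A.vecMulLinear ≃ₗ[MonoidAlgebra ℚ H] V.1.ρ.asModule)

/-- The class in `con_ℚ(L)` of the generators of a cyclic group `L`. -/
def genClass (L : Type u) [Group L] [IsCyclic L] : ConQ L :=
  ⟦(IsCyclic.exists_generator (α := L)).choose⟧

end ClassQ


/-! ### Colimits of modules -/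

section Colim

open scoped Classical in
/-- The colimit of a covariant functor from a category `C` to `k`-modules, given by its values `M x`
on objects and `t f` on morphisms: the direct sum of all values modulo the identifications
`a ∼ t f a`. -/
abbrev Colim (k : Type*) [CommRing k] {C : Type*} [Category C] (M : C → Type*)
    [∀ x, AddCommGroup (M x)] [∀ x, Module k (M x)] (t : ∀ x y : C, (x ⟶ y) → (M x →ₗ[k] M y)) :
    Type _ :=
  (DirectSum C M) ⧸ Submodule.span k {z : DirectSum C M | ∃ (x y : C) (f : x ⟶ y) (a : M x),
    z = DirectSum.lof k C M x a - DirectSum.lof k C M y (t x y f a)}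

variable (k : Type*) [CommRing k] {C : Type*} [Category C] {M : C → Type*}
    [∀ x, AddCommGroup (M x)] [∀ x, Module k (M x)] (t : ∀ x y : C, (x ⟶ y) → (M x →ₗ[k] M y))

open scoped Classical in
/-- The structure map of the colimit at the object `x`. -/
def colimIncl (x : C) : M x →ₗ[k] Colim k M t :=
  (Submodule.mkQ _).comp (DirectSum.lof k C M x)

end Colim

/-! ### Fixed point sets, Weyl groups, path components -/

section Weyl

variable {G : Type u} [Group G] {X : Type v} [MulAction G X]

/-- The fixed point set `X^H`. -/
abbrev Fix (H : Subgroup G) (X : Type v) [MulAction G X] : Set X := {p | ∀ h ∈ H, h • p = p}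

/-- The Weyl group `WH = NH/H`. -/
abbrev Weyl (H : Subgroup G) : Type u :=
  Subgroup.normalizer (H : Set G) ⧸ H.subgroupOf (Subgroup.normalizer (H : Set G))

theorem smul_mem_fix {H : Subgroup G} (n : Subgroup.normalizer (H : Set G)) (p : Fix H X) :
    (n : G) • (p : X) ∈ Fix H X := by
  intro h hh
  have h1 : (n : G)⁻¹ * h * n ∈ H := by
    have := (Subgroup.mem_normalizer_iff.1 (n⁻¹).2 h).1 hh
    simpa using this
  have h2 := p.2 _ h1
  rw [mul_smul, mul_smul, inv_smul_eq_iff] at h2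
  exact h2

instance normalizerAction (H : Subgroup G) :
    MulAction (Subgroup.normalizer (H : Set G)) (Fix H X) where
  smul n p := ⟨(n : G) • (p : X), smul_mem_fix n p⟩
  one_smul p := Subtype.ext (one_smul G (p : X))
  mul_smul n m p := Subtype.ext (mul_smul (n : G) (m : G) (p : X))

/-- The action of `WH` on `X^H`. -/
instance weylAction (H : Subgroup G) : MulAction (Weyl H) (Fix H X) :=
  MulAction.compHom _ (QuotientGroup.lift (H.subgroupOf (Subgroup.normalizer (H : Set G)))
    (MulAction.toPermHom (Subgroup.normalizer (H : Set G)) (Fix H X)) (by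
      intro n hn
      ext p
      exact p.2 _ (Subgroup.mem_subgroupOf.1 hn)))

theorem weyl_mk_smul {H : Subgroup G} (n : Subgroup.normalizer (H : Set G)) (p : Fix H X) :
    (((n : Weyl H) • p : Fix H X) : X) = (n : G) • (p : X) := rfl

variable [TopologicalSpace X] [ContinuousConstSMul G X]

instance (H : Subgroup G) : ContinuousConstSMul (Weyl H) (Fix H X) where
  continuous_const_smul w := by
    induction w using QuotientGroup.induction_on with
    | H n => exact Continuous.subtype_mk (by fun_prop : Continuous fun p : Fix H X => (n : G) • (p : X)) _

/-- A group acting continuously on `Y` acts on `π₀(Y)`. -/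
instance pi0Action {W : Type*} [Group W] {Y : Type*} [TopologicalSpace Y] [MulAction W Y]
    [ContinuousConstSMul W Y] : MulAction W (ZerothHomotopy Y) where
  smul w := Quotient.map (w • ·) fun _ _ ⟨q⟩ => ⟨q.map (continuous_const_smul w)⟩
  one_smul := by rintro ⟨p⟩; exact congrArg _ (one_smul W p)
  mul_smul w w' := by rintro ⟨p⟩; exact congrArg _ (mul_smul w w' p)

/-- A path component `C ∈ π₀(Y)` as a space. -/
abbrev Comp {Y : Type*} [TopologicalSpace Y] (C : ZerothHomotopy Y) : Type _ :=
  {p : Y // ZerothHomotopy.mk p = C}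

/-- The isotropy group `W_C` of `C ∈ π₀(Y)` acts on the space `C`. -/
instance compAction {W : Type*} [Group W] {Y : Type*} [TopologicalSpace Y] [MulAction W Y]
    [ContinuousConstSMul W Y] (C : ZerothHomotopy Y) :
    MulAction (MulAction.stabilizer W C) (Comp C) where
  smul w p := ⟨(w : W) • (p : Y), by
    have h : (w : W) • C = C := MulAction.mem_stabilizer_iff.1 w.2
    exact (congrArg ((w : W) • ·) p.2).trans h⟩
  one_smul p := Subtype.ext (one_smul W (p : Y))
  mul_smul w w' p := Subtype.ext (mul_smul (w : W) (w' : W) (p : Y))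

/-- The set of conjugacy classes of subgroups of `G`. -/
abbrev Consub (G : Type u) [Group G] : Type u := MulAction.orbitRel.Quotient (ConjAct G) (Subgroup G)

/-- A chosen representative `H` of the conjugacy class `(H)`. -/
def Consub.rep (c : Consub G) : Subgroup G := Quotient.out c

variable (G X) in
/-- The index set `∐_{(H) ∈ consub(G)} WH \ π₀(X^H)`. -/
abbrev Idx : Type _ :=
  Σ c : Consub G, MulAction.orbitRel.Quotient (Weyl c.rep) (ZerothHomotopy (Fix c.rep X))

/-- A chosen component `C` of `X^H` representing the orbit `WH · C`. -/
def Idx.comp (j : Idx G X) : ZerothHomotopy (Fix j.1.rep X) := Quotient.out j.2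

variable (G X) in
/-- The part of the index set that belongs to finite cyclic subgroups. -/
abbrev CycIdx : Type _ := {j : Idx G X // Finite j.1.rep ∧ IsCyclic j.1.rep}

end Weyl

/-! ### The component category -/

section ComponentCategory

variable (G : Type u) [Group G] (X : Type v) [TopologicalSpace X] [MulAction G X]

/-- Objects of the component category `Π₀(G, X)`: `G`-maps `x : G/H → X`. -/
structure PiZero where
  H : Subgroup G
  map : (G ⧸ H) →[G] X

variable {G X}

/-- `G`-homotopy of `G`-maps `A → X` where `A` is a discrete `G`-set: a path in the space of `G`-maps
`A → X` with the topology of pointwise convergence. As `A` is discrete, this is the same as a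
continuous `G`-homotopy `A × [0,1] → X`. -/
def GHomotopic {A : Type*} [MulAction G A] (f f' : A →[G] X) : Prop :=
  JoinedIn {k : A → X | ∀ (g : G) (a : A), k (g • a) = g • k a} f f'

theorem GHomotopic.comp {A B : Type*} [MulAction G A] [MulAction G B] {f f' : B →[G] X}
    (h : GHomotopic f f') (s : A →[G] B) : GHomotopic (f.comp s) (f'.comp s) := by
  have h2 := JoinedIn.map h (f := fun k : B → X => k ∘ s) (by fun_prop)
  refine h2.mono ?_
  rintro _ ⟨k, hk, rfl⟩ g a
  simp [hk g (s a)]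

/-- Morphisms `x ⟶ y`: `G`-maps `s : G/H → G/K` such that `y ∘ s` and `x` are `G`-homotopic. -/
instance : Category (PiZero G X) where
  Hom x y := {s : (G ⧸ x.H) →[G] (G ⧸ y.H) // GHomotopic (y.map.comp s) x.map}
  id x := ⟨MulActionHom.id G, JoinedIn.refl fun g a => map_smul x.map g a⟩
  comp s t := ⟨t.1.comp s.1, (t.2.comp s.1).trans s.2⟩

/-- The `G`-map `G/H → G/K` underlying a morphism, i.e. the functor `Q` on morphisms. -/
def PiZero.homMap {x y : PiZero G X} (f : x ⟶ y) : (G ⧸ x.H) →[G] (G ⧸ y.H) :=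
  (f : {s : (G ⧸ x.H) →[G] (G ⧸ y.H) // GHomotopic (y.map.comp s) x.map}).1

/-- The action of `aut(y)` on `mor(y, x)` given by `(s, t) ↦ t ∘ s⁻¹`. Recall that `WK_y ≅ aut(y)`
for `y : G/K → X`, and that this is the definition of the action of `WK_y` on `mor(y, x)`. -/
instance autAction (y x : PiZero G X) : MulAction (Aut y) (y ⟶ x) where
  smul s t := s.inv ≫ t
  one_smul t := Category.id_comp t
  mul_smul s s' t := Category.assoc s.inv s'.inv t

/-- The point `x(1H) ∈ X^H` of an object `x : G/H → X`. -/
def PiZero.pt (x : PiZero G X) : Fix x.H X :=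
  ⟨x.map ((1 : G) : G ⧸ x.H), fun h hh => by
    rw [← map_smul]
    congr 1
    exact QuotientGroup.eq.2 (by simpa using hh)⟩

/-- The object `G/H → X`, `gH ↦ gp`, for a point `p ∈ X^H`. -/
def PiZero.ofPt (H : Subgroup G) (p : Fix H X) : PiZero G X where
  H := H
  map :=
    { toFun := Quotient.lift (fun g : G => g • (p : X)) (by
        intro a b hab
        have h1 : a⁻¹ * b ∈ H := QuotientGroup.leftRel_apply.1 hab
        have h2 := p.2 _ h1
        rw [mul_smul, inv_smul_eq_iff] at h2
        exact h2.symm)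
      map_smul' := by
        rintro g ⟨a⟩
        exact mul_smul g a (p : X) }

/-- The isomorphism classes of objects of `Π₀(G, X)`. -/
abbrev IsPiZero (G : Type u) [Group G] (X : Type v) [TopologicalSpace X] [MulAction G X] : Type _ :=
  Quotient (isIsomorphicSetoid (PiZero G X))

/-- The isomorphism class `[x]`. -/
def PiZero.cls (x : PiZero G X) : IsPiZero G X := Quotient.mk _ x

variable [ContinuousConstSMul G X]

/-- For an index `(H), WH · C`, a chosen object `y : G/H → X` with `X^H(y) = C`. -/
def Idx.obj (j : Idx G X) : PiZero G X := PiZero.ofPt j.1.rep (Quotient.out j.comp)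

/-- A representative `g` of `s(1H) = gK` for a `G`-map `s : G/H → G/K`. -/
def repElt {H K : Subgroup G} (s : (G ⧸ H) →[G] (G ⧸ K)) : G :=
  Quotient.out (s ((1 : G) : G ⧸ H))

theorem repElt_conj_mem {H K : Subgroup G} (s : (G ⧸ H) →[G] (G ⧸ K)) {h : G} (hh : h ∈ H) :
    (repElt s)⁻¹ * h * repElt s ∈ K := by
  have h1 : ((repElt s : G) : G ⧸ K) = s ((1 : G) : G ⧸ H) := QuotientGroup.out_eq' _
  have h2 : ((h * repElt s : G) : G ⧸ K) = ((repElt s : G) : G ⧸ K) := by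
    have h3 : h • s ((1 : G) : G ⧸ H) = s ((1 : G) : G ⧸ H) := by
      rw [← map_smul]
      congr 1
      exact QuotientGroup.eq.2 (by simpa using hh)
    rw [← h1] at h3
    exact h3
  rw [mul_assoc]
  exact QuotientGroup.eq.1 h2.symm

/-- The homomorphism `H → K`, `h ↦ g⁻¹hg`, of a `G`-map `G/H → G/K`, `1H ↦ gK`. -/
def conjHom {H K : Subgroup G} (s : (G ⧸ H) →[G] (G ⧸ K)) : H →* K where
  toFun h := ⟨(repElt s)⁻¹ * h * repElt s, repElt_conj_mem s h.2⟩
  map_one' := Subtype.ext (by simp)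
  map_mul' a b := Subtype.ext (by simp [mul_assoc])

end ComponentCategory

/-! ### Proper `G`-CW-complexes -/

open Topology (CWComplex)
open Topology.RelCWComplex (cell openCell skeletonLT)

/-- A proper `G`-CW-complex for a discrete group `G`: a CW-complex with an action of `G` by
homeomorphisms which permutes the open cells, such that an element of `G` that maps an open cell to
itself fixes it pointwise, and such that all isotropy groups are finite. -/
structure ProperGCW (G : Type u) [Group G] where
  carrier : Type v
  [top : TopologicalSpace carrier]
  [t2 : T2Space carrier]
  [action : MulAction G carrier]
  [cont : ContinuousConstSMul G carrier]
  [cw : CWComplex (Set.univ : Set carrier)]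
  perm : ∀ (g : G) (n : ℕ) (e : cell (Set.univ : Set carrier) n),
    ∃ e' : cell (Set.univ : Set carrier) n, g • openCell n e = openCell n e'
  fixes : ∀ (g : G) (n : ℕ) (e : cell (Set.univ : Set carrier) n),
    g • openCell n e = openCell n e → ∀ p ∈ openCell n e, g • p = p
  proper : ∀ p : carrier, Finite (MulAction.stabilizer G p)

namespace ProperGCW

variable {G : Type u} [Group G]

instance : CoeSort (ProperGCW.{u, v} G) (Type v) := ⟨carrier⟩

attribute [instance] top t2 action cont cw

variable (X Y : ProperGCW.{u, v} G)

/-- `X.skel n` is the `(n-1)`-skeleton `X_{n-1}`; in particular `X.skel 0 = ∅`. -/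
def skel (n : ℕ) : Set X := (skeletonLT (Set.univ : Set X) n : Set X)

/-- The set `I_n(X)` of open `n`-cells, as subsets of `X`. -/
def openCells (n : ℕ) : Set (Set X) := Set.range fun e : cell (Set.univ : Set X) n => openCell n e

/-- `X` is a finite `G`-CW-complex: there are only finitely many `G`-orbits of open cells. -/
def IsFinite : Prop :=
  {o : MulAction.orbitRel.Quotient G (Set X) | ∃ n, ∃ s ∈ X.openCells n, o = Quotient.mk _ s}.Finite

instance finite_obj (x : PiZero G X) : Finite x.H :=
  haveI := X.proper (x.pt : X)
  Finite.of_injective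
    (fun h : x.H => (⟨h, MulAction.mem_stabilizer_iff.2 (x.pt.2 _ h.2)⟩ :
      MulAction.stabilizer G (x.pt : X)))
    fun _ _ hab => Subtype.ext (congrArg (fun z => (z.1 : G)) hab)

theorem smul_mem_skel {n : ℕ} (g : G) {p : X} (hp : p ∈ X.skel n) : g • p ∈ X.skel n := by
  unfold skel at *
  rw [← Topology.CWComplex.iUnion_openCell_eq_skeletonLT] at *
  simp only [Set.mem_iUnion] at *
  obtain ⟨m, hm, e, he⟩ := hp
  obtain ⟨e', he'⟩ := X.perm g m e
  exact ⟨m, hm, e', he' ▸ Set.smul_mem_smul_set he⟩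

/-! #### Bredon homology -/

/-- The finite subgroups `H`, i.e. the objects `G/H` of the orbit category for finite subgroups. -/
abbrev FinSub (G : Type u) [Group G] : Type u := {H : Subgroup G // Finite H}

instance (H : FinSub G) : Finite H.1 := H.2

/-- The cellular chain group `C_n(X^H) = H_n((X_n)^H, (X_{n-1})^H; ℤ)`. -/
abbrev CellChain (n : ℕ) (H : Subgroup G) : Type v :=
  RelHomology n (X.skel (n + 1) ∩ Fix H X) (X.skel n ∩ Fix H X)

/-- The cellular boundary operator of `X^H`. -/
def cellBdry (n : ℕ) (H : Subgroup G) : X.CellChain (n + 1) H →ₗ[ℤ] X.CellChain n H :=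
  tripleBdry n _ _ _

variable {X} in
theorem translate_mem {n : ℕ} {H K : Subgroup G} (s : (G ⧸ H) →[G] (G ⧸ K)) :
    Set.MapsTo (⟨(repElt s • ·), continuous_const_smul _⟩ : C(X, X))
      (X.skel n ∩ Fix K X) (X.skel n ∩ Fix H X) := by
  rintro p ⟨hp, hp'⟩
  refine ⟨X.smul_mem_skel _ hp, fun h hh => ?_⟩
  have h2 := hp' _ (repElt_conj_mem s hh)
  rw [mul_smul, mul_smul, inv_smul_eq_iff] at h2
  exact h2

variable {X} in
/-- The contravariant functoriality of `G/H ↦ C_n(X^H)`: a `G`-map `s : G/H → G/K`, `1H ↦ gK`,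
induces `X^K = map_G(G/K, X) → map_G(G/H, X) = X^H`, `p ↦ gp`. -/
def cellPull (n : ℕ) {H K : Subgroup G} (s : (G ⧸ H) →[G] (G ⧸ K)) :
    X.CellChain n K →ₗ[ℤ] X.CellChain n H :=
  relMap n ⟨(repElt s • ·), continuous_const_smul _⟩ (translate_mem s) (translate_mem s)

/-- The functor `R_ℚ` on morphisms: the induction `R_ℚ(H) → R_ℚ(K)` along `H → K`, `h ↦ g⁻¹hg`, for
a `G`-map `G/H → G/K`, `1H ↦ gK`. -/
def repPush {H K : Subgroup G} [Finite K] (s : (G ⧸ H) →[G] (G ⧸ K)) : RepRing H →ₗ[ℤ] RepRing K :=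
  indR (conjHom s)

/-- The summand `C_n(X^H) ⊗ R_ℚ(H)` belonging to `G/H`. -/
def BredonTerm (n : ℕ) (H : FinSub G) : Type max v (u + 1) :=
  X.CellChain n H.1 ⊗[ℤ] RepRing H.1

instance (n : ℕ) (H : FinSub G) : AddCommGroup (X.BredonTerm n H) :=
  inferInstanceAs (AddCommGroup (X.CellChain n H.1 ⊗[ℤ] RepRing H.1))

/-- The element `c ⊗ a` of `C_n(X^H) ⊗ R_ℚ(H)`. -/
def bredonTmul (n : ℕ) (H : FinSub G) (c : X.CellChain n H.1) (a : RepRing H.1) :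
    X.BredonTerm n H := (c ⊗ₜ[ℤ] a : X.CellChain n H.1 ⊗[ℤ] RepRing H.1)

open scoped Classical in
/-- The relations `(c · s) ⊗ v ∼ c ⊗ (s · v)` in the tensor product over the orbit category. -/
def bredonRel (n : ℕ) : Submodule ℤ (DirectSum (FinSub G) (X.BredonTerm n)) :=
  Submodule.span ℤ {z | ∃ (H K : FinSub G) (s : (G ⧸ H.1) →[G] (G ⧸ K.1)) (c : X.CellChain n K.1)
    (a : RepRing H.1),
    z = DirectSum.lof ℤ (FinSub G) (X.BredonTerm n) H (X.bredonTmul n H (cellPull n s c) a)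
      - DirectSum.lof ℤ (FinSub G) (X.BredonTerm n) K (X.bredonTmul n K c (repPush s a))}

/-- The Bredon chain group `C_n(X^-) ⊗_{ℤOr(G; Fin)} R_ℚ`. -/
abbrev BredonChain (n : ℕ) : Type max v (u + 1) :=
  DirectSum (FinSub G) (X.BredonTerm n) ⧸ X.bredonRel n

open scoped Classical in
/-- The element of the Bredon chain group represented by `c ⊗ a` at `G/H`. -/
def bredonMk (n : ℕ) (H : FinSub G) (c : X.CellChain n H.1) (a : RepRing H.1) : X.BredonChain n :=
  Submodule.Quotient.mk (DirectSum.lof ℤ (FinSub G) (X.BredonTerm n) H (X.bredonTmul n H c a))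

variable {X Y} in
/-- The map `C_n(X^H) ⊗ R_ℚ(H) → C_m(Y^H) ⊗ R_ℚ(H)` induced by a map of cellular chain groups. -/
def termMap {n m : ℕ} {H : FinSub G} (t : X.CellChain n H.1 →ₗ[ℤ] Y.CellChain m H.1) :
    X.BredonTerm n H →ₗ[ℤ] Y.BredonTerm m H :=
  (t.rTensor (RepRing H.1) :
    X.CellChain n H.1 ⊗[ℤ] RepRing H.1 →ₗ[ℤ] Y.CellChain m H.1 ⊗[ℤ] RepRing H.1)

variable {X Y} in
/-- The map of Bredon chain groups induced by maps of cellular chain groups that are natural in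
`G/H`. -/
def bredonInd {n m : ℕ} (t : ∀ H : FinSub G, X.CellChain n H.1 →ₗ[ℤ] Y.CellChain m H.1)
    (ht : ∀ (H K : FinSub G) (s : (G ⧸ H.1) →[G] (G ⧸ K.1)) (c : X.CellChain n K.1),
      t H (cellPull n s c) = cellPull m s (t K c)) :
    X.BredonChain n →ₗ[ℤ] Y.BredonChain m :=
  Submodule.mapQ _ _ (DirectSum.lmap fun H => termMap (t H)) (by
    unfold bredonRel
    rw [Submodule.span_le]
    rintro _ ⟨H, K, s, c, a, rfl⟩
    refine Submodule.subset_span ⟨H, K, s, t K c, a, ?_⟩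
    rw [map_sub, DirectSum.lmap_lof, DirectSum.lmap_lof, ← ht]
    rfl)

theorem cellPull_cellBdry (n : ℕ) (H K : FinSub G) (s : (G ⧸ H.1) →[G] (G ⧸ K.1))
    (c : X.CellChain (n + 1) K.1) :
    X.cellBdry n H.1 (cellPull (n + 1) s c) = cellPull n s (X.cellBdry n K.1 c) :=
  (relMap_tripleBdry n _ _ _ (translate_mem s) c).symm

/-- The boundary operator of the Bredon chain complex. -/
def bredonBdry (n : ℕ) : X.BredonChain (n + 1) →ₗ[ℤ] X.BredonChain n :=
  bredonInd (fun H => X.cellBdry n H.1) (X.cellPull_cellBdry n)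

/-- The zeroth Bredon homology `H_0^{Or(G)}(X; R_ℚ)`, the cokernel of the boundary operator from
degree one to degree zero. -/
abbrev BredonH0 : Type _ := X.BredonChain 0 ⧸ LinearMap.range (X.bredonBdry 0)

/-- For a point `p` of the `0`-skeleton of `X^H` and `v ∈ R_ℚ(H)`, the class of `[p] ⊗ v` in
`H_0^{Or(G)}(X; R_ℚ)`. This is the image of `v` under
`R_ℚ(H) = H_0^{Or(G)}(G/H; R_ℚ) → H_0^{Or(G)}(X; R_ℚ)`, where the map is induced by the cellular
`G`-map `G/H → X`, `gH ↦ gp`. -/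
def ptBredon (H : FinSub G) (p : X) (hp : p ∈ X.skel 1 ∩ Fix H.1 X) (a : RepRing H.1) :
    X.BredonH0 :=
  Submodule.Quotient.mk (X.bredonMk 0 H (ptClass _ p hp) a)

/-- A (continuous) `G`-map. -/
structure GMap where
  toMap : C(X, Y)
  map_smul : ∀ (g : G) (p : X), toMap (g • p) = g • toMap p

variable {X Y}

/-- A `G`-map is cellular if it maps `X_n` to `Y_n` for all `n`. -/
def GMap.Cellular (f : GMap X Y) : Prop := ∀ n, Set.MapsTo f.toMap (X.skel n) (Y.skel n)

/-- `G`-homotopy of `G`-maps. -/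
def GMap.Homotopic (f f' : GMap X Y) : Prop :=
  f.toMap.HomotopicWith f'.toMap fun k => ∀ (g : G) (p : X), k (g • p) = g • k p

theorem GMap.mapsTo_fix (f : GMap X Y) (H : Subgroup G) :
    Set.MapsTo f.toMap (Fix H X) (Fix H Y) := fun p hp h hh => by
  rw [← f.map_smul, hp h hh]

/-- The map induced by a cellular `G`-map on cellular chains of fixed point sets. -/
def GMap.cellMap (f : GMap X Y) (hf : f.Cellular) (n : ℕ) (H : Subgroup G) :
    X.CellChain n H →ₗ[ℤ] Y.CellChain n H :=
  relMap n f.toMap ((hf (n + 1)).inter_inter (f.mapsTo_fix H)) ((hf n).inter_inter (f.mapsTo_fix H))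

theorem relMap_comp {n : ℕ} {X Y Z : Type*} [TopologicalSpace X] [TopologicalSpace Y]
    [TopologicalSpace Z] {A B : Set X} {A' B' : Set Y} {A'' B'' : Set Z} (f : C(X, Y)) (k : C(Y, Z))
    (hA : Set.MapsTo f A A') (hB : Set.MapsTo f B B') (hA' : Set.MapsTo k A' A'')
    (hB' : Set.MapsTo k B' B'') (z : RelHomology n A B) :
    relMap n k hA' hB' (relMap n f hA hB z)
      = relMap n (k.comp f) (hA'.comp hA) (hB'.comp hB) z := by
  induction z using Submodule.Quotient.induction_on with
  | H c =>
    refine congrArg (Submodule.Quotient.mk (p := (relBoundaries n A'' B'').comap _))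
      (Subtype.ext ?_)
    exact (Finsupp.mapDomain_comp (f := f.comp) (g := k.comp) (v := c.1)).symm

theorem relMap_congr {n : ℕ} {X Y : Type*} [TopologicalSpace X] [TopologicalSpace Y]
    {A B : Set X} {A' B' : Set Y} {f k : C(X, Y)} (h : f = k) (hA : Set.MapsTo f A A')
    (hB : Set.MapsTo f B B') (hA' : Set.MapsTo k A A') (hB' : Set.MapsTo k B B')
    (z : RelHomology n A B) : relMap n f hA hB z = relMap n k hA' hB' z := by
  subst h; rfl

/-- The map of Bredon chain groups induced by a cellular `G`-map. -/
def GMap.bredonMap (f : GMap X Y) (hf : f.Cellular) (n : ℕ) : X.BredonChain n →ₗ[ℤ] Y.BredonChain n :=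
  bredonInd (fun H => f.cellMap hf n H.1) (fun H K s c => by
    unfold GMap.cellMap cellPull
    rw [relMap_comp, relMap_comp]
    have key : f.toMap.comp (⟨(repElt s • ·), continuous_const_smul _⟩ : C(X, X))
        = (⟨(repElt s • ·), continuous_const_smul _⟩ : C(Y, Y)).comp f.toMap :=
      ContinuousMap.ext fun p => f.map_smul _ p
    exact relMap_congr key _ _ _ _ _)

theorem bredonInd_comp {X Y Z : ProperGCW.{u, v} G} {n m l : ℕ}
    (t : ∀ H : FinSub G, X.CellChain n H.1 →ₗ[ℤ] Y.CellChain m H.1)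
    (ht : ∀ (H K : FinSub G) (s : (G ⧸ H.1) →[G] (G ⧸ K.1)) (c : X.CellChain n K.1),
      t H (cellPull n s c) = cellPull m s (t K c))
    (t' : ∀ H : FinSub G, Y.CellChain m H.1 →ₗ[ℤ] Z.CellChain l H.1)
    (ht' : ∀ (H K : FinSub G) (s : (G ⧸ H.1) →[G] (G ⧸ K.1)) (c : Y.CellChain m K.1),
      t' H (cellPull m s c) = cellPull l s (t' K c)) (z : X.BredonChain n) :
    bredonInd t' ht' (bredonInd t ht z)
      = bredonInd (fun H => (t' H).comp (t H)) (fun H K s c => by simp [ht, ht']) z := by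
  induction z using Submodule.Quotient.induction_on with
  | H c =>
    refine congrArg (Submodule.Quotient.mk (p := Z.bredonRel l)) ?_
    refine DFinsupp.ext fun H => ?_
    exact (LinearMap.rTensor_comp_apply (RepRing H.1) (t' H) (t H) (c H)).symm

/-- The map `H_0^{Or(G)}(X; R_ℚ) → H_0^{Or(G)}(Y; R_ℚ)` induced by a cellular `G`-map `X → Y`. -/
def GMap.bredonH0Map (f : GMap X Y) (hf : f.Cellular) : X.BredonH0 →ₗ[ℤ] Y.BredonH0 :=
  Submodule.mapQ _ _ (f.bredonMap hf 0) (by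
    rintro _ ⟨z, rfl⟩
    refine ⟨f.bredonMap hf 1 z, ?_⟩
    unfold GMap.bredonMap bredonBdry
    rw [bredonInd_comp, bredonInd_comp]
    congr 1
    congr 1
    funext H
    refine LinearMap.ext fun c => ?_
    exact (relMap_tripleBdry 0 f.toMap _ _ ((hf 0).inter_inter (f.mapsTo_fix H.1)) c).symm)

/-! #### Colimits over the component category -/

variable (X)

/-- The colimit of `Q^* R_ℚ` over `Π₀(G, X)`. -/
abbrev RepColim : Type max v (u + 1) :=
  Colim ℤ (C := PiZero G X) (fun x => RepRing x.H) fun _ _ f => repPush (PiZero.homMap f)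

/-- The colimit of `Q^* class_ℚ` over `Π₀(G, X)`. -/
abbrev ClassColim : Type max u v :=
  Colim ℚ (C := PiZero G X) (fun x => ClassQ x.H) fun _ _ f => classMap (conjHom (PiZero.homMap f))

variable {X}

/-- The structure map `R_ℚ(H) → colim` of an object `x : G/H → X`. -/
def repIncl (x : PiZero G X) : RepRing x.H →ₗ[ℤ] X.RepColim :=
  colimIncl ℤ (C := PiZero G X) (M := fun x => RepRing x.H)
    (fun _ _ f => repPush (PiZero.homMap f)) x

/-- The structure map `class_ℚ(H) → colim` of an object `x : G/H → X`. -/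
def classIncl (x : PiZero G X) : ClassQ x.H →ₗ[ℚ] X.ClassColim :=
  colimIncl ℚ (C := PiZero G X) (M := fun x => ClassQ x.H)
    (fun _ _ f => classMap (conjHom (PiZero.homMap f))) x

/-- For `(L), WL · C` with `L` finite cyclic, the element of the colimit of `Q^* class_ℚ` represented
at `y : G/L → X`, where `X^L(y) = C`, by the class in `con_ℚ(L)` of the generators of `L`. -/
def genElt (j : CycIdx G X) : X.ClassColim :=
  haveI : IsCyclic j.1.obj.H := j.2.2
  classIncl j.1.obj (Finsupp.single (genClass j.1.obj.H) 1)

variable (X) in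
/-- The automorphism `D^G(X)`, multiplication by `|Gen(L)| / |L|` on the summands belonging to
`L`. -/
def dMap : (CycIdx G X →₀ ℚ) →ₗ[ℚ] (CycIdx G X →₀ ℚ) :=
  Finsupp.linearCombination ℚ fun j => Finsupp.single j
    ((Nat.card {l : j.1.1.rep // Subgroup.zpowers l = ⊤} : ℚ) / Nat.card j.1.1.rep)

variable (X) in
/-- The projection onto the summands belonging to finite cyclic subgroups. -/
def pr : (Idx G X →₀ ℚ) →ₗ[ℚ] (CycIdx G X →₀ ℚ) :=
  Finsupp.lcomapDomain Subtype.val Subtype.val_injective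

/-! #### Universal equivariant Euler characteristic, character map, orbifold Euler characteristic -/

variable (X) in
/-- The group `U^G(X) = ℤ[Is Π₀(G, X)]`. -/
abbrev U : Type max u v := IsPiZero G X →₀ ℤ

/-- The component `ch^G(X)([x])_{[y]}` of the character map, for `y : G/K → X` with `X^K(y) = C`:
the sum of `|(WK_y)_s|⁻¹` over the orbits `WK_y · s` in `mor(y, x)`. -/
def chComponent (x : PiZero G X) (j : Idx G X) : ℚ :=
  ∑ᶠ o : MulAction.orbitRel.Quotient (Aut j.obj) (j.obj ⟶ x),
    (Nat.card (MulAction.stabilizer (Aut j.obj) (Quotient.out o)) : ℚ)⁻¹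

variable (X) in
/-- The open `n`-cells of (the CW-complex) `C`, for a path component `C` of `X^H`: those open cells
of `X` that are contained in `C`. -/
def compCells (H : Subgroup G) (C : ZerothHomotopy (Fix H X)) (n : ℕ) : Set (Set (Comp C)) :=
  {s | (fun p : Comp C => ((p : Fix H X) : X)) '' s ∈ X.openCells n}

variable (X) in
/-- The subset `C ∩ X^{>H}` of `C`, where `X^{>H}` consists of the points whose isotropy group
properly contains `H`. -/
def compSing (H : Subgroup G) (C : ZerothHomotopy (Fix H X)) : Set (Comp C) :=
  {p | H < MulAction.stabilizer G ((p : Fix H X) : X)}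

/-- The orbifold Euler characteristic `∑ (-1)^n ∑ |W_e|⁻¹` of a proper cocompact `W`-CW-complex `Y`,
where the inner sum runs over the `W`-orbits `W · e` of open `n`-cells, given the sets `I n` of its
open `n`-cells. -/
def orbifoldEuler (W : Type*) [Group W] {Y : Type*} [MulAction W Y] (I : ℕ → Set (Set Y)) : ℚ :=
  ∑ᶠ n : ℕ, (-1 : ℚ) ^ n *
    ∑ᶠ o ∈ {o : MulAction.orbitRel.Quotient W (Set Y) | ∃ s ∈ I n, o = Quotient.mk _ s},
      (Nat.card (MulAction.stabilizer W (Quotient.out o : Set Y)) : ℚ)⁻¹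

/-- The Euler characteristic of the pair `(W\Y, W\Z)` of finite CW-complexes: the alternating sum of
the numbers of open cells of `W\Y` that are not in `W\Z`, where the open cells of `W\Y` are the
images of those of `Y`. -/
def quotientEuler (W : Type*) [Group W] {Y : Type*} [MulAction W Y] (I : ℕ → Set (Set Y))
    (Z : Set Y) : ℤ :=
  ∑ᶠ n : ℕ, (-1 : ℤ) ^ n *
    ({t : Set (MulAction.orbitRel.Quotient W Y) |
      ∃ s ∈ I n, Disjoint s Z ∧ t = (Quotient.mk _) '' s}.ncard : ℤ)

/-- The component of the universal equivariant Euler characteristic `χ^G(X)` at `[x : G/H → X]`: the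
Euler characteristic of the pair `(WH_x\X^H(x), WH_x\X^{>H}(x))`. -/
def chiComponent (x : PiZero G X) : ℤ :=
  quotientEuler (MulAction.stabilizer (Weyl x.H) (ZerothHomotopy.mk x.pt))
    (X.compCells x.H (ZerothHomotopy.mk x.pt)) (X.compSing x.H (ZerothHomotopy.mk x.pt))

variable (X) in
/-- The orbifold Euler characteristic `χ^{ℚWH_C}(C)` of a path component `C` of `X^H`. -/
def compEuler (H : Subgroup G) (C : ZerothHomotopy (Fix H X)) : ℚ :=
  orbifoldEuler (MulAction.stabilizer (Weyl H) C) (X.compCells H C)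

/-! #### Functoriality of the index sets -/

/-- The map `π₀(X^H) → π₀(Y^H)` induced by a `G`-map. -/
def GMap.pi0Map (f : GMap X Y) (H : Subgroup G) :
    ZerothHomotopy (Fix H X) → ZerothHomotopy (Fix H Y) :=
  Quotient.map (fun p => ⟨f.toMap p, f.mapsTo_fix H p.2⟩) fun _ _ ⟨q⟩ =>
    ⟨q.map (f := fun p : Fix H X => (⟨f.toMap p, f.mapsTo_fix H p.2⟩ : Fix H Y)) (by fun_prop)⟩

theorem GMap.pi0Map_smul (f : GMap X Y) (H : Subgroup G) (w : Weyl H)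
    (C : ZerothHomotopy (Fix H X)) : f.pi0Map H (w • C) = w • f.pi0Map H C := by
  induction w using QuotientGroup.induction_on with
  | H n =>
    obtain ⟨p, rfl⟩ := ZerothHomotopy.mk_surjective C
    exact congrArg ZerothHomotopy.mk (Subtype.ext (f.map_smul n p))

/-- The map of index sets induced by a `G`-map; it sends `(H), WH · C` to `(H), WH · C'` where `C'`
is the component of `Y^H` that contains `f(C)`. -/
def GMap.idxMap (f : GMap X Y) (j : Idx G X) : Idx G Y :=
  ⟨j.1, Quotient.map (f.pi0Map j.1.rep) (by
    rintro C C' ⟨w, rfl⟩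
    exact ⟨w, (f.pi0Map_smul _ w C').symm⟩) j.2⟩

/-- The restriction of `idxMap` to the part belonging to finite cyclic subgroups. -/
def GMap.cycMap (f : GMap X Y) (j : CycIdx G X) : CycIdx G Y := ⟨f.idxMap j.1, j.2⟩

end ProperGCW

end

end EquivEuler

open EquivEuler

/-!
The three constituents of `γ` are isomorphisms for independent reasons.

*The map `β`.* The group `H₀` is presented by generators `p ⊗ a`, with `p` a vertex of some `X^H`
and `a ∈ R_ℚ(H)`, subject to the relations of the balanced tensor product and those given by paths
in the `1`-skeleton of `X^H`. The colimit has the same presentation with all points and all paths of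
`X^H`. Hence `β` is an isomorphism because every point of `X^H` is joined to a vertex
(`exists_joinedIn_vertex`) and vertices joined in `X^H` are joined in its `1`-skeleton
(`joinedIn_oneSkeleton`). The latter is proved without simplicial approximation, by a connectedness
argument: cells of dimension at least two have connected boundary, so that the part of the complex
attached to a path component of the `1`-skeleton is closed with closed complement (`betaEquiv`).

*The map `HS`.* The Hattori-Stallings rank of `V` in `class_ℚ(H)` is `|H|⁻¹ ∑ χ_V(h) [h]`
(`univTrace_eq_hsElt`), which is compatible with induction (`hsElt_indRep`). It determines `χ_V`,
since rational characters agree on elements that generate the same cyclic group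
(`character_eq_of_zpowers_eq`, by Dirichlet's theorem on primes), and `χ_V` determines the class of
`V` in `R_ℚ(H)` by complete reducibility (`repClass_eq_of_character_eq`). The ranks of the
permutation modules `ℚ[H/⟨h⟩]` span `class_ℚ(H)` (`single_mem_span_hattoriStallings`). Therefore
`ℚ ⊗ R_ℚ(H) ≅ class_ℚ(H)` already before passing to colimits (`ratEquiv`, `hsEquiv`).

*The map `α`.* Its inverse sends the class of `h ∈ H` at `x : G/H → X` to the index of the
restriction `G/⟨h⟩ → X` of `x` (`alphaEquiv`, `genElt_cycIdx`).

The map `ch` becomes an isomorphism because it is unitriangular with respect to the order of the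
isotropy group: an endomorphism in the component category is an isomorphism, and a morphism that is
not an isomorphism strictly increases this order (`charMap_bijective`).

By these descriptions the formula for `e₁` reduces to a count: given `x : G/H → X` and `y : G/L → X`
with `L` cyclic, the number of elements `h ∈ H` for which `G/⟨h⟩ → X` is isomorphic to `y` is
`|H| |Gen(L)| / |L|` times the component at `y` of `ch [x]`. Both sides count orbits of `aut(y)` on
the pairs of such an `h` and an isomorphism from `y` to `G/⟨h⟩ → X`. This action is free, and the
equivariant map to `mor(y, x)` has fibres of constant size (`card_cycPair_fibre`,
`card_cycIdx_eq`).

For finite `X` one has `χ^G(X) = ∑ (-1)^n [x_e]`, summed over the `G`-orbits of cells `e`, where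
`x_e : G/G_e → X` is the orbit of a point of `e` (`ncard_cells_eq`). The cells of the orbit `G e`
that lie in a component `C` correspond equivariantly to the morphisms from the object of `C` to
`x_e`, so that the components of `ch (χ^G(X))` are the orbifold Euler characteristics
(`finsum_compCells`, `exists_euler`). The formula for `e₁` then gives the assertion on `γ`.
Naturality of `γ` follows from the effect of `G`-maps on the generators (`gammaEquiv_natural`).
-/

namespace EquivEuler

noncomputable section

/-! ### Paths in subcomplexes -/

section CellPaths

open Topology Set
open Topology.RelCWComplex (cell openCell closedCell cellFrontier skeletonLT)

variable {X : Type*} [TopologicalSpace X] [CWComplex (univ : Set X)] {F : Set X}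

theorem exists_mem_openCell (x : X) : ∃ (n : ℕ) (e : cell (univ : Set X) n), x ∈ openCell n e := by
  have := CWComplex.iUnion_openCell_eq_complex (C := (univ : Set X))
  have hx : x ∈ (univ : Set X) := mem_univ x
  rw [← this] at hx
  simpa using hx

theorem isPathConnected_closedCell {n : ℕ} (e : cell (univ : Set X) n) :
    IsPathConnected (closedCell n e) :=
  ((convex_closedBall (0 : Fin n → ℝ) 1).isPathConnected
    ⟨0, Metric.mem_closedBall_self zero_le_one⟩).image' (RelCWComplex.continuousOn n e)

theorem isPreconnected_cellFrontier {n : ℕ} (hn : 2 ≤ n) (e : cell (univ : Set X) n) :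
    IsPreconnected (cellFrontier n e) :=
  (isPreconnected_sphere (by rw [rank_fin_fun]; exact_mod_cast hn) (0 : Fin n → ℝ) 1).image _
    ((RelCWComplex.continuousOn n e).mono Metric.sphere_subset_closedBall)

variable [T2Space X]

/-- A closed union of open cells contains with each open cell its closure. -/
theorem closedCell_subset_of_mem (hF : IsClosed F)
    (hcell : ∀ n (e : cell (univ : Set X) n), ∀ x ∈ openCell n e, x ∈ F → openCell n e ⊆ F)
    {n : ℕ} {e : cell (univ : Set X) n} {x : X} (hx : x ∈ openCell n e) (hxF : x ∈ F) :
    closedCell n e ⊆ F := by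
  rw [← RelCWComplex.closure_openCell_eq_closedCell]
  exact closure_minimal (hcell n e x hx hxF) hF

/-- Every point of a subcomplex can be joined, inside the subcomplex, to a vertex: move to the
boundary of the cell and use induction on the dimension. -/
theorem exists_joinedIn_vertex (hF : IsClosed F)
    (hcell : ∀ n (e : cell (univ : Set X) n), ∀ x ∈ openCell n e, x ∈ F → openCell n e ⊆ F)
    {p : X} (hp : p ∈ F) :
    ∃ q ∈ (skeletonLT (univ : Set X) ((1 : ℕ) : ℕ∞) : Set X) ∩ F, JoinedIn F p q := by
  obtain ⟨n, e, he⟩ := exists_mem_openCell p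
  induction n using Nat.strong_induction_on generalizing p with
  | _ n ih =>
    rcases Nat.eq_zero_or_pos n with rfl | hn
    · refine ⟨p, ⟨?_, hp⟩, JoinedIn.refl hp⟩
      exact CWComplex.mem_skeletonLT_iff.2 ⟨0, by simp, e, he⟩
    · have hsub := closedCell_subset_of_mem hF hcell he hp
      obtain ⟨y, hy⟩ := RelCWComplex.nonempty_cellFrontier hn.ne' e
      obtain ⟨I, hI⟩ := CWComplex.cellFrontier_subset_finite_openCell n e
      have hy' := hI hy
      simp only [mem_iUnion] at hy'
      obtain ⟨m, hm, e', -, hye'⟩ := hy'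
      have hyc := RelCWComplex.cellFrontier_subset_closedCell n e hy
      obtain ⟨q, hq, hyq⟩ := ih m hm (hsub hyc) e' hye'
      exact ⟨q, hq, (((isPathConnected_closedCell e).joinedIn p
        (RelCWComplex.openCell_subset_closedCell n e he) y hyc).mono hsub).trans hyq⟩

/-- The points of the subcomplex `F` that are reached from `p` by a path in the `1`-skeleton of `F`,
followed by successively entering higher cells through points of their boundary. -/
inductive Reach (F : Set X) (p : X) : X → Prop
  | base {x : X} (h : JoinedIn (skeletonLT (univ : Set X) ((2 : ℕ) : ℕ∞) ∩ F) p x) : Reach F p x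
  | step {n : ℕ} (hn : 2 ≤ n) {e : cell (univ : Set X) n} (he : openCell n e ⊆ F) {x y : X}
      (hy : y ∈ cellFrontier n e) (hx : x ∈ openCell n e) (h : Reach F p y) : Reach F p x

theorem Reach.mem {p x : X} (h : Reach F p x) : x ∈ F := by
  cases h with
  | base h => exact h.target_mem.2
  | step hn he hy hx h => exact he hx

theorem Reach.joinedIn {p x : X} (h : Reach F p x)
    (hx : x ∈ (skeletonLT (univ : Set X) ((2 : ℕ) : ℕ∞) : Set X)) :
    JoinedIn (skeletonLT (univ : Set X) ((2 : ℕ) : ℕ∞) ∩ F) p x := by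
  cases h with
  | base h => exact h
  | step hn he hy hx' h =>
    exact absurd hx' (disjoint_left.1
      (RelCWComplex.disjoint_skeletonLT_openCell (by exact_mod_cast hn)) hx)

/-- The set of reached points and its complement in `F` meet every closed cell in a closed set:
a cell of dimension at least two has connected boundary, so that it is reached either completely or
not at all. -/
theorem isClosed_reach_inter_closedCell (hF : IsClosed F)
    (hcell : ∀ n (e : cell (univ : Set X) n), ∀ x ∈ openCell n e, x ∈ F → openCell n e ⊆ F)
    (p : X) (n : ℕ) (e : cell (univ : Set X) n) :
    IsClosed ({x | Reach F p x} ∩ closedCell n e) ∧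
      IsClosed ((F \ {x | Reach F p x}) ∩ closedCell n e) := by
  induction n using Nat.case_strong_induction_on with
  | hz =>
    rw [RelCWComplex.closedCell_zero_eq_singleton]
    exact ⟨isClosed_inter_singleton, isClosed_inter_singleton⟩
  | hi n ih =>
    have h1 := CWComplex.isClosed_inter_cellFrontier_succ_of_le_isClosed_inter_closedCell
      (fun m hm j => (ih m hm j).1) e
    have h2 := CWComplex.isClosed_inter_cellFrontier_succ_of_le_isClosed_inter_closedCell
      (fun m hm j => (ih m hm j).2) e
    -- it suffices that the reached set contains the closed cell or misses it
    have allOrNone (hsub : closedCell (n + 1) e ⊆ F)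
        (h : (∀ x ∈ closedCell (n + 1) e, Reach F p x) ∨
          ∀ x ∈ closedCell (n + 1) e, ¬ Reach F p x) :
        IsClosed ({x | Reach F p x} ∩ closedCell (n + 1) e) ∧
          IsClosed ((F \ {x | Reach F p x}) ∩ closedCell (n + 1) e) := by
      have hc : IsClosed (closedCell (n + 1) e) := RelCWComplex.isClosed_closedCell
      rcases h with h | h
      · rw [inter_eq_right.2 (show closedCell (n + 1) e ⊆ {x | Reach F p x} from h),
          show (F \ {x | Reach F p x}) ∩ closedCell (n + 1) e = ∅ from
          eq_empty_of_forall_notMem fun x hx => hx.1.2 (h x hx.2)]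
        exact ⟨hc, isClosed_empty⟩
      · rw [inter_eq_right.2 (show closedCell (n + 1) e ⊆ F \ {x | Reach F p x} from
            fun x hx => ⟨hsub hx, h x hx⟩),
          show {x | Reach F p x} ∩ closedCell (n + 1) e = ∅ from
          eq_empty_of_forall_notMem fun x hx => h x hx.2 hx.1]
        exact ⟨isClosed_empty, hc⟩
    by_cases hne : ∃ x ∈ openCell (n + 1) e, x ∈ F
    · obtain ⟨x₀, hx₀, hx₀F⟩ := hne
      have hsub := closedCell_subset_of_mem hF hcell hx₀ hx₀F
      refine allOrNone hsub ?_
      rcases Nat.eq_zero_or_pos n with rfl | hn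
      · have hsub2 : closedCell (0 + 1) e ⊆
            (skeletonLT (univ : Set X) ((2 : ℕ) : ℕ∞) : Set X) ∩ F := fun x hx =>
          ⟨RelCWComplex.closedCell_subset_skeletonLT 1 e hx, hsub hx⟩
        by_cases h : ∃ x ∈ closedCell (0 + 1) e, Reach F p x
        · obtain ⟨x, hx, hr⟩ := h
          refine Or.inl fun y hy => Reach.base ((hr.joinedIn (hsub2 hx).1).trans ?_)
          exact ((isPathConnected_closedCell e).joinedIn x hx y hy).mono hsub2
        · exact Or.inr fun x hx hr => h ⟨x, hx, hr⟩
      · have hfr : cellFrontier (n + 1) e ⊆ F :=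
          (RelCWComplex.cellFrontier_subset_closedCell _ e).trans hsub
        have hn2 : 2 ≤ n + 1 := by omega
        have hpre := isPreconnected_iff_subset_of_disjoint_closed.1
          (isPreconnected_cellFrontier hn2 e) _ _ h1 h2
          (fun x hx => by
            by_cases hr : Reach F p x
            · exact Or.inl ⟨hr, hx⟩
            · exact Or.inr ⟨⟨hfr hx, hr⟩, hx⟩)
          (eq_empty_of_forall_notMem fun x hx => hx.2.2.1.2 hx.2.1.1)
        rw [← RelCWComplex.cellFrontier_union_openCell_eq_closedCell]
        rcases hpre with h | h
        · refine Or.inl fun x hx => hx.elim (fun hx => (h hx).1) fun hx => ?_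
          obtain ⟨y, hy⟩ := RelCWComplex.nonempty_cellFrontier (Nat.succ_ne_zero n) e
          exact Reach.step hn2 (hcell _ e x₀ hx₀ hx₀F) hy hx (h hy).1
        · refine Or.inr fun x hx hr => hx.elim (fun hx => (h hx).1.2 hr) fun hx => ?_
          cases hr with
          | base hj =>
            exact disjoint_left.1 (RelCWComplex.disjoint_skeletonLT_openCell
              (by exact_mod_cast hn2)) hj.target_mem.1 hx
          | step hn' he' hy' hx' hr' =>
            have := RelCWComplex.eq_of_not_disjoint_openCell (not_disjoint_iff.2 ⟨x, hx, hx'⟩)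
            cases this
            exact (h hy').1.2 hr'
    · have hdisj (A : Set X) (hA : A ⊆ F) :
          A ∩ closedCell (n + 1) e = A ∩ cellFrontier (n + 1) e := by
        rw [← RelCWComplex.cellFrontier_union_openCell_eq_closedCell, inter_union_distrib_left,
          union_eq_left]
        exact fun x hx => absurd ⟨x, hx.2, hA hx.1⟩ hne
      rw [hdisj {x | Reach F p x} fun x hx => Reach.mem hx, hdisj _ sdiff_subset]
      exact ⟨h1, h2⟩

/-- Cellular approximation of paths in a subcomplex: points of the `1`-skeleton that are joined in
the subcomplex are joined in its `1`-skeleton. -/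
theorem joinedIn_oneSkeleton (hF : IsClosed F)
    (hcell : ∀ n (e : cell (univ : Set X) n), ∀ x ∈ openCell n e, x ∈ F → openCell n e ⊆ F)
    {p q : X} (hp : p ∈ (skeletonLT (univ : Set X) ((2 : ℕ) : ℕ∞) : Set X))
    (hq : q ∈ (skeletonLT (univ : Set X) ((2 : ℕ) : ℕ∞) : Set X)) (h : JoinedIn F p q) :
    JoinedIn (skeletonLT (univ : Set X) ((2 : ℕ) : ℕ∞) ∩ F) p q := by
  have key := isClosed_reach_inter_closedCell hF hcell p
  have c1 : IsClosed {x | Reach F p x} :=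
    (CWComplex.closed univ _ (subset_univ _)).2 fun n e => (key n e).1
  have c2 : IsClosed (F \ {x | Reach F p x}) :=
    (CWComplex.closed univ _ (subset_univ _)).2 fun n e => (key n e).2
  have hpr : Reach F p p := Reach.base (JoinedIn.refl ⟨hp, h.source_mem⟩)
  obtain ⟨γ, hγ⟩ := h
  have hpre := isPreconnected_iff_subset_of_disjoint_closed.1
    (isPreconnected_range γ.continuous) _ _ c1 c2
    (by
      rintro _ ⟨t, rfl⟩
      by_cases hr : Reach F p (γ t)
      · exact Or.inl hr
      · exact Or.inr ⟨hγ t, hr⟩)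
    (eq_empty_of_forall_notMem fun x hx => hx.2.2.2 hx.2.1)
  rcases hpre with h | h
  · exact Reach.joinedIn (h ⟨1, γ.target⟩) hq
  · exact absurd hpr (h ⟨0, γ.source⟩).2

end CellPaths

/-! ### Vertices and paths in fixed point sets -/

namespace ProperGCW

open Topology.RelCWComplex (cell openCell skeletonLT)

variable {G : Type u} [Group G] (X Y : ProperGCW.{u, v} G)

theorem isClosed_fix (H : Subgroup G) : IsClosed (Fix H X) := by
  have h : Fix H X = ⋂ h ∈ H, {p : X | h • p = p} := by ext p; simp [Fix]
  rw [h]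
  exact isClosed_biInter fun h _ => isClosed_eq (continuous_const_smul h) continuous_id

variable {X} in
/-- If `g` moves a point of an open cell to a point of that cell, then it fixes the cell
pointwise. -/
theorem smul_eq_of_mem_openCell {n : ℕ} {e : cell (Set.univ : Set X) n} {p : X}
    (hp : p ∈ openCell n e) {g : G} (hg : g • p ∈ openCell n e) :
    ∀ q ∈ openCell n e, g • q = q := by
  obtain ⟨e', he'⟩ := X.perm g n e
  have h1 : g • p ∈ openCell n e' := he' ▸ Set.smul_mem_smul_set hp
  have h2 := Topology.RelCWComplex.eq_of_not_disjoint_openCell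
    (Set.not_disjoint_iff.2 ⟨_, hg, h1⟩)
  cases h2
  exact X.fixes g n e he'

theorem openCell_subset_fix (H : Subgroup G) (n : ℕ) (e : cell (Set.univ : Set X) n) (p : X)
    (hp : p ∈ openCell n e) (hpF : p ∈ Fix H X) : openCell n e ⊆ Fix H X := fun q hq h hh =>
  smul_eq_of_mem_openCell hp ((hpF h hh).symm ▸ hp) q hq

variable {X}

theorem exists_vertex {H : Subgroup G} {p : X} (hp : p ∈ Fix H X) :
    ∃ q ∈ X.skel 1 ∩ Fix H X, JoinedIn (Fix H X) p q :=
  exists_joinedIn_vertex (X.isClosed_fix H) (X.openCell_subset_fix H) hp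

theorem joinedIn_skel {H : Subgroup G} {p q : X} (hp : p ∈ X.skel 1) (hq : q ∈ X.skel 1)
    (h : JoinedIn (Fix H X) p q) : JoinedIn (X.skel 2 ∩ Fix H X) p q :=
  have hle : ((1 : ℕ) : ℕ∞) ≤ ((2 : ℕ) : ℕ∞) := by norm_num
  joinedIn_oneSkeleton (X.isClosed_fix H) (X.openCell_subset_fix H)
    (Topology.RelCWComplex.skeletonLT_mono hle hp) (Topology.RelCWComplex.skeletonLT_mono hle hq) h

end ProperGCW

/-! ### Colimits of modules -/

section ColimLemmas

variable {k : Type*} [CommRing k] {C : Type*} [Category C] {M : C → Type*}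
    [∀ x, AddCommGroup (M x)] [∀ x, Module k (M x)] {t : ∀ x y : C, (x ⟶ y) → (M x →ₗ[k] M y)}
    {N : Type*} [AddCommGroup N] [Module k N]

theorem colimIncl_map {x y : C} (f : x ⟶ y) (a : M x) :
    colimIncl k t y (t x y f a) = colimIncl k t x a := by
  classical
  refine Eq.symm ?_
  change Submodule.Quotient.mk (DirectSum.lof k C M x a)
    = Submodule.Quotient.mk (DirectSum.lof k C M y (t x y f a))
  rw [Submodule.Quotient.eq]
  exact Submodule.subset_span ⟨x, y, f, a, rfl⟩

open scoped Classical in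
/-- The universal property of the colimit. -/
def colimDesc (φ : ∀ x, M x →ₗ[k] N) (hφ : ∀ x y (f : x ⟶ y) a, φ y (t x y f a) = φ x a) :
    Colim k M t →ₗ[k] N :=
  Submodule.liftQ _ (DirectSum.toModule k C N φ) (by
    rw [Submodule.span_le]
    rintro _ ⟨x, y, f, a, rfl⟩
    simp [DirectSum.toModule_lof, hφ])

@[simp]
theorem colimDesc_incl (φ : ∀ x, M x →ₗ[k] N)
    (hφ : ∀ x y (f : x ⟶ y) a, φ y (t x y f a) = φ x a) (x : C) (a : M x) :
    colimDesc φ hφ (colimIncl k t x a) = φ x a := by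
  classical
  exact DirectSum.toModule_lof k x a

theorem colim_hom_ext {f g : Colim k M t →ₗ[k] N}
    (h : ∀ x a, f (colimIncl k t x a) = g (colimIncl k t x a)) : f = g := by
  classical
  refine Submodule.linearMap_qext _ (DirectSum.linearMap_ext _ fun x => LinearMap.ext fun a => ?_)
  exact h x a

end ColimLemmas

/-! ### Morphisms in the component category -/

namespace ProperGCW

section PiZeroLemmas

variable {G : Type u} [Group G] {X : Type v} [MulAction G X]

/-- The `G`-map `G/H → G/K`, `1H ↦ gK`, for `g` with `g⁻¹Hg ⊆ K`. -/
def cosetMap {H K : Subgroup G} (g : G) (hg : ∀ h ∈ H, g⁻¹ * h * g ∈ K) : (G ⧸ H) →[G] (G ⧸ K) where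
  toFun := Quotient.lift (fun a : G => ((a * g : G) : G ⧸ K)) (by
    intro a b hab
    have h1 : a⁻¹ * b ∈ H := QuotientGroup.leftRel_apply.1 hab
    refine QuotientGroup.eq.2 ?_
    simpa [mul_assoc] using hg _ h1)
  map_smul' := by
    rintro a ⟨b⟩
    exact congrArg _ (mul_assoc a b g)

@[simp]
theorem cosetMap_mk {H K : Subgroup G} (g : G) (hg : ∀ h ∈ H, g⁻¹ * h * g ∈ K) (a : G) :
    cosetMap g hg (a : G ⧸ H) = ((a * g : G) : G ⧸ K) := rfl

theorem mk_repElt {H K : Subgroup G} (s : (G ⧸ H) →[G] (G ⧸ K)) :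
    ((repElt s : G) : G ⧸ K) = s ((1 : G) : G ⧸ H) := QuotientGroup.out_eq' _

theorem coset_map_ext {H : Subgroup G} {Z : Type*} [MulAction G Z] {s t : (G ⧸ H) →[G] Z}
    (h : s ((1 : G) : G ⧸ H) = t ((1 : G) : G ⧸ H)) : s = t := by
  refine MulActionHom.ext ?_
  rintro ⟨a⟩
  have h1 : (Quot.mk _ a : G ⧸ H) = a • ((1 : G) : G ⧸ H) :=
    congrArg (QuotientGroup.mk (s := H)) (mul_one a).symm
  rw [h1, map_smul, map_smul, h]

theorem map_coset {H : Subgroup G} {Z : Type*} [MulAction G Z] (s : (G ⧸ H) →[G] Z) (a : G) :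
    s ((a : G) : G ⧸ H) = a • s ((1 : G) : G ⧸ H) := by
  rw [← map_smul]
  exact congrArg s (congrArg (QuotientGroup.mk (s := H)) (mul_one a).symm)

theorem PiZero.map_mk (x : PiZero G X) (a : G) : x.map ((a : G) : G ⧸ x.H) = a • (x.pt : X) :=
  map_coset x.map a

@[simp]
theorem PiZero.ofPt_pt (H : Subgroup G) (p : Fix H X) : (PiZero.ofPt H p).pt = p :=
  Subtype.ext (one_smul G (p : X))

/-- The `G`-map `G/H → X`, `gH ↦ gp`, for a point `p ∈ X^H`. -/
def orbitMap (H : Subgroup G) (p : Fix H X) : (G ⧸ H) →[G] X := (PiZero.ofPt H p).map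

theorem orbitMap_one (H : Subgroup G) (p : Fix H X) : orbitMap H p ((1 : G) : G ⧸ H) = p :=
  one_smul G (p : X)

variable [TopologicalSpace X]

theorem PiZero.hom_ext {x y : PiZero G X} {f f' : x ⟶ y}
    (h : PiZero.homMap f ((1 : G) : G ⧸ x.H) = PiZero.homMap f' ((1 : G) : G ⧸ x.H)) : f = f' :=
  Subtype.ext (coset_map_ext h)

theorem PiZero.homMap_comp {x y z : PiZero G X} (f : x ⟶ y) (f' : y ⟶ z) :
    PiZero.homMap (f ≫ f') = (PiZero.homMap f').comp (PiZero.homMap f) := rfl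

variable [ContinuousConstSMul G X]

/-- Two `G`-maps `G/H → X` are `G`-homotopic if and only if the images of `1H` can be joined by a
path in `X^H`. -/
theorem gHomotopic_iff {H : Subgroup G} (f f' : (G ⧸ H) →[G] X) :
    GHomotopic f f' ↔
      JoinedIn (Fix H X) (f ((1 : G) : G ⧸ H)) (f' ((1 : G) : G ⧸ H)) := by
  constructor
  · intro h
    have h2 := JoinedIn.map h (f := fun k : (G ⧸ H) → X => k ((1 : G) : G ⧸ H)) (by fun_prop)
    refine h2.mono ?_
    rintro _ ⟨k, hk, rfl⟩ a ha
    rw [← hk]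
    congr 1
    exact QuotientGroup.eq.2 (by simpa using ha)
  · rintro ⟨γ, hγ⟩
    refine ⟨⟨⟨fun t q => orbitMap H ⟨γ t, hγ t⟩ q, ?_⟩, ?_, ?_⟩, ?_⟩
    · refine continuous_pi ?_
      rintro ⟨a⟩
      exact (by fun_prop : Continuous fun t => a • γ t)
    · funext q
      refine DFunLike.congr_fun (coset_map_ext (t := f) ?_) q
      rw [orbitMap_one]
      exact γ.source
    · funext q
      refine DFunLike.congr_fun (coset_map_ext (t := f') ?_) q
      rw [orbitMap_one]
      exact γ.target
    · intro t g a
      exact map_smul (orbitMap H ⟨γ t, hγ t⟩) g a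

/-- The morphism `x ⟶ y`, `1H ↦ gK`, where `g⁻¹Hg ⊆ K` and `gy(1K)` lies in `X^H(x)`. -/
def PiZero.homOf {x y : PiZero G X} (g : G) (hg : ∀ h ∈ x.H, g⁻¹ * h * g ∈ y.H)
    (h : JoinedIn (Fix x.H X) (g • (y.pt : X)) x.pt) : x ⟶ y :=
  ⟨cosetMap g hg, (gHomotopic_iff _ _).2 (by
    have h1 : (y.map.comp (cosetMap g hg)) ((1 : G) : G ⧸ x.H) = g • (y.pt : X) := by
      rw [MulActionHom.comp_apply, cosetMap_mk, one_mul, PiZero.map_mk]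
    rw [h1]; exact h)⟩

@[simp]
theorem PiZero.homMap_homOf {x y : PiZero G X} (g : G) (hg : ∀ h ∈ x.H, g⁻¹ * h * g ∈ y.H)
    (h : JoinedIn (Fix x.H X) (g • (y.pt : X)) x.pt) :
    PiZero.homMap (PiZero.homOf g hg h) = cosetMap g hg := rfl

theorem PiZero.hom_joined {x y : PiZero G X} (f : x ⟶ y) {g : G}
    (hg : (g : G ⧸ y.H) = PiZero.homMap f ((1 : G) : G ⧸ x.H)) :
    JoinedIn (Fix x.H X) (g • (y.pt : X)) x.pt := by
  have h := (gHomotopic_iff _ _).1 f.2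
  rw [MulActionHom.comp_apply] at h
  change JoinedIn _ (y.map (PiZero.homMap f _)) _ at h
  rw [← hg, PiZero.map_mk] at h
  exact h

theorem conj_mem_of_coset {H K : Subgroup G} (s : (G ⧸ H) →[G] (G ⧸ K)) {g : G}
    (hg : (g : G ⧸ K) = s ((1 : G) : G ⧸ H)) {h : G} (hh : h ∈ H) : g⁻¹ * h * g ∈ K := by
  have h2 : ((h * g : G) : G ⧸ K) = ((g : G) : G ⧸ K) := by
    have h1 : ((h : G) : G ⧸ H) = ((1 : G) : G ⧸ H) := QuotientGroup.eq.2 (by simpa using hh)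
    have h3 : ((h * g : G) : G ⧸ K) = h • (g : G ⧸ K) := rfl
    rw [h3, hg, ← map_coset s h, h1]
  rw [mul_assoc]
  exact QuotientGroup.eq.1 h2.symm

end PiZeroLemmas

end ProperGCW

/-! ### Zeroth Bredon homology as a colimit over the component category -/

section SimplexLemmas

variable {X : Type*} [TopologicalSpace X]

theorem zeroSimplex_eq_const (s : C(stdSimplex ℝ (Fin (0 + 1)), X)) :
    s = ContinuousMap.const _ (s (stdSimplex.vertex 0)) :=
  ContinuousMap.ext fun _ => congrArg s (Subsingleton.elim (α := stdSimplex ℝ (Fin 1)) _ _)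

/-- The zeroth relative homology group is generated by the classes of points. -/
theorem span_ptClass {A B : Set X} :
    Submodule.span ℤ {z : RelHomology 0 A B | ∃ p hp, z = ptClass B p hp} = ⊤ := by
  rw [eq_top_iff]
  rintro z -
  induction z using Submodule.Quotient.induction_on with
  | H c =>
    obtain ⟨c, hc⟩ := c
    have key : ∀ c' : SingChain 0 X, c' ∈ chainsIn 0 A → ∃ hc' : c' ∈ relCycles 0 A B,
        (Submodule.Quotient.mk ⟨c', hc'⟩ : RelHomology 0 A B) ∈
          Submodule.span ℤ {z : RelHomology 0 A B | ∃ p hp, z = ptClass B p hp} := by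
      intro c' hc'
      rw [chainsIn, Finsupp.supported_eq_span_single] at hc'
      induction hc' using Submodule.span_induction with
      | mem x hx =>
        obtain ⟨s, hs, rfl⟩ := hx
        have hA : s (stdSimplex.vertex 0) ∈ A := hs ⟨_, rfl⟩
        rw [zeroSimplex_eq_const s]
        exact ⟨_, Submodule.subset_span ⟨_, hA, rfl⟩⟩
      | zero => exact ⟨Submodule.zero_mem _, Submodule.zero_mem _⟩
      | add x y _ _ hx hy =>
        obtain ⟨hx, hx'⟩ := hx
        obtain ⟨hy, hy'⟩ := hy
        exact ⟨Submodule.add_mem _ hx hy, Submodule.add_mem _ hx' hy'⟩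
      | smul n x _ hx =>
        obtain ⟨hx, hx'⟩ := hx
        exact ⟨Submodule.smul_mem _ n hx, Submodule.smul_mem _ n hx'⟩
    exact (key c hc.1).2

/-- The singular `1`-simplex of a path. -/
def pathSimplex {p q : X} (γ : Path p q) : C(stdSimplex ℝ (Fin (0 + 2)), X) :=
  γ.toContinuousMap.comp ⟨fun t => ⟨t.1 1, t.2.1 1, stdSimplex.le_one t 1⟩,
    ((continuous_apply 1).comp continuous_subtype_val).subtype_mk _⟩

theorem face_pathSimplex_zero {p q : X} (γ : Path p q) :
    face 0 0 (pathSimplex γ) = ContinuousMap.const _ q := by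
  rw [zeroSimplex_eq_const (face 0 0 (pathSimplex γ))]
  congr 1
  refine (congrArg γ (Subtype.ext ?_)).trans γ.target
  change (stdSimplex.map (Fin.succAbove 0) (stdSimplex.vertex (S := ℝ) (0 : Fin 1))).1 1 = 1
  rw [stdSimplex.map_vertex]
  simp

theorem face_pathSimplex_one {p q : X} (γ : Path p q) :
    face 0 1 (pathSimplex γ) = ContinuousMap.const _ p := by
  rw [zeroSimplex_eq_const (face 0 1 (pathSimplex γ))]
  congr 1
  refine (congrArg γ (Subtype.ext ?_)).trans γ.source
  change (stdSimplex.map (Fin.succAbove 1) (stdSimplex.vertex (S := ℝ) (0 : Fin 1))).1 1 = 0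
  rw [stdSimplex.map_vertex]
  simp

theorem bdry_pathSimplex {p q : X} (γ : Path p q) :
    bdry 1 (Finsupp.single (pathSimplex γ) 1)
      = Finsupp.single (ContinuousMap.const _ q) 1
        - Finsupp.single (ContinuousMap.const _ p) 1 := by
  change (∑ i : Fin (0 + 2), (-1 : ℤ) ^ (i : ℕ) • Finsupp.lmapDomain ℤ ℤ (face 0 i)) _ = _
  rw [LinearMap.sum_apply, Fin.sum_univ_two]
  simp only [LinearMap.smul_apply, Finsupp.lmapDomain_apply, Finsupp.mapDomain_single,
    face_pathSimplex_zero, face_pathSimplex_one]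
  simp [sub_eq_add_neg]

theorem tripleBdry_mk (n : ℕ) {A B B' : Set X} (c : SingChain (n + 1) X)
    (hc : c ∈ relCycles (n + 1) A B) :
    tripleBdry n A B B' (Submodule.Quotient.mk ⟨c, hc⟩)
      = Submodule.Quotient.mk ⟨bdry (n + 1) c, bdry_mem_relCycles hc⟩ := rfl

/-- The boundary of a path in `A` with end points in `B`, in relative homology. -/
theorem exists_tripleBdry_eq {A B : Set X} (B' : Set X) {p q : X} (h : JoinedIn A p q) (hp : p ∈ B)
    (hq : q ∈ B) :
    ∃ z : RelHomology (0 + 1) A B, tripleBdry 0 A B B' z = ptClass B' q hq - ptClass B' p hp := by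
  obtain ⟨γ, hγ⟩ := h
  have hA : Finsupp.single (pathSimplex γ) (1 : ℤ) ∈ chainsIn (0 + 1) A := by
    refine Finsupp.single_mem_supported ℤ _ ?_
    rintro _ ⟨t, rfl⟩
    exact hγ _
  have hpt (x : X) (hx : x ∈ B) :
      Finsupp.single (ContinuousMap.const (stdSimplex ℝ (Fin (0 + 1))) x) (1 : ℤ)
        ∈ chainsIn 0 B := by
    refine Finsupp.single_mem_supported ℤ _ ?_
    rintro _ ⟨t, rfl⟩
    exact hx
  have hc : Finsupp.single (pathSimplex γ) (1 : ℤ) ∈ relCycles (0 + 1) A B := by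
    refine ⟨hA, ?_⟩
    change bdry 1 _ ∈ chainsIn 0 B
    rw [bdry_pathSimplex]
    exact Submodule.sub_mem _ (hpt q hq) (hpt p hp)
  refine ⟨Submodule.Quotient.mk ⟨_, hc⟩, ?_⟩
  rw [tripleBdry_mk]
  unfold ptClass
  rw [← Submodule.Quotient.mk_sub]
  exact congrArg _ (Subtype.ext (bdry_pathSimplex γ))

/-- The boundary of a `1`-simplex is the difference of two points that it joins. -/
theorem exists_bdry_single {A : Set X} (s : C(stdSimplex ℝ (Fin (1 + 1)), X))
    (hs : Set.range s ⊆ A) :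
    ∃ p q : X, JoinedIn A p q ∧ bdry 1 (Finsupp.single s 1)
      = Finsupp.single (ContinuousMap.const _ q) 1
        - Finsupp.single (ContinuousMap.const _ p) 1 := by
  refine ⟨face 0 1 s (stdSimplex.vertex 0), face 0 0 s (stdSimplex.vertex 0), ?_, ?_⟩
  · have h : IsPathConnected (Set.univ : Set (stdSimplex ℝ (Fin 2))) := by
      have := (convex_stdSimplex ℝ (Fin 2)).isPathConnected ⟨_, (stdSimplex.vertex 0).2⟩
      rw [isPathConnected_iff_pathConnectedSpace] at this
      exact pathConnectedSpace_iff_univ.1 this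
    refine ((h.image s.continuous).joinedIn _ ⟨_, trivial, rfl⟩ _ ⟨_, trivial, rfl⟩).mono ?_
    rintro _ ⟨t, -, rfl⟩
    exact hs ⟨t, rfl⟩
  · rw [← zeroSimplex_eq_const, ← zeroSimplex_eq_const]
    change (∑ i : Fin (0 + 2), (-1 : ℤ) ^ (i : ℕ) • Finsupp.lmapDomain ℤ ℤ (face 0 i)) _ = _
    rw [LinearMap.sum_apply, Fin.sum_univ_two]
    simp only [LinearMap.smul_apply, Finsupp.lmapDomain_apply, Finsupp.mapDomain_single]
    simp [sub_eq_add_neg]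

/-- A homomorphism on `0`-chains that agrees on the end points of every path in `A` vanishes on the
boundaries of `1`-chains in `A`. -/
theorem map_bdry_eq_zero {N : Type*} [AddCommGroup N] (φ : SingChain 0 X →ₗ[ℤ] N) {A : Set X}
    (hφ : ∀ p q, JoinedIn A p q → φ (Finsupp.single (ContinuousMap.const _ p) 1)
      = φ (Finsupp.single (ContinuousMap.const _ q) 1))
    {c : SingChain 1 X} (hc : c ∈ chainsIn 1 A) : φ (bdry 1 c) = 0 := by
  rw [chainsIn, Finsupp.supported_eq_span_single] at hc
  induction hc using Submodule.span_induction with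
  | mem x hx =>
    obtain ⟨s, hs, rfl⟩ := hx
    obtain ⟨p, q, h, hb⟩ := exists_bdry_single s hs
    rw [hb, map_sub, hφ p q h, sub_self]
  | zero => simp
  | add x y _ _ hx hy => rw [map_add, map_add, hx, hy, add_zero]
  | smul n x _ hx => rw [map_smul, map_smul, hx, smul_zero]

/-- The homomorphism on `H_0(A, ∅)` induced by such a homomorphism on `0`-chains. -/
def liftH0 {N : Type*} [AddCommGroup N] (φ : SingChain 0 X →ₗ[ℤ] N) {A B : Set X} (hB : B = ∅)
    (hφ : ∀ p q, JoinedIn A p q → φ (Finsupp.single (ContinuousMap.const _ p) 1)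
      = φ (Finsupp.single (ContinuousMap.const _ q) 1)) : RelHomology 0 A B →ₗ[ℤ] N :=
  Submodule.liftQ _ (φ.comp (Submodule.subtype _)) (by
    rintro ⟨c, hc⟩ h
    obtain ⟨_, ⟨a, ha, rfl⟩, b, hb, rfl⟩ := Submodule.mem_sup.1
      (show c ∈ relBoundaries 0 A B from h)
    have hb0 : b = 0 := by
      rw [chainsIn, hB, show {s : C(stdSimplex ℝ (Fin (0 + 1)), X) | Set.range s ⊆ ∅} = ∅ from
        Set.eq_empty_of_forall_notMem fun s hs => hs ⟨stdSimplex.vertex 0, rfl⟩,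
        Finsupp.supported_empty] at hb
      exact hb
    rw [LinearMap.mem_ker]
    change φ (bdry 1 a + b) = 0
    rw [hb0, add_zero]
    exact map_bdry_eq_zero φ hφ ha)

theorem liftH0_ptClass {N : Type*} [AddCommGroup N] (φ : SingChain 0 X →ₗ[ℤ] N) {A B : Set X}
    (hB : B = ∅) (hφ : ∀ p q, JoinedIn A p q → φ (Finsupp.single (ContinuousMap.const _ p) 1)
      = φ (Finsupp.single (ContinuousMap.const _ q) 1)) {p : X} (hp : p ∈ A) :
    liftH0 φ hB hφ (ptClass B p hp) = φ (Finsupp.single (ContinuousMap.const _ p) 1) := rfl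

theorem liftH0_tripleBdry {N : Type*} [AddCommGroup N] (φ : SingChain 0 X →ₗ[ℤ] N)
    {A' A B : Set X} (hB : B = ∅) (hφ : ∀ p q, JoinedIn A p q →
      φ (Finsupp.single (ContinuousMap.const _ p) 1)
        = φ (Finsupp.single (ContinuousMap.const _ q) 1))
    (hφ' : ∀ p q, JoinedIn A' p q →
      φ (Finsupp.single (ContinuousMap.const _ p) 1)
        = φ (Finsupp.single (ContinuousMap.const _ q) 1))
    (c : RelHomology (0 + 1) A' A) : liftH0 φ hB hφ (tripleBdry 0 A' A B c) = 0 := by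
  induction c using Submodule.Quotient.induction_on with
  | H c => exact map_bdry_eq_zero φ hφ' c.2.1

end SimplexLemmas

namespace ProperGCW

variable {G : Type u} [Group G] {X Y : ProperGCW.{u, v} G}

variable (X) in
open scoped Classical in
/-- The bilinear map `(c, a) ↦ c ⊗ a` into the Bredon chain group. -/
def bredonMkₗ (n : ℕ) (H : FinSub G) : X.CellChain n H.1 →ₗ[ℤ] RepRing H.1 →ₗ[ℤ] X.BredonChain n :=
  (TensorProduct.mk ℤ (X.CellChain n H.1) (RepRing H.1)).compr₂
    ((Submodule.mkQ (X.bredonRel n)).comp (DirectSum.lof ℤ (FinSub G) (X.BredonTerm n) H))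

theorem bredonMkₗ_apply (n : ℕ) (H : FinSub G) (c : X.CellChain n H.1) (a : RepRing H.1) :
    X.bredonMkₗ n H c a = X.bredonMk n H c a := rfl

theorem bredonMk_rel (n : ℕ) {H K : FinSub G} (s : (G ⧸ H.1) →[G] (G ⧸ K.1))
    (c : X.CellChain n K.1) (a : RepRing H.1) :
    X.bredonMk n H (cellPull n s c) a = X.bredonMk n K c (repPush s a) := by
  classical
  exact (Submodule.Quotient.eq _).2 (Submodule.subset_span ⟨H, K, s, c, a, rfl⟩)

theorem bredonInd_mk {n m : ℕ} (t : ∀ H : FinSub G, X.CellChain n H.1 →ₗ[ℤ] Y.CellChain m H.1)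
    (ht : ∀ (H K : FinSub G) (s : (G ⧸ H.1) →[G] (G ⧸ K.1)) (c : X.CellChain n K.1),
      t H (cellPull n s c) = cellPull m s (t K c))
    (H : FinSub G) (c : X.CellChain n H.1) (a : RepRing H.1) :
    bredonInd t ht (X.bredonMk n H c a) = Y.bredonMk m H (t H c) a := by
  classical
  refine congrArg (Submodule.Quotient.mk (p := Y.bredonRel m)) ?_
  rw [DirectSum.lmap_lof]
  rfl

theorem bredonChain_hom_ext {n : ℕ} {N : Type*} [AddCommGroup N] {f g : X.BredonChain n →ₗ[ℤ] N}
    (h : ∀ H c a, f (X.bredonMk n H c a) = g (X.bredonMk n H c a)) : f = g := by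
  classical
  refine Submodule.linearMap_qext _ (DirectSum.linearMap_ext _ fun H => ?_)
  refine TensorProduct.ext' (M := X.CellChain n H.1) (N := RepRing H.1) fun c a => h H c a

/-- Vertices in the same component of `X^H` represent the same elements of `H_0`. -/
theorem ptBredon_eq {H : FinSub G} {p q : X} (hp : p ∈ X.skel 1 ∩ Fix H.1 X)
    (hq : q ∈ X.skel 1 ∩ Fix H.1 X) (h : JoinedIn (Fix H.1 X) p q) (a : RepRing H.1) :
    X.ptBredon H p hp a = X.ptBredon H q hq a := by
  obtain ⟨z, hz⟩ := exists_tripleBdry_eq (X.skel 0 ∩ Fix H.1 X) (joinedIn_skel hp.1 hq.1 h) hp hq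
  refine Eq.symm ((Submodule.Quotient.eq _).2 ⟨X.bredonMk 1 H z a, ?_⟩)
  unfold bredonBdry
  rw [bredonInd_mk]
  have h2 : X.cellBdry 0 H.1 z = ptClass _ q hq - ptClass _ p hp := hz
  rw [h2, ← bredonMkₗ_apply, map_sub, LinearMap.sub_apply]
  rfl

theorem cellPull_ptClass {H K : FinSub G} (s : (G ⧸ H.1) →[G] (G ⧸ K.1)) {p : X}
    (hp : p ∈ X.skel 1 ∩ Fix K.1 X) :
    cellPull 0 s (ptClass (X.skel 0 ∩ Fix K.1 X) p hp)
      = ptClass (X.skel 0 ∩ Fix H.1 X) (repElt s • p) (translate_mem s hp) :=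
  congrArg Submodule.Quotient.mk (Subtype.ext (Finsupp.mapDomain_single))

/-- The finite isotropy group of an object of the component category. -/
abbrev finSub (x : PiZero G X) : FinSub G := ⟨x.H, inferInstance⟩

/-- A vertex in the component `X^H(x)`. -/
def vertexOf (x : PiZero G X) : X := (exists_vertex x.pt.2).choose

theorem vertexOf_mem (x : PiZero G X) : vertexOf x ∈ X.skel 1 ∩ Fix x.H X :=
  (exists_vertex x.pt.2).choose_spec.1

theorem joinedIn_vertexOf (x : PiZero G X) : JoinedIn (Fix x.H X) (x.pt : X) (vertexOf x) :=
  (exists_vertex x.pt.2).choose_spec.2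

/-- The map `colim R_ℚ(H) → H_0(X; R_ℚ)` induced by the objects `x : G/H → X`. -/
def colimToBredon (X : ProperGCW.{u, v} G) : X.RepColim →ₗ[ℤ] X.BredonH0 :=
  colimDesc (fun x => (Submodule.mkQ _).comp
    (X.bredonMkₗ 0 (finSub x) (ptClass _ (vertexOf x) (vertexOf_mem x)))) (by
    intro x y f a
    change X.ptBredon (finSub y) (vertexOf y) (vertexOf_mem y) _ =
      X.ptBredon (finSub x) (vertexOf x) (vertexOf_mem x) a
    have h1 : X.ptBredon (finSub x) (repElt (PiZero.homMap f) • vertexOf y)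
        (translate_mem _ (vertexOf_mem y)) a = X.ptBredon (finSub y) (vertexOf y) (vertexOf_mem y)
          (repPush (PiZero.homMap f) a) := by
      have := bredonMk_rel (X := X) 0 (H := finSub x) (K := finSub y) (PiZero.homMap f)
        (ptClass _ (vertexOf y) (vertexOf_mem y)) a
      have h0 := cellPull_ptClass (H := finSub x) (K := finSub y) (PiZero.homMap f) (vertexOf_mem y)
      rw [h0] at this
      exact congrArg Submodule.Quotient.mk this
    rw [← h1]
    refine ptBredon_eq (H := finSub x) _ _ ?_ a
    have h2 : JoinedIn (Fix x.H X) (repElt (PiZero.homMap f) • (y.pt : X))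
        (repElt (PiZero.homMap f) • vertexOf y) := by
      have := (joinedIn_vertexOf y).map
        (f := fun p : X => repElt (PiZero.homMap f) • p) (continuous_const_smul _)
      refine this.mono ?_
      rintro _ ⟨p, hp, rfl⟩ h hh
      have h2 := hp _ (repElt_conj_mem (PiZero.homMap f) hh)
      rwa [mul_smul, mul_smul, inv_smul_eq_iff] at h2
    exact h2.symm.trans
      ((PiZero.hom_joined f (mk_repElt _)).trans (joinedIn_vertexOf x)))

theorem colimToBredon_incl (x : PiZero G X) {p : X} (hp : p ∈ X.skel 1 ∩ Fix x.H X)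
    (h : JoinedIn (Fix x.H X) (x.pt : X) p) (a : RepRing x.H) :
    X.colimToBredon (repIncl x a) = X.ptBredon (finSub x) p hp a := by
  unfold colimToBredon repIncl
  rw [colimDesc_incl]
  exact ptBredon_eq (H := finSub x) (vertexOf_mem x) hp ((joinedIn_vertexOf x).symm.trans h) a

open scoped Classical in
/-- The map which sends a point `p` of `X^H` and `a ∈ R_ℚ(H)` to the class of `a` at
`G/H → X`, `gH ↦ gp`, extended to singular `0`-chains of `X` by zero. -/
def chainToColim (H : FinSub G) : SingChain 0 X →ₗ[ℤ] RepRing H.1 →ₗ[ℤ] X.RepColim :=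
  Finsupp.linearCombination ℤ fun s => if h : s (stdSimplex.vertex 0) ∈ Fix H.1 X then
    repIncl (PiZero.ofPt H.1 ⟨_, h⟩) else 0

theorem chainToColim_const (H : FinSub G) {p : X} (hp : p ∈ Fix H.1 X) :
    chainToColim H (Finsupp.single (ContinuousMap.const _ p) 1)
      = repIncl (PiZero.ofPt H.1 ⟨p, hp⟩) := by
  unfold chainToColim
  rw [Finsupp.linearCombination_single, one_smul]
  exact dif_pos hp

theorem repIncl_repPush {x y : PiZero G X} (f : x ⟶ y) (a : RepRing x.H) :
    repIncl y (repPush (PiZero.homMap f) a) = repIncl x a :=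
  colimIncl_map (M := fun x : PiZero G X => RepRing x.H) f a

theorem repIncl_ofPt (x : PiZero G X) {p : X} (h : JoinedIn (Fix x.H X) (x.pt : X) p)
    (a : RepRing x.H) : repIncl (PiZero.ofPt x.H ⟨p, h.target_mem⟩) a = repIncl x a := by
  -- the identity of `G/H` is a morphism between the two objects
  let f : x ⟶ PiZero.ofPt x.H ⟨p, h.target_mem⟩ :=
    ⟨MulActionHom.id G, (gHomotopic_iff _ _).2 (by
      refine (?_ : JoinedIn (Fix x.H X) (orbitMap x.H ⟨p, h.target_mem⟩ ((1 : G) : G ⧸ x.H)) x.pt)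
      rw [orbitMap_one]
      exact h.symm)⟩
  exact (repIncl_repPush (𝟙 (PiZero.ofPt x.H ⟨p, h.target_mem⟩)) a).symm.trans (repIncl_repPush f a)

theorem chainToColim_joinedIn (H : FinSub G) (p q : X) (h : JoinedIn (Fix H.1 X) p q) :
    chainToColim (X := X) H (Finsupp.single (ContinuousMap.const _ p) 1)
      = chainToColim H (Finsupp.single (ContinuousMap.const _ q) 1) := by
  rw [chainToColim_const H h.source_mem, chainToColim_const H h.target_mem]
  exact LinearMap.ext fun a => (repIncl_ofPt (PiZero.ofPt H.1 ⟨p, h.source_mem⟩)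
    (by rw [PiZero.ofPt_pt]; exact h) a).symm

theorem skel_zero_inter (A : Set X) : X.skel 0 ∩ A = ∅ := by
  have h : X.skel 0 = ∅ := Topology.CWComplex.skeletonLT_zero_eq_empty
  rw [h, Set.empty_inter]

/-- The map induced by `chainToColim` on the cellular `0`-chains of `X^H`. -/
def cellToColim (H : FinSub G) : X.CellChain 0 H.1 →ₗ[ℤ] RepRing H.1 →ₗ[ℤ] X.RepColim :=
  liftH0 (chainToColim H) (skel_zero_inter _) fun p q h =>
    chainToColim_joinedIn H p q (h.mono Set.inter_subset_right)

theorem cellToColim_ptClass (H : FinSub G) {p : X} (hp : p ∈ X.skel 1 ∩ Fix H.1 X) :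
    cellToColim H (ptClass _ p hp) = repIncl (PiZero.ofPt H.1 ⟨p, hp.2⟩) :=
  (liftH0_ptClass _ _ _ hp).trans (chainToColim_const H hp.2)

theorem cellToColim_cellBdry (H : FinSub G) (c : X.CellChain 1 H.1) :
    cellToColim H (X.cellBdry 0 H.1 c) = 0 :=
  liftH0_tripleBdry _ _ _ (fun p q h =>
    chainToColim_joinedIn H p q (h.mono Set.inter_subset_right)) c

theorem cellToColim_cellPull {H K : FinSub G} (s : (G ⧸ H.1) →[G] (G ⧸ K.1))
    (c : X.CellChain 0 K.1) (a : RepRing H.1) :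
    cellToColim H (cellPull 0 s c) a = cellToColim K c (repPush s a) := by
  have h : c ∈ (⊤ : Submodule ℤ (X.CellChain 0 K.1)) := trivial
  rw [← span_ptClass] at h
  induction h using Submodule.span_induction with
  | mem c hc =>
    obtain ⟨p, hp, rfl⟩ := hc
    rw [cellPull_ptClass, cellToColim_ptClass, cellToColim_ptClass]
    -- `s` is a morphism between the objects given by `gp ∈ X^H` and `p ∈ X^K`
    let f : PiZero.ofPt H.1 ⟨repElt s • p, (translate_mem s hp).2⟩ ⟶
        PiZero.ofPt K.1 ⟨p, hp.2⟩ := ⟨s, (gHomotopic_iff _ _).2 (by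
      refine (?_ : JoinedIn (Fix H.1 X) (((orbitMap K.1 ⟨p, hp.2⟩).comp s) ((1 : G) : G ⧸ H.1))
        (orbitMap H.1 ⟨repElt s • p, (translate_mem s hp).2⟩ ((1 : G) : G ⧸ H.1)))
      rw [orbitMap_one, MulActionHom.comp_apply, ← mk_repElt, map_coset, orbitMap_one]
      exact JoinedIn.refl (translate_mem s hp).2)⟩
    exact (repIncl_repPush f a).symm
  | zero => simp
  | add x y _ _ hx hy => simp only [map_add, LinearMap.add_apply, hx, hy]
  | smul n x _ hx => simp only [map_smul, LinearMap.smul_apply, hx]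

/-- The map `c ⊗ a ↦ cellToColim c a` on the summand of `H`. -/
def termToColim (H : FinSub G) : X.BredonTerm 0 H →ₗ[ℤ] X.RepColim :=
  (TensorProduct.lift (cellToColim H) : X.CellChain 0 H.1 ⊗[ℤ] RepRing H.1 →ₗ[ℤ] X.RepColim)

open scoped Classical in
/-- The map `C_0(X^-) ⊗ R_ℚ → colim R_ℚ(H)`, `p ⊗ a ↦` the class of `a` at `gH ↦ gp`. -/
def bredonChainToColim (X : ProperGCW.{u, v} G) : X.BredonChain 0 →ₗ[ℤ] X.RepColim :=
  Submodule.liftQ _ (DirectSum.toModule ℤ (FinSub G) X.RepColim termToColim) (by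
    unfold bredonRel
    rw [Submodule.span_le]
    rintro _ ⟨H, K, s, c, a, rfl⟩
    rw [SetLike.mem_coe, LinearMap.mem_ker, map_sub, DirectSum.toModule_lof,
      DirectSum.toModule_lof, sub_eq_zero]
    exact cellToColim_cellPull s c a)

theorem bredonChainToColim_mk (H : FinSub G) (c : X.CellChain 0 H.1) (a : RepRing H.1) :
    X.bredonChainToColim (X.bredonMk 0 H c a) = cellToColim H c a := by
  classical
  exact DirectSum.toModule_lof ℤ H _

/-- The inverse of `colimToBredon`. -/
def bredonToColim (X : ProperGCW.{u, v} G) : X.BredonH0 →ₗ[ℤ] X.RepColim :=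
  Submodule.liftQ _ X.bredonChainToColim (by
    rw [LinearMap.range_le_ker_iff]
    refine bredonChain_hom_ext fun H c a => ?_
    unfold bredonBdry
    rw [LinearMap.comp_apply, bredonInd_mk, bredonChainToColim_mk, cellToColim_cellBdry]
    rfl)

theorem bredonToColim_ptBredon (H : FinSub G) {p : X} (hp : p ∈ X.skel 1 ∩ Fix H.1 X)
    (a : RepRing H.1) :
    X.bredonToColim (X.ptBredon H p hp a) = repIncl (PiZero.ofPt H.1 ⟨p, hp.2⟩) a :=
  (bredonChainToColim_mk H _ a).trans (DFunLike.congr_fun (cellToColim_ptClass H hp) a)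

theorem bredonH0_hom_ext {N : Type*} [AddCommGroup N] {f g : X.BredonH0 →ₗ[ℤ] N}
    (h : ∀ H p hp a, f (X.ptBredon H p hp a) = g (X.ptBredon H p hp a)) : f = g := by
  refine Submodule.linearMap_qext _ (bredonChain_hom_ext fun H c a => ?_)
  have hc : c ∈ (⊤ : Submodule ℤ (X.CellChain 0 H.1)) := trivial
  rw [← span_ptClass] at hc
  induction hc using Submodule.span_induction with
  | mem c hc =>
    obtain ⟨p, hp, rfl⟩ := hc
    exact h H p hp a
  | zero => rw [← bredonMkₗ_apply]; simp
  | add x y _ _ hx hy =>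
    rw [← bredonMkₗ_apply] at *
    simp only [map_add, LinearMap.add_apply, hx, hy]
  | smul n x _ hx =>
    rw [← bredonMkₗ_apply] at *
    simp only [map_smul, LinearMap.smul_apply, hx]

/-- The isomorphism `β`. -/
def betaEquiv (X : ProperGCW.{u, v} G) : X.RepColim ≃ₗ[ℤ] X.BredonH0 :=
  LinearEquiv.ofLinearMap X.colimToBredon X.bredonToColim
    (bredonH0_hom_ext fun H p hp a => by
      rw [LinearMap.comp_apply, bredonToColim_ptBredon]
      exact colimToBredon_incl (PiZero.ofPt H.1 ⟨p, hp.2⟩) hp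
        (by rw [PiZero.ofPt_pt]; exact JoinedIn.refl hp.2) a)
    (colim_hom_ext fun x a => by
      change X.bredonToColim (X.colimToBredon (repIncl x a)) = repIncl x a
      rw [colimToBredon_incl x (vertexOf_mem x) (joinedIn_vertexOf x), bredonToColim_ptBredon]
      exact repIncl_ofPt x (joinedIn_vertexOf x) a)

end ProperGCW

/-! ### Traces of rational matrices of finite order -/

section Traces

/-- The trace of a map that permutes basis vectors up to repetition is the number of fixed basis
vectors. -/
theorem trace_of_basis_map {R M ι : Type*} [CommRing R] [AddCommGroup M] [Module R M] [Fintype ι]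
    [DecidableEq ι] (b : Module.Basis ι R M) (f : M →ₗ[R] M) (p : ι → ι)
    (h : ∀ i, f (b i) = b (p i)) : LinearMap.trace R M f = ∑ i, if p i = i then 1 else 0 := by
  rw [LinearMap.trace_eq_matrix_trace R b]
  refine Finset.sum_congr rfl fun i _ => ?_
  rw [Matrix.diag_apply, LinearMap.toMatrix_apply, h, Module.Basis.repr_self, Finsupp.single_apply]

/-- A common denominator of the entries of a rational matrix and a further rational number. -/
theorem exists_int_matrix {m : ℕ} (A : Matrix (Fin m) (Fin m) ℚ) (t : ℚ) :
    ∃ (D : ℤ) (N : Matrix (Fin m) (Fin m) ℤ) (b : ℤ), D ≠ 0 ∧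
      (D : ℚ) • A = N.map (Int.cast : ℤ → ℚ) ∧ (D : ℚ) * t = b := by
  obtain ⟨d, hd⟩ := IsLocalization.exist_integer_multiples_of_finite (nonZeroDivisors ℤ)
    (fun o : Option (Fin m × Fin m) => o.elim t fun ij => A ij.1 ij.2)
  choose N hN using hd
  refine ⟨d, fun i j => N (some (i, j)), N none, nonZeroDivisors.ne_zero d.2, ?_, ?_⟩
  · ext i j
    have := hN (some (i, j))
    change (d : ℤ) * A i j = ((N (some (i, j)) : ℤ) : ℚ)
    simpa [Submonoid.smul_def] using this.symm
  · have := hN none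
    simpa [Submonoid.smul_def] using this.symm

/-- A rational matrix of finite order dividing `n` has the same trace as its `k`-th power for `k`
prime to `n`: for primes `p ≡ k` modulo `n`, the trace of the `p`-th power is congruent to the trace
modulo `p`, and there are infinitely many such primes by Dirichlet's theorem. -/
theorem trace_pow_eq_of_coprime {m : ℕ} (A : Matrix (Fin m) (Fin m) ℚ) {n k : ℕ} (hn : 0 < n)
    (hA : A ^ n = 1) (hk : k.Coprime n) : (A ^ k).trace = A.trace := by
  obtain ⟨D, N, b, hD, hN, hb⟩ := exists_int_matrix A (A ^ k).trace
  -- with `DA` integral, the integers `D tr(A)` and `D tr(Aᵏ)` are congruent modulo every prime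
  -- `p ≡ k` that does not divide `D`; `p` is chosen larger than `|D|` and than their difference
  have ha : (D : ℚ) * A.trace = (N.trace : ℤ) := by
    rw [← smul_eq_mul, ← Matrix.trace_smul, hN]
    simp [Matrix.trace]
  suffices h : b = N.trace by
    have h1 : (D : ℚ) * (A ^ k).trace = D * A.trace := by rw [hb, ha, h]
    exact mul_left_cancel₀ (by exact_mod_cast hD) h1
  have : NeZero n := ⟨hn.ne'⟩
  obtain ⟨p, hpgt, hp, hpk⟩ := Nat.forall_exists_prime_gt_and_eq_mod
    ((ZMod.isUnit_iff_coprime k n).2 hk) (D.natAbs + (b - N.trace).natAbs)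
  have : Fact p.Prime := ⟨hp⟩
  have hpA : A ^ p = A ^ k := by
    rw [pow_eq_pow_mod p hA, pow_eq_pow_mod k hA]
    rw [(ZMod.natCast_eq_natCast_iff' p k n).1 hpk]
  have h1 : (N ^ p).trace = D ^ (p - 1) * b := by
    have h2 : ((N ^ p).trace : ℚ) = (((D : ℚ) • A) ^ p).trace := by
      have h3 : (N ^ p).map (Int.cast : ℤ → ℚ) = (N.map (Int.cast : ℤ → ℚ)) ^ p :=
        map_pow (Int.castRingHom ℚ).mapMatrix N p
      rw [hN, ← h3]
      simp [Matrix.trace]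
    rw [smul_pow, hpA, Matrix.trace_smul, smul_eq_mul, ← pow_sub_one_mul hp.ne_zero (D : ℚ),
      mul_assoc, hb] at h2
    exact_mod_cast h2
  have hDp : (D : ZMod p) ≠ 0 := by
    rw [Ne, ZMod.intCast_zmod_eq_zero_iff_dvd]
    intro h
    have := Int.natAbs_dvd_natAbs.2 h
    have := Nat.le_of_dvd (Int.natAbs_pos.2 hD) this
    simp at this
    omega
  have h4 : (((N ^ p).trace : ℤ) : ZMod p) = (N.trace : ℤ) := by
    have h5 := ZMod.trace_pow_card (N.map (Int.cast : ℤ → ZMod p))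
    have h3 : (N ^ p).map (Int.cast : ℤ → ZMod p) = (N.map (Int.cast : ℤ → ZMod p)) ^ p :=
      map_pow (Int.castRingHom (ZMod p)).mapMatrix N p
    rw [← h3, ZMod.pow_card] at h5
    simpa [Matrix.trace] using h5
  rw [h1] at h4
  push_cast at h4
  rw [ZMod.pow_card_sub_one_eq_one hDp, one_mul] at h4
  have h6 : (p : ℤ) ∣ b - N.trace := by
    rw [← ZMod.intCast_zmod_eq_zero_iff_dvd]
    push_cast
    rw [h4, sub_self]
  by_contra hne
  have h7 := Nat.le_of_dvd (Int.natAbs_pos.2 (sub_ne_zero.2 hne)) (Int.natAbs_dvd_natAbs.2 h6)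
  simp at h7
  omega

/-- Rational characters take the same value on elements that generate the same cyclic group. -/
theorem character_eq_of_zpowers_eq {H : Type*} [Group H] [Finite H] {V : Type*} [AddCommGroup V]
    [Module ℚ V] [FiniteDimensional ℚ V] (ρ : Representation ℚ H V) {g g' : H}
    (h : Subgroup.zpowers g = Subgroup.zpowers g') : ρ.character g = ρ.character g' := by
  have h1 : g' ∈ Subgroup.zpowers g := h ▸ Subgroup.mem_zpowers g'
  obtain ⟨k, rfl⟩ := (mem_powers_iff_mem_zpowers.2 h1 : g' ∈ Submonoid.powers g)
  have ho : orderOf (g ^ k) = orderOf g := by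
    rw [← Nat.card_zpowers, ← Nat.card_zpowers, h]
  have hk : k.Coprime (orderOf g) := by
    rw [orderOf_pow] at ho
    have hpos := orderOf_pos g
    have hdvd : Nat.gcd (orderOf g) k ∣ orderOf g := Nat.gcd_dvd_left _ _
    rw [Nat.div_eq_self] at ho
    rcases ho with ho | ho
    · omega
    · exact Nat.Coprime.symm ho
  have hb := Module.finBasis ℚ V
  unfold Representation.character
  rw [LinearMap.trace_eq_matrix_trace ℚ hb, LinearMap.trace_eq_matrix_trace ℚ hb, map_pow,
    ← LinearMap.toMatrix_pow]
  refine (trace_pow_eq_of_coprime _ (orderOf_pos g) ?_ hk).symm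
  rw [LinearMap.toMatrix_pow, ← map_pow, pow_orderOf_eq_one, map_one, LinearMap.toMatrix_one]

/-- The trace of a map induced on coinvariants. -/
theorem trace_coinvariants {k G M : Type*} [Field k] [CharZero k] [Group G] [Fintype G]
    [AddCommGroup M] [Module k M] [FiniteDimensional k M] (τ : Representation k G M)
    (φ : τ.IntertwiningMap τ) :
    LinearMap.trace k _ (Representation.Coinvariants.map τ τ φ)
      = (Nat.card G : k)⁻¹ * ∑ g, LinearMap.trace k M (φ.toLinearMap ∘ₗ τ g) := by
  have hG : (Nat.card G : k) ≠ 0 := by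
    rw [Nat.cast_ne_zero]; exact Nat.card_pos.ne'
  -- the projection to the invariants, whose image is identified with the coinvariants
  let e : M →ₗ[k] M := (Nat.card G : k)⁻¹ • ∑ g, τ g
  have he (x : G) : e ∘ₗ τ x = e := by
    ext y
    simp only [e, LinearMap.comp_apply, LinearMap.smul_apply, LinearMap.sum_apply]
    congr 1
    refine Fintype.sum_equiv (Equiv.mulRight x) _ _ fun g => ?_
    rw [Equiv.coe_mulRight, map_mul]
    rfl
  let mk := Representation.Coinvariants.mk τ
  have hmk : mk ∘ₗ e = mk := by
    ext x
    simp only [e, mk, LinearMap.comp_apply, LinearMap.smul_apply, LinearMap.sum_apply, map_smul,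
      map_sum, Representation.Coinvariants.mk_self_apply, Finset.sum_const, Finset.card_univ]
    rw [← Nat.card_eq_fintype_card, ← Nat.cast_smul_eq_nsmul k, smul_smul, inv_mul_cancel₀ hG,
      one_smul]
  let σ := Representation.Coinvariants.lift τ e he
  have hσ : σ ∘ₗ mk = e := Representation.Coinvariants.lift_comp_mk τ e he
  have hid : mk ∘ₗ σ = LinearMap.id := Representation.Coinvariants.hom_ext (by
    change mk ∘ₗ (σ ∘ₗ mk) = mk
    rw [hσ, hmk])
  have h1 : Representation.Coinvariants.map τ τ φ = (mk ∘ₗ φ.toLinearMap) ∘ₗ σ := by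
    rw [← LinearMap.comp_id (Representation.Coinvariants.map τ τ φ), ← hid, ← LinearMap.comp_assoc]
    rfl
  rw [h1, LinearMap.trace_comp_comm', ← LinearMap.comp_assoc, hσ, LinearMap.trace_comp_comm']
  simp only [e, LinearMap.comp_smul, map_smul, smul_eq_mul]
  congr 1
  rw [← map_sum (LinearMap.trace k M)]
  congr 1
  ext x
  simp [LinearMap.sum_apply]

end Traces

/-! ### Hattori-Stallings ranks and characters -/

section HattoriStallings

variable {H K : Type u} [Group H] [Group K]

/-- The class of an element in `con_ℚ(H)`. -/
abbrev conQ (h : H) : ConQ H := Quotient.mk _ h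

theorem conQ_eq_iff {h k : H} :
    conQ h = conQ k ↔ ∃ a : H, Subgroup.zpowers (a * k * a⁻¹) = Subgroup.zpowers h :=
  Quotient.eq.trans zpowers_rel

theorem conQ_inv (h : H) : conQ h⁻¹ = conQ h :=
  conQ_eq_iff.2 ⟨1, by simp⟩

theorem conQ_conj (a h : H) : conQ (a * h * a⁻¹) = conQ h :=
  conQ_eq_iff.2 ⟨a, rfl⟩

theorem conQMap_conQ (f : H →* K) (h : H) : conQMap f (conQ h) = conQ (f h) := rfl

/-- The average `|H|⁻¹ ∑ χ(h) [h]` of a function `χ` on the finite group `H`. For a character `χ`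
this is the image in `class_ℚ(H)` of the Hattori-Stallings rank, whose value at the conjugacy class
of `h` is `χ(h⁻¹)` divided by the order of the centralizer of `h`. -/
def classAvg [Finite H] (χ : H → ℚ) : ClassQ H :=
  letI := Fintype.ofFinite H
  (Nat.card H : ℚ)⁻¹ • ∑ h, Finsupp.single (conQ h) (χ h)

theorem classAvg_eq [Fintype H] (χ : H → ℚ) :
    classAvg χ = (Nat.card H : ℚ)⁻¹ • ∑ h, Finsupp.single (conQ h) (χ h) := by
  unfold classAvg
  congr!

/-- The coefficient sum over `con_ℚ(H)` of the traces of a matrix over `ℚH`. -/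
theorem univTrace_mapDomain [Fintype H] {n : ℕ} (A : Matrix (Fin n) (Fin n) (MonoidAlgebra ℚ H)) :
    (univTrace A).mapDomain conProj = ∑ i, ∑ h, Finsupp.single (conQ h) ((A i i).coeff h) := by
  unfold univTrace
  rw [Finsupp.mapDomain_finsetSum]
  refine Finset.sum_congr rfl fun i _ => ?_
  rw [← Finsupp.mapDomain_comp, Finsupp.mapDomain, Finsupp.sum_fintype _ _ (by simp)]
  rfl

/-- The basis of the group ring given by the group elements. -/
def groupRingBasis (H : Type u) [Group H] : Module.Basis H ℚ (MonoidAlgebra ℚ H) :=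
  Module.Basis.ofRepr (MonoidAlgebra.coeffLinearEquiv ℚ)

theorem groupRingBasis_apply (h : H) : groupRingBasis H h = MonoidAlgebra.single h 1 := by
  refine (groupRingBasis H).repr.injective ?_
  rw [Module.Basis.repr_self]
  rfl

theorem groupRingBasis_repr (x : MonoidAlgebra ℚ H) (h : H) :
    (groupRingBasis H).repr x h = x.coeff h := rfl

/-- The trace of `x ↦ h x A` on `(ℚH)^n`. -/
theorem trace_smul_vecMul [Fintype H] {n : ℕ} (A : Matrix (Fin n) (Fin n) (MonoidAlgebra ℚ H))
    (h : H) :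
    LinearMap.trace ℚ (Fin n → MonoidAlgebra ℚ H)
      (Algebra.lsmul ℚ ℚ _ (MonoidAlgebra.single h (1 : ℚ)) ∘ₗ A.vecMulLinear.restrictScalars ℚ)
      = ∑ i, ∑ g : H, (A i i).coeff (g⁻¹ * h⁻¹ * g) := by
  classical
  rw [LinearMap.trace_eq_matrix_trace ℚ (Pi.basis fun _ : Fin n => groupRingBasis H), Matrix.trace,
    ← Finset.univ_sigma_univ, Finset.sum_sigma]
  refine Finset.sum_congr rfl fun i _ => Finset.sum_congr rfl fun g _ => ?_
  rw [Matrix.diag_apply, LinearMap.toMatrix_apply, Pi.basis_repr, groupRingBasis_repr,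
    Pi.basis_apply, groupRingBasis_apply]
  simp only [LinearMap.comp_apply, LinearMap.restrictScalars_apply, Matrix.vecMulLinear_apply,
    Algebra.lsmul_coe, Pi.smul_apply, smul_eq_mul]
  have h1 : Matrix.vecMul (Pi.single i (MonoidAlgebra.single g (1 : ℚ))) A i
      = MonoidAlgebra.single g (1 : ℚ) * A i i := by
    rw [Matrix.single_vecMul]
    simp
  rw [h1, ← mul_assoc, MonoidAlgebra.single_mul_single, mul_one,
    MonoidAlgebra.coeff_single_mul_eq_mul_coeff (g⁻¹ * h⁻¹ * g), one_mul]
  intro m _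
  constructor
  · intro h2
    have h3 : m = (h * g)⁻¹ * g := by rw [eq_inv_mul_iff_mul_eq]; exact h2
    rw [h3]; group
  · rintro rfl; group

/-- The character of the image of an idempotent matrix. -/
theorem character_of_presents [Fintype H] {n : ℕ} {A : Matrix (Fin n) (Fin n) (MonoidAlgebra ℚ H)}
    {V : FinRep H} (hA : Presents A V) (h : H) :
    V.1.ρ.character h = ∑ i, ∑ g : H, (A i i).coeff (g⁻¹ * h⁻¹ * g) := by
  obtain ⟨hAA, ⟨e⟩⟩ := hA
  have := V.2
  rw [← trace_smul_vecMul]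
  let π : (Fin n → MonoidAlgebra ℚ H) →ₗ[ℚ] LinearMap.range A.vecMulLinear :=
    A.vecMulLinear.rangeRestrict.restrictScalars ℚ
  let ι : LinearMap.range A.vecMulLinear →ₗ[ℚ] (Fin n → MonoidAlgebra ℚ H) :=
    (LinearMap.range A.vecMulLinear).subtype.restrictScalars ℚ
  let l : (Fin n → MonoidAlgebra ℚ H) →ₗ[ℚ] (Fin n → MonoidAlgebra ℚ H) :=
    Algebra.lsmul ℚ ℚ _ (MonoidAlgebra.single h (1 : ℚ))
  have h1 : Algebra.lsmul ℚ ℚ _ (MonoidAlgebra.single h (1 : ℚ)) ∘ₗ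
      A.vecMulLinear.restrictScalars ℚ = (l ∘ₗ ι) ∘ₗ π := rfl
  have : Module.Finite ℚ (LinearMap.range A.vecMulLinear) :=
    Module.Finite.of_surjective π A.vecMulLinear.surjective_rangeRestrict
  rw [h1, LinearMap.trace_comp_comm']
  let E : LinearMap.range A.vecMulLinear ≃ₗ[ℚ] V.1 :=
    (e.restrictScalars ℚ).trans V.1.ρ.asModuleEquiv
  have h2 : E.conj (π ∘ₗ l ∘ₗ ι) = V.1.ρ h := by
    ext v
    rw [LinearEquiv.conj_apply_apply]
    obtain ⟨r, rfl⟩ := E.surjective v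
    rw [LinearEquiv.symm_apply_apply]
    have h3 : (π ∘ₗ l ∘ₗ ι) r = MonoidAlgebra.single h (1 : ℚ) • r := by
      refine Subtype.ext ?_
      obtain ⟨_, x, rfl⟩ := r
      change Matrix.vecMul (MonoidAlgebra.single h (1 : ℚ) • Matrix.vecMul x A) A
        = MonoidAlgebra.single h (1 : ℚ) • Matrix.vecMul x A
      rw [Matrix.smul_vecMul, Matrix.vecMul_vecMul, hAA]
    rw [h3]
    change V.1.ρ.asModuleEquiv (e _) = V.1.ρ h (V.1.ρ.asModuleEquiv (e r))
    rw [map_smul, Representation.asModuleEquiv_map_smul, Representation.asAlgebraHom_single,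
      one_smul]
  rw [← LinearMap.trace_conj' _ E, h2]
  rfl

/-- The class `|H|⁻¹ ∑ χ_V(h) [h]` of a representation. -/
def hsElt [Finite H] (V : FinRep H) : ClassQ H := classAvg V.1.ρ.character

/-- The Hattori-Stallings rank is given by the character. -/
theorem univTrace_eq_hsElt [Finite H] {n : ℕ} {A : Matrix (Fin n) (Fin n) (MonoidAlgebra ℚ H)}
    {V : FinRep H} (hA : Presents A V) : (univTrace A).mapDomain conProj = hsElt V := by
  have := Fintype.ofFinite H
  have hH : (Nat.card H : ℚ) ≠ 0 := Nat.cast_ne_zero.2 Nat.card_pos.ne'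
  rw [univTrace_mapDomain, hsElt, classAvg_eq, eq_inv_smul_iff₀ hH]
  simp only [character_of_presents hA, Finsupp.single_finsetSum]
  conv_rhs => rw [Finset.sum_comm]
  rw [Finset.smul_sum]
  refine Finset.sum_congr rfl fun i _ => ?_
  conv_rhs => rw [Finset.sum_comm]
  have key (g : H) : ∑ h : H, Finsupp.single (conQ h) ((A i i).coeff (g⁻¹ * h⁻¹ * g))
      = ∑ h : H, Finsupp.single (conQ h) ((A i i).coeff h) := by
    refine Fintype.sum_equiv ((Equiv.inv H).trans (MulAut.conj g⁻¹).toEquiv) _ _ fun h => ?_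
    have : conQ (g⁻¹ * h⁻¹ * g) = conQ h := by
      have := conQ_conj g⁻¹ h⁻¹
      rw [inv_inv] at this
      rw [this, conQ_inv]
    simp [this]
  rw [Finset.sum_congr rfl fun g _ => key g, Finset.sum_const, Finset.card_univ,
    ← Nat.card_eq_fintype_card, Nat.cast_smul_eq_nsmul]

/-- The character of an induced representation. -/
theorem character_indRep [Fintype H] [Fintype K] [DecidableEq K] (f : H →* K) (V : FinRep H)
    (k : K) : (indRep f V).1.ρ.character k
      = (Nat.card H : ℚ)⁻¹ * ∑ h, (∑ x : K, if f h * x * k⁻¹ = x then 1 else 0) *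
          V.1.ρ.character h := by
  have := V.2
  have : Module.Finite ℚ (MonoidAlgebra ℚ K) :=
    Module.Finite.equiv (MonoidAlgebra.coeffLinearEquiv ℚ).symm
  refine (trace_coinvariants _ _).trans ?_
  congr 1
  refine Finset.sum_congr rfl fun h _ => ?_
  let r : MonoidAlgebra ℚ K →ₗ[ℚ] MonoidAlgebra ℚ K :=
    MonoidAlgebra.mapDomainLinearMap ℚ ℚ fun x => x * k⁻¹
  let l : MonoidAlgebra ℚ K →ₗ[ℚ] MonoidAlgebra ℚ K := Representation.leftRegular ℚ K (f h)
  have h1 : r.rTensor V.1 ∘ₗ TensorProduct.map l (V.1.ρ h)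
      = TensorProduct.map (r ∘ₗ l) (V.1.ρ h) := by
    rw [LinearMap.rTensor, ← TensorProduct.map_comp, LinearMap.id_comp]
  have h2 : LinearMap.trace ℚ _ (r ∘ₗ l) = ∑ x : K, if f h * x * k⁻¹ = x then 1 else 0 := by
    refine trace_of_basis_map (groupRingBasis K) _ (fun x => f h * x * k⁻¹) fun x => ?_
    simp only [groupRingBasis_apply, LinearMap.comp_apply, l, r]
    rw [Representation.leftRegular, Representation.ofMulAction_single]
    simp
  refine (congrArg (LinearMap.trace ℚ _) h1).trans ?_
  rw [LinearMap.trace_tensorProduct', h2]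
  rfl

/-- Induction carries `|H|⁻¹ ∑ χ(h) [h]` to the image of this element in `class_ℚ(K)`, for every
homomorphism `f : H →* K`. -/
theorem hsElt_indRep [Finite H] [Finite K] (f : H →* K) (V : FinRep H) :
    hsElt (indRep f V) = classMap f (hsElt V) := by
  classical
  have := Fintype.ofFinite H
  have := Fintype.ofFinite K
  have hK : (Nat.card K : ℚ) ≠ 0 := Nat.cast_ne_zero.2 Nat.card_pos.ne'
  rw [hsElt, hsElt, classAvg_eq, classAvg_eq, map_smul, inv_smul_eq_iff₀ hK, map_sum]
  simp only [character_indRep, classMap, Finsupp.lmapDomain_apply, Finsupp.mapDomain_single,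
    conQMap_conQ]
  have h1 (k : K) (q : ℚ) : Finsupp.single (conQ k) ((Nat.card H : ℚ)⁻¹ * q)
      = (Nat.card H : ℚ)⁻¹ • Finsupp.single (conQ k) q := by
    rw [Finsupp.smul_single, smul_eq_mul]
  simp only [h1, Finsupp.single_finsetSum]
  rw [← Finset.smul_sum, smul_comm]
  congr 1
  rw [Finset.sum_comm, Finset.smul_sum]
  refine Finset.sum_congr rfl fun h _ => ?_
  simp only [Finset.sum_mul, Finsupp.single_finsetSum]
  rw [Finset.sum_comm]
  have key (x : K) : ∑ k : K, Finsupp.single (conQ k)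
      ((if f h * x * k⁻¹ = x then 1 else 0) * V.1.ρ.character h)
      = Finsupp.single (conQ (f h)) (V.1.ρ.character h) := by
    rw [Finset.sum_eq_single (x⁻¹ * f h * x)]
    · have h2 : conQ (x⁻¹ * f h * x) = conQ (f h) := by
        have := conQ_conj x⁻¹ (f h)
        rwa [inv_inv] at this
      rw [if_pos (by group), one_mul, h2]
    · intro k _ hk
      rw [if_neg, zero_mul, Finsupp.single_zero]
      intro h2
      refine hk ?_
      rw [mul_inv_eq_iff_eq_mul] at h2
      rw [mul_assoc, h2]; group
    · intro h2; exact absurd (Finset.mem_univ _) h2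
  rw [Finset.sum_congr rfl fun x _ => key x, Finset.sum_const, Finset.card_univ,
    ← Nat.card_eq_fintype_card, Nat.cast_smul_eq_nsmul]

end HattoriStallings

/-! ### The rational representation ring is determined by characters -/

section RepresentationRing

variable {H K : Type u} [Group H] [Group K]

theorem repClass_biprod {V V' V'' : FinRep H} (e : V.1 ≅ V'.1 ⊞ V''.1) :
    repClass V = repClass V' + repClass V'' := by
  have h : Finsupp.single V (1 : ℤ) - Finsupp.single V' 1 - Finsupp.single V'' 1 ∈
      Submodule.span ℤ {z : FinRep H →₀ ℤ | ∃ V V' V'' : FinRep H,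
        Nonempty (V.1 ≅ V'.1 ⊞ V''.1) ∧
          z = Finsupp.single V 1 - Finsupp.single V' 1 - Finsupp.single V'' 1} :=
    Submodule.subset_span ⟨V, V', V'', ⟨e⟩, rfl⟩
  rw [sub_sub] at h
  exact (Submodule.Quotient.eq _).2 h

/-- The direct sum of representations is the biproduct in `Rep`. -/
theorem nonempty_iso_biprod {V V' V'' : FinRep H}
    (e : (V'.1.ρ.prod V''.1.ρ).Equiv V.1.ρ) : Nonempty (V.1 ≅ V'.1 ⊞ V''.1) := by
  let i₁ : V'.1 ⟶ V.1 := Rep.ofHom (e.toIntertwiningMap.comp (.inl ℚ _ _))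
  let i₂ : V''.1 ⟶ V.1 := Rep.ofHom (e.toIntertwiningMap.comp (.inr ℚ _ _))
  let p₁ : V.1 ⟶ V'.1 := Rep.ofHom ((Representation.IntertwiningMap.fst ℚ _ _).comp
    e.symm.toIntertwiningMap)
  let p₂ : V.1 ⟶ V''.1 := Rep.ofHom ((Representation.IntertwiningMap.snd ℚ _ _).comp
    e.symm.toIntertwiningMap)
  have es (x : V'.1 × V''.1) : e.symm (e x) = x := e.symm_apply_apply x
  have h11 : i₁ ≫ p₁ = 𝟙 _ := Rep.hom_ext (Representation.IntertwiningMap.ext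
    (LinearMap.ext fun x => congrArg Prod.fst (es (x, 0))))
  have h12 : i₁ ≫ p₂ = 0 := Rep.hom_ext (Representation.IntertwiningMap.ext
    (LinearMap.ext fun x => congrArg Prod.snd (es (x, 0))))
  have h21 : i₂ ≫ p₁ = 0 := Rep.hom_ext (Representation.IntertwiningMap.ext
    (LinearMap.ext fun x => congrArg Prod.fst (es (0, x))))
  have h22 : i₂ ≫ p₂ = 𝟙 _ := Rep.hom_ext (Representation.IntertwiningMap.ext
    (LinearMap.ext fun x => congrArg Prod.snd (es (0, x))))
  have htot : p₁ ≫ i₁ + p₂ ≫ i₂ = 𝟙 _ := by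
    refine Rep.hom_ext (Representation.IntertwiningMap.ext (LinearMap.ext fun v => ?_))
    change e ((e.symm v).1, 0) + e (0, (e.symm v).2) = v
    rw [← map_add, Prod.mk_add_mk, add_zero, zero_add]
    exact e.apply_symm_apply v
  exact ⟨{
    hom := Limits.biprod.lift p₁ p₂
    inv := Limits.biprod.desc i₁ i₂
    hom_inv_id := by rw [Limits.biprod.lift_desc, htot]
    inv_hom_id := by
      apply Limits.biprod.hom_ext' <;> apply Limits.biprod.hom_ext <;> simp [h11, h12, h21, h22] }⟩

theorem character_biprod {V V' V'' : FinRep H} (e : V.1 ≅ V'.1 ⊞ V''.1) (h : H) :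
    V.1.ρ.character h = V'.1.ρ.character h + V''.1.ρ.character h := by
  have := V.2
  have := V'.2
  have := V''.2
  let i₁ : V'.1 ⟶ V.1 := Limits.biprod.inl ≫ e.inv
  let p₁ : V.1 ⟶ V'.1 := e.hom ≫ Limits.biprod.fst
  let i₂ : V''.1 ⟶ V.1 := Limits.biprod.inr ≫ e.inv
  let p₂ : V.1 ⟶ V''.1 := e.hom ≫ Limits.biprod.snd
  have h11 : i₁ ≫ p₁ = 𝟙 _ := by simp [i₁, p₁]
  have h22 : i₂ ≫ p₂ = 𝟙 _ := by simp [i₂, p₂]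
  have htot : p₁ ≫ i₁ + p₂ ≫ i₂ = 𝟙 _ := by
    have := Limits.biprod.total (X := V'.1) (Y := V''.1)
    calc p₁ ≫ i₁ + p₂ ≫ i₂ = e.hom ≫ (Limits.biprod.fst ≫ Limits.biprod.inl +
        Limits.biprod.snd ≫ Limits.biprod.inr) ≫ e.inv := by
          simp only [i₁, p₁, i₂, p₂, Preadditive.add_comp, Preadditive.comp_add, Category.assoc]
      _ = 𝟙 _ := by rw [this]; simp
  have key (W : FinRep H) (i : W.1 ⟶ V.1) (p : V.1 ⟶ W.1) (hip : i ≫ p = 𝟙 _) :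
      LinearMap.trace ℚ V.1 (V.1.ρ h ∘ₗ (i.hom.toLinearMap ∘ₗ p.hom.toLinearMap))
        = W.1.ρ.character h := by
    have := W.2
    rw [← LinearMap.comp_assoc, LinearMap.trace_comp_comm']
    unfold Representation.character
    congr 1
    ext w
    change p.hom (V.1.ρ h (i.hom w)) = W.1.ρ h w
    rw [Rep.hom_comm_apply]
    congr 1
    have := congrArg (fun q => q.hom w) hip
    exact this
  rw [← key V' i₁ p₁ h11, ← key V'' i₂ p₂ h22, ← map_add, ← LinearMap.comp_add]
  unfold Representation.character
  congr 1
  ext v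
  have := congrArg (fun q => q.hom v) htot
  exact congrArg (V.1.ρ h) this.symm

/-- The finite-dimensional representation on an invariant subspace. -/
def subRep (V : FinRep H) (P : Subrepresentation V.1.ρ) : FinRep H :=
  ⟨Rep.of P.toRepresentation, by
    have := V.2
    change Module.Finite ℚ P.toSubmodule
    infer_instance⟩

theorem isCompl_toSubmodule {V : FinRep H} {P Q : Subrepresentation V.1.ρ} (h : IsCompl P Q) :
    IsCompl P.toSubmodule Q.toSubmodule := by
  refine IsCompl.of_eq ?_ ?_
  · rw [← Subrepresentation.toSubmodule_inf, h.inf_eq_bot]; rfl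
  · rw [← Subrepresentation.toSubmodule_sup, h.sup_eq_top]; rfl

/-- A decomposition of a representation into two invariant subspaces is a direct sum. -/
theorem nonempty_iso_of_isCompl {V : FinRep H} {P Q : Subrepresentation V.1.ρ} (h : IsCompl P Q) :
    Nonempty (V.1 ≅ (subRep V P).1 ⊞ (subRep V Q).1) :=
  nonempty_iso_biprod (V' := subRep V P) (V'' := subRep V Q)
    (Representation.Equiv.mk (Submodule.prodEquivOfIsCompl _ _ (isCompl_toSubmodule h)) fun g =>
      LinearMap.ext fun _ => (map_add (V.1.ρ g) _ _).symm)

/-- The zero representation. -/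
def zeroRep (H : Type u) [Group H] : FinRep H :=
  ⟨Rep.of (Representation.trivial ℚ H PUnit.{u + 1}), by
    change Module.Finite ℚ PUnit.{u + 1}; infer_instance⟩

theorem repClass_eq_of_equiv {V W : FinRep H} (e : V.1.ρ.Equiv W.1.ρ) :
    repClass V = repClass W := by
  have key (U : FinRep H) (e : V.1.ρ.Equiv U.1.ρ) :
      repClass U = repClass V + repClass (zeroRep H) := by
    obtain ⟨i⟩ := nonempty_iso_biprod (V := U) (V' := V) (V'' := zeroRep H)
      (Representation.Equiv.mk
        ((LinearEquiv.prodUnique (R := ℚ) (M := V.1) (M₂ := PUnit.{u + 1})).trans e.toLinearEquiv)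
        fun g => LinearMap.ext fun x => 
          Representation.IntertwiningMap.isIntertwining _ _ e.toIntertwiningMap g x.1)
    exact repClass_biprod i
  rw [key V (Representation.Equiv.refl _), key W e]

/-- The direct sum of two representations. -/
def prodRep (V W : FinRep H) : FinRep H :=
  ⟨Rep.of (V.1.ρ.prod W.1.ρ), by
    have := V.2
    have := W.2
    change Module.Finite ℚ (V.1 × W.1)
    infer_instance⟩

theorem repClass_prodRep (V W : FinRep H) :
    repClass (prodRep V W) = repClass V + repClass W := by
  obtain ⟨e⟩ := nonempty_iso_biprod (V := prodRep V W) (V' := V) (V'' := W)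
    (Representation.Equiv.refl _)
  exact repClass_biprod e

theorem repClass_subRep {V : FinRep H} {P Q : Subrepresentation V.1.ρ} (h : IsCompl P Q) :
    repClass V = repClass (subRep V P) + repClass (subRep V Q) :=
  repClass_biprod (nonempty_iso_of_isCompl h).some

theorem character_subRep {V : FinRep H} {P Q : Subrepresentation V.1.ρ} (h : IsCompl P Q) (g : H) :
    V.1.ρ.character g
      = (subRep V P).1.ρ.character g + (subRep V Q).1.ρ.character g :=
  character_biprod (nonempty_iso_of_isCompl h).some g

/-- Over the rational numbers, representations of a finite group with the same character represent
the same element of the representation ring. If they are not zero, the scalar product of the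
characters shows that there is a nonzero homomorphism between them, whose image is a common summand;
one concludes by induction on the dimension. -/
theorem repClass_eq_of_character_eq [Finite H] (V W : FinRep H)
    (h : V.1.ρ.character = W.1.ρ.character) : repClass V = repClass W := by
  have := Fintype.ofFinite H
  have hH : (Nat.card H : ℚ) ≠ 0 := Nat.cast_ne_zero.2 Nat.card_pos.ne'
  have : NeZero (Nat.card H : ℚ) := ⟨hH⟩
  let _ : Invertible (Nat.card H : ℚ) := invertibleOfNonzero hH
  obtain ⟨d, hd⟩ : ∃ d, Module.finrank ℚ V.1 = d := ⟨_, rfl⟩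
  induction d using Nat.strong_induction_on generalizing V W with
  | _ d ih =>
    have := V.2
    have := W.2
    have hW : Module.finrank ℚ W.1 = d := by
      have h1 := congrFun h 1
      rw [Representation.char_one, Representation.char_one, hd] at h1
      exact_mod_cast h1.symm
    rcases Nat.eq_zero_or_pos d with rfl | hpos
    · have := Module.finrank_zero_iff.1 hd
      have := Module.finrank_zero_iff.1 hW
      exact repClass_eq_of_equiv (Representation.Equiv.mk 0 fun g =>
        LinearMap.ext fun x => Subsingleton.elim _ _)
    · -- there is a nonzero map from `V` to `W`
      obtain ⟨f, hf⟩ : ∃ f : V.1.ρ.IntertwiningMap W.1.ρ, f ≠ 0 := by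
        by_contra hcon
        push Not at hcon
        have hs : Subsingleton (V.1.ρ.IntertwiningMap W.1.ρ) :=
          ⟨fun a b => (hcon a).trans (hcon b).symm⟩
        have h1 := Representation.card_inv_mul_sum_char_mul_char_eq_finrank V.1.ρ W.1.ρ
        have h2 := Representation.card_inv_mul_sum_char_mul_char_eq_finrank V.1.ρ V.1.ρ
        rw [← h, h2, Module.finrank_zero_of_subsingleton (M := V.1.ρ.IntertwiningMap W.1.ρ)] at h1
        have h3 : Module.finrank ℚ (V.1.ρ.IntertwiningMap V.1.ρ) = 0 := by exact_mod_cast h1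
        have h4 := Module.finrank_zero_iff.1 h3
        have h5 : Representation.IntertwiningMap.id V.1.ρ = 0 := Subsingleton.elim _ _
        have : Nontrivial V.1 := Module.nontrivial_of_finrank_pos (R := ℚ) (hd ▸ hpos)
        obtain ⟨v, hv⟩ := exists_ne (0 : V.1)
        exact hv (congrArg (fun q : V.1.ρ.IntertwiningMap V.1.ρ => q v) h5)
      obtain ⟨Q, hQ⟩ := exists_isCompl f.ker
      obtain ⟨R, hR⟩ := exists_isCompl f.range
      have hQc := isCompl_toSubmodule hQ
      -- `f` maps the complement `Q` of its kernel isomorphically to its image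
      let r : (subRep V Q).1.ρ.IntertwiningMap (subRep W f.range).1.ρ :=
        ⟨(f.toLinearMap.domRestrict Q.toSubmodule).codRestrict f.range.toSubmodule
          fun x => ⟨x, rfl⟩, fun g => LinearMap.ext fun x => Subtype.ext
            (Representation.IntertwiningMap.isIntertwining _ _ f g (show Q.toSubmodule from x).1)⟩
      have hr : Function.Bijective r := by
        constructor
        · intro (x : Q.toSubmodule) (y : Q.toSubmodule) hxy
          have h1 : f (x : V.1) = f (y : V.1) := congrArg Subtype.val hxy
          have h2 : (x - y : V.1) ∈ f.ker.toSubmodule := by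
            change f ((x : V.1) - y) = 0
            rw [map_sub, h1, sub_self]
          have h3 := (Submodule.disjoint_def.1 hQc.disjoint) _ h2 (Submodule.sub_mem _ x.2 y.2)
          exact Subtype.ext (sub_eq_zero.1 h3)
        · rintro ⟨_, v, rfl⟩
          obtain ⟨a, ha, b, hb, rfl⟩ := Submodule.mem_sup.1
            (show v ∈ f.ker.toSubmodule ⊔ Q.toSubmodule by rw [hQc.sup_eq_top]; trivial)
          refine ⟨⟨b, hb⟩, Subtype.ext ?_⟩
          change f b = f (a + b)
          rw [map_add, show f a = 0 from ha, zero_add]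
      have e := Representation.IntertwiningMap.ofBijective r hr
      rw [repClass_subRep hQ, repClass_subRep hR, repClass_eq_of_equiv e, add_comm]
      congr 1
      refine ih (Module.finrank ℚ f.ker.toSubmodule) ?_ _ _ ?_ rfl
      · rw [← hd]
        refine Submodule.finrank_lt ?_
        rintro h1
        refine hf (Representation.IntertwiningMap.ext (LinearMap.ext fun v => ?_))
        have : v ∈ f.ker.toSubmodule := h1 ▸ trivial
        exact this
      · funext g
        have h1 := character_subRep hQ g
        have h2 := character_subRep hR g
        rw [h, h2, congrFun (Representation.char_iso e) g, add_comm] at h1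
        exact (add_right_cancel h1).symm

end RepresentationRing

/-! ### The rationalized representation ring is `class_ℚ` -/

section RationalRepresentationRing

variable {H K : Type u} [Group H] [Group K]

/-- The homomorphism `R_ℚ(H) → class_ℚ(H)` given by the Hattori-Stallings rank. -/
def hattoriStallings (H : Type u) [Group H] [Finite H] : RepRing H →ₗ[ℤ] ClassQ H :=
  Submodule.liftQ _ (Finsupp.linearCombination ℤ hsElt) (by
    rw [Submodule.span_le]
    rintro _ ⟨V, V', V'', ⟨e⟩, rfl⟩
    change Finsupp.linearCombination ℤ hsElt _ = 0
    have := Fintype.ofFinite H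
    simp only [map_sub, Finsupp.linearCombination_single, one_smul]
    simp only [hsElt, classAvg_eq, ← smul_sub, ← Finset.sum_sub_distrib, ← Finsupp.single_sub]
    rw [Finset.sum_eq_zero, smul_zero]
    intro h _
    rw [character_biprod e h, add_sub_cancel_left, sub_self, Finsupp.single_zero])

theorem hattoriStallings_repClass [Finite H] (V : FinRep H) :
    hattoriStallings H (repClass V) = hsElt V :=
  (Submodule.liftQ_apply _ _ _).trans (by simp)

theorem repRing_hom_ext {A : Type*} [AddCommGroup A] {φ ψ : RepRing H →ₗ[ℤ] A}
    (h : ∀ V, φ (repClass V) = ψ (repClass V)) : φ = ψ := by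
  refine Submodule.linearMap_qext _ (Finsupp.lhom_ext' fun V => LinearMap.ext_ring ?_)
  exact h V

theorem indR_repClass [Finite K] (f : H →* K) (V : FinRep H) :
    indR f (repClass V) = repClass (indRep f V) := by
  refine (Submodule.mapQ_apply _ _ _ _).trans ?_
  rw [Finsupp.lmapDomain_apply, Finsupp.mapDomain_single]
  rfl

/-- The Hattori-Stallings rank is compatible with induction. -/
theorem hattoriStallings_indR [Finite H] [Finite K] (f : H →* K) (a : RepRing H) :
    hattoriStallings K (indR f a) = classMap f (hattoriStallings H a) := by
  have : (hattoriStallings K).comp (indR f)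
      = ((classMap f).restrictScalars ℤ).comp (hattoriStallings H) := by
    refine repRing_hom_ext fun V => ?_
    simp only [LinearMap.comp_apply, indR_repClass, hattoriStallings_repClass, hsElt_indRep]
    rfl
  exact LinearMap.congr_fun this a

/-- Elements of the representation ring are differences of classes of representations. -/
theorem exists_repClass_sub (a : RepRing H) : ∃ V W : FinRep H, a = repClass V - repClass W := by
  have hz : repClass (zeroRep H) = 0 := by
    obtain ⟨e⟩ := nonempty_iso_biprod (V := zeroRep H) (V' := zeroRep H) (V'' := zeroRep H)
      (Representation.Equiv.mk (LinearEquiv.prodUnique (R := ℚ) (M := PUnit.{u + 1})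
        (M₂ := PUnit.{u + 1})) fun g => rfl)
    have := repClass_biprod e
    simpa using this
  have hneg {V W : FinRep H} : repClass V - repClass W = -(repClass W - repClass V) := by abel
  induction a using Submodule.Quotient.induction_on with
  | H c =>
    induction c using Finsupp.induction_linear with
    | zero => exact ⟨zeroRep H, zeroRep H, (Submodule.Quotient.mk_zero _).trans (sub_self _).symm⟩
    | add c d hc hd =>
      obtain ⟨V, W, h⟩ := hc
      obtain ⟨V', W', h'⟩ := hd
      refine ⟨prodRep V V', prodRep W W', ?_⟩
      rw [Submodule.Quotient.mk_add, h, h', repClass_prodRep, repClass_prodRep]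
      abel
    | single V n =>
      have hs : (Submodule.Quotient.mk (Finsupp.single V n) : RepRing H) = n • repClass V := by
        rw [repClass, ← Submodule.Quotient.mk_smul, Finsupp.smul_single_one]
      rw [hs]
      induction n using Int.induction_on with
      | zero => exact ⟨zeroRep H, zeroRep H, by simp⟩
      | succ n ih =>
        obtain ⟨V', W', h⟩ := ih (by
          rw [repClass, ← Submodule.Quotient.mk_smul, Finsupp.smul_single_one])
        refine ⟨prodRep V V', W', ?_⟩
        rw [add_smul, h, repClass_prodRep, one_smul]
        abel
      | pred n ih =>
        obtain ⟨V', W', h⟩ := ih (by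
          rw [repClass, ← Submodule.Quotient.mk_smul, Finsupp.smul_single_one])
        refine ⟨V', prodRep V W', ?_⟩
        rw [sub_smul, h, repClass_prodRep, one_smul]
        abel

/-- A function that is constant on the rational conjugacy classes is determined by its average. -/
theorem eq_of_classAvg_eq [Finite H] {χ ψ : H → ℚ} (hχ : ∀ h k, conQ h = conQ k → χ h = χ k)
    (hψ : ∀ h k, conQ h = conQ k → ψ h = ψ k) (h : classAvg χ = classAvg ψ) : χ = ψ := by
  classical
  have := Fintype.ofFinite H
  have hH : (Nat.card H : ℚ) ≠ 0 := Nat.cast_ne_zero.2 Nat.card_pos.ne'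
  rw [classAvg_eq, classAvg_eq] at h
  have h2 := smul_right_injective _ (inv_ne_zero hH) h
  have key (χ : H → ℚ) (hχ : ∀ h k, conQ h = conQ k → χ h = χ k) (k : H) :
      (∑ h, Finsupp.single (conQ h) (χ h)) (conQ k)
        = (Finset.univ.filter fun h : H => conQ h = conQ k).card * χ k := by
    rw [Finsupp.finsetSum_apply]
    simp only [Finsupp.single_apply]
    rw [← Finset.sum_filter, ← nsmul_eq_mul]
    refine Finset.sum_eq_card_nsmul fun h hh => hχ _ _ (Finset.mem_filter.1 hh).2
  funext k
  have h3 := DFunLike.congr_fun h2 (conQ k)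
  rw [key χ hχ, key ψ hψ] at h3
  refine mul_left_cancel₀ ?_ h3
  refine Nat.cast_ne_zero.2 (Finset.card_pos.2 ⟨k, by simp⟩).ne'

/-- The character of a rational representation is constant on rational conjugacy classes. -/
theorem character_eq_of_conQ_eq [Finite H] (V : FinRep H) {h k : H} (hk : conQ h = conQ k) :
    V.1.ρ.character h = V.1.ρ.character k := by
  have := V.2
  obtain ⟨a, ha⟩ := conQ_eq_iff.1 hk
  rw [← Representation.char_conj V.1.ρ k a]
  exact (character_eq_of_zpowers_eq _ ha).symm

/-- The Hattori-Stallings rank determines the character, and thereby the class in `R_ℚ(H)`. -/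
theorem hattoriStallings_injective [Finite H] : Function.Injective (hattoriStallings H) := by
  rw [injective_iff_map_eq_zero]
  intro a ha
  obtain ⟨V, W, rfl⟩ := exists_repClass_sub a
  rw [map_sub, hattoriStallings_repClass, hattoriStallings_repClass, sub_eq_zero] at ha
  rw [sub_eq_zero]
  exact repClass_eq_of_character_eq V W (eq_of_classAvg_eq
    (fun _ _ => character_eq_of_conQ_eq V) (fun _ _ => character_eq_of_conQ_eq W) ha)

theorem character_trivialRep (h : H) : (trivialRep H).1.ρ.character h = 1 := by
  have := (trivialRep H).2
  have h1 : (trivialRep H).1.ρ h = (trivialRep H).1.ρ 1 := rfl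
  rw [Representation.character, h1]
  refine (Representation.char_one _).trans ?_
  change ((Module.finrank ℚ (ULift.{u} ℚ) : ℕ) : ℚ) = 1
  rw [LinearEquiv.finrank_eq (ULift.moduleEquiv (R := ℚ) (M := ℚ)), Module.finrank_self,
    Nat.cast_one]

theorem hsElt_trivialRep [Fintype H] :
    hsElt (trivialRep H) = (Nat.card H : ℚ)⁻¹ • ∑ h : H, Finsupp.single (conQ h) (1 : ℚ) := by
  rw [hsElt, classAvg_eq]
  simp only [character_trivialRep]

/-- Up to a nonzero factor, the Hattori-Stallings rank of the permutation module `ℚ[H/⟨h⟩]` is the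
class of `h` plus contributions of elements of smaller order. -/
theorem single_mem_span_hattoriStallings [Finite H] (h : H) :
    Finsupp.single (conQ h) (1 : ℚ) ∈ Submodule.span ℚ (Set.range (hattoriStallings H)) := by
  classical
  obtain ⟨n, hn⟩ : ∃ n, orderOf h = n := ⟨_, rfl⟩
  induction n using Nat.strong_induction_on generalizing h with
  | _ n ih =>
    let L := Subgroup.zpowers h
    have := Fintype.ofFinite L
    have hL : (Nat.card L : ℚ) ≠ 0 := Nat.cast_ne_zero.2 Nat.card_pos.ne'
    have h1 : (Nat.card L : ℚ) • hattoriStallings H (repClass (indRep L.subtype (trivialRep L)))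
        = ∑ l : L, Finsupp.single (conQ (l : H)) (1 : ℚ) := by
      rw [hattoriStallings_repClass, hsElt_indRep, hsElt_trivialRep, map_smul, smul_inv_smul₀ hL,
        map_sum]
      exact Finset.sum_congr rfl fun l _ => by
        rw [classMap, Finsupp.lmapDomain_apply, Finsupp.mapDomain_single, conQMap_conQ]; rfl
    let S : Finset L := Finset.univ.filter fun l => Subgroup.zpowers (l : H) = L
    have h2 : ∑ l ∈ S, Finsupp.single (conQ (l : H)) (1 : ℚ)
        = (S.card : ℚ) • Finsupp.single (conQ h) 1 := by
      rw [Finset.sum_congr rfl (g := fun _ => Finsupp.single (conQ h) (1 : ℚ)), Finset.sum_const,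
        Nat.cast_smul_eq_nsmul]
      intro l hl
      rw [conQ_eq_iff.2 ⟨1, by simpa using ((Finset.mem_filter.1 hl).2 : _ = L).symm⟩]
    have hS : (S.card : ℚ) ≠ 0 := Nat.cast_ne_zero.2 (Finset.card_pos.2
      ⟨⟨h, Subgroup.mem_zpowers h⟩, by simp [S, L]⟩).ne'
    have h3 : (S.card : ℚ) • Finsupp.single (conQ h) (1 : ℚ)
        ∈ Submodule.span ℚ (Set.range (hattoriStallings H)) := by
      rw [← h2, ← add_sub_cancel_right (∑ l ∈ S, Finsupp.single (conQ (l : H)) (1 : ℚ))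
        (∑ l ∈ Sᶜ, Finsupp.single (conQ (l : H)) (1 : ℚ)), Finset.sum_add_sum_compl, ← h1]
      refine Submodule.sub_mem _ (Submodule.smul_mem _ _ (Submodule.subset_span ⟨_, rfl⟩)) ?_
      refine Submodule.sum_mem _ fun l hl => ih _ ?_ _ rfl
      have hl' : Subgroup.zpowers (l : H) ≠ L := by simpa [S] using hl
      have hle : Subgroup.zpowers (l : H) ≤ L := Subgroup.zpowers_le.2 l.2
      rw [← hn, ← Nat.card_zpowers, ← Nat.card_zpowers]
      exact lt_of_le_of_ne (Subgroup.card_le_of_le hle) fun hc =>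
        hl' (Subgroup.eq_of_le_of_card_ge hle hc.ge)
    have := Submodule.smul_mem _ (S.card : ℚ)⁻¹ h3
    rwa [inv_smul_smul₀ hS] at this

/-- Every element of `ℚ ⊗ A` is of the form `n⁻¹ ⊗ a`. -/
theorem exists_eq_inv_tmul {A : Type*} [AddCommGroup A] (z : ℚ ⊗[ℤ] A) :
    ∃ (n : ℕ) (a : A), n ≠ 0 ∧ z = (n : ℚ)⁻¹ ⊗ₜ[ℤ] a := by
  induction z using TensorProduct.induction_on with
  | zero => exact ⟨1, 0, one_ne_zero, by simp⟩
  | tmul q a =>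
    refine ⟨q.den, q.num • a, q.den_ne_zero, ?_⟩
    rw [← TensorProduct.smul_tmul, zsmul_eq_mul, ← div_eq_mul_inv, Rat.num_div_den]
  | add x y hx hy =>
    obtain ⟨n, a, hn, rfl⟩ := hx
    obtain ⟨m, b, hm, rfl⟩ := hy
    have hn' : (n : ℚ) ≠ 0 := Nat.cast_ne_zero.2 hn
    have hm' : (m : ℚ) ≠ 0 := Nat.cast_ne_zero.2 hm
    refine ⟨n * m, (m : ℤ) • a + (n : ℤ) • b, mul_ne_zero hn hm, ?_⟩
    rw [TensorProduct.tmul_add, ← TensorProduct.smul_tmul, ← TensorProduct.smul_tmul]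
    congr 2 <;> · push_cast [zsmul_eq_mul]; field_simp

/-- An injective homomorphism from an abelian group to a rational vector space whose image spans
becomes an isomorphism after rationalization. -/
theorem liftBaseChange_bijective {A M : Type*} [AddCommGroup A] [AddCommGroup M] [Module ℚ M]
    (φ : A →ₗ[ℤ] M) (hφ : Function.Injective φ) (hs : Submodule.span ℚ (Set.range φ) = ⊤) :
    Function.Bijective (φ.liftBaseChange ℚ) := by
  constructor
  · rw [injective_iff_map_eq_zero]
    intro z hz
    obtain ⟨n, a, hn, rfl⟩ := exists_eq_inv_tmul z
    rw [LinearMap.liftBaseChange_tmul, smul_eq_zero] at hz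
    rcases hz with h | h
    · exact absurd h (inv_ne_zero (Nat.cast_ne_zero.2 hn))
    · rw [(injective_iff_map_eq_zero φ).1 hφ a h, TensorProduct.tmul_zero]
  · rw [← LinearMap.range_eq_top, eq_top_iff, ← hs, Submodule.span_le]
    rintro _ ⟨a, rfl⟩
    exact ⟨1 ⊗ₜ a, by simp⟩

/-- The isomorphism `ℚ ⊗ R_ℚ(H) ≅ class_ℚ(H)`. -/
def ratEquiv (H : Type u) [Group H] [Finite H] : (ℚ ⊗[ℤ] RepRing H) ≃ₗ[ℚ] ClassQ H :=
  LinearEquiv.ofBijective ((hattoriStallings H).liftBaseChange ℚ)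
    (liftBaseChange_bijective _ hattoriStallings_injective (by
      rw [eq_top_iff]
      rintro x -
      induction x using Finsupp.induction_linear with
      | zero => exact Submodule.zero_mem _
      | add a b ha hb => exact Submodule.add_mem _ ha hb
      | single c q =>
        induction c using Quotient.inductionOn with
        | h h =>
          rw [← Finsupp.smul_single_one]
          exact Submodule.smul_mem _ _ (single_mem_span_hattoriStallings h)))

theorem ratEquiv_tmul [Finite H] (q : ℚ) (a : RepRing H) :
    ratEquiv H (q ⊗ₜ a) = q • hattoriStallings H a := by
  simp [ratEquiv]

/-- Induction along an isomorphism preserves the trivial representation. -/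
theorem indR_trivialRep [Finite H] [Finite K] (f : H →* K) (hf : Function.Bijective f) :
    indR f (repClass (trivialRep H)) = repClass (trivialRep K) := by
  have := Fintype.ofFinite H
  have := Fintype.ofFinite K
  refine hattoriStallings_injective ?_
  rw [hattoriStallings_indR, hattoriStallings_repClass, hattoriStallings_repClass, hsElt_trivialRep,
    hsElt_trivialRep, map_smul, map_sum, Nat.card_eq_of_bijective f hf, ← hf.sum_comp]
  congr 1
  exact Finset.sum_congr rfl fun l _ => by
    rw [classMap, Finsupp.lmapDomain_apply, Finsupp.mapDomain_single, conQMap_conQ]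

end RationalRepresentationRing

namespace ProperGCW

/-! ### Isomorphisms in the component category -/

section Isomorphisms

variable {G : Type u} [Group G] {X : Type v} [TopologicalSpace X] [MulAction G X]

theorem PiZero.conjHom_injective {H K : Subgroup G} (s : (G ⧸ H) →[G] (G ⧸ K)) :
    Function.Injective (conjHom s) := fun a b hab => by
  have h : (repElt s)⁻¹ * a * repElt s = (repElt s)⁻¹ * b * repElt s := congrArg Subtype.val hab
  exact Subtype.ext (mul_left_cancel (mul_right_cancel h))

theorem PiZero.card_le {x y : PiZero G X} [Finite y.H] (f : x ⟶ y) :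
    Nat.card x.H ≤ Nat.card y.H :=
  Nat.card_le_card_of_injective _ (PiZero.conjHom_injective (PiZero.homMap f))

theorem PiZero.card_eq {x y : PiZero G X} [Finite x.H] [Finite y.H] (e : x ≅ y) :
    Nat.card x.H = Nat.card y.H :=
  le_antisymm (PiZero.card_le e.hom) (PiZero.card_le e.inv)

theorem PiZero.conjHom_bijective {x y : PiZero G X} [Finite x.H] [Finite y.H] (e : x ≅ y) :
    Function.Bijective (conjHom (PiZero.homMap e.hom)) := by
  have := Fintype.ofFinite x.H
  have := Fintype.ofFinite y.H
  refine (Fintype.bijective_iff_injective_and_card _).2 ⟨PiZero.conjHom_injective _, ?_⟩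
  rw [← Nat.card_eq_fintype_card, ← Nat.card_eq_fintype_card]
  exact PiZero.card_eq e

theorem PiZero.mem_iff_of_card_le {x y : PiZero G X} [Finite y.H] (f : x ⟶ y)
    (hc : Nat.card y.H ≤ Nat.card x.H) {g : G}
    (hg : (g : G ⧸ y.H) = PiZero.homMap f ((1 : G) : G ⧸ x.H)) (h : G) :
    h ∈ x.H ↔ g⁻¹ * h * g ∈ y.H := by
  refine ⟨conj_mem_of_coset _ hg, fun hh => ?_⟩
  have hle : x.H.map (MulAut.conj g⁻¹).toMonoidHom ≤ y.H := by
    rintro _ ⟨k, hk, rfl⟩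
    have := conj_mem_of_coset _ hg hk
    simpa using this
  have heq := Subgroup.eq_of_le_of_card_ge hle (by
    rwa [Nat.card_congr (x.H.equivMapOfInjective _ (MulAut.conj g⁻¹).injective).toEquiv.symm])
  rw [← heq] at hh
  obtain ⟨k, hk, hk'⟩ := hh
  have : k = h := by
    have h2 : g⁻¹ * k * g = g⁻¹ * h * g := by simpa using hk'
    exact mul_left_cancel (mul_right_cancel h2)
  exact this ▸ hk

theorem PiZero.cls_eq_iff {x y : PiZero G X} : x.cls = y.cls ↔ Nonempty (x ≅ y) :=
  Quotient.eq

theorem conQ_conjHom {H K : Subgroup G} (s : (G ⧸ H) →[G] (G ⧸ K)) {g : G}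
    (hg : (g : G ⧸ K) = s ((1 : G) : G ⧸ H)) (h : H) :
    conQ (conjHom s h) = conQ ⟨g⁻¹ * h * g, conj_mem_of_coset s hg h.2⟩ := by
  have h1 : g⁻¹ * repElt s ∈ K := QuotientGroup.eq.1 (hg.trans (mk_repElt s).symm)
  rw [← conQ_conj ⟨_, h1⟩ (conjHom s h)]
  congr 1
  refine Subtype.ext ?_
  change g⁻¹ * repElt s * ((repElt s)⁻¹ * h * repElt s) * (g⁻¹ * repElt s)⁻¹ = _
  group

theorem ext_conQ {H : Type u} [Group H] {N : Type*} [AddCommGroup N] [Module ℚ N]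
    {φ ψ : ClassQ H →ₗ[ℚ] N}
    (h : ∀ h, φ (Finsupp.single (conQ h) 1) = ψ (Finsupp.single (conQ h) 1)) : φ = ψ := by
  refine Finsupp.lhom_ext' fun c => LinearMap.ext_ring ?_
  induction c using Quotient.inductionOn with
  | h k => exact h k

variable [ContinuousConstSMul G X]

theorem joinedIn_fix_smul {H K : Subgroup G} (g : G) (hg : ∀ k ∈ K, g⁻¹ * k * g ∈ H) {p q : X}
    (h : JoinedIn (Fix H X) p q) : JoinedIn (Fix K X) (g • p) (g • q) := by
  have h2 := JoinedIn.map h (f := fun p : X => g • p) (continuous_const_smul g)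
  refine h2.mono ?_
  rintro _ ⟨p, hp, rfl⟩ k hk
  have h3 := hp _ (hg k hk)
  rwa [mul_smul, mul_smul, inv_smul_eq_iff] at h3

/-- The isomorphism `x ≅ y`, `1H ↦ gK`, where `H = gKg⁻¹` and `gy(1K)` lies in `X^H(x)`. -/
def PiZero.isoOf {x y : PiZero G X} (g : G) (hg : ∀ h, h ∈ x.H ↔ g⁻¹ * h * g ∈ y.H)
    (h : JoinedIn (Fix x.H X) (g • (y.pt : X)) x.pt) : x ≅ y where
  hom := PiZero.homOf g (fun h hh => (hg h).1 hh) h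
  inv := PiZero.homOf g⁻¹ (fun k hk => (hg _).2 (by simpa [mul_assoc] using hk)) (by
    have := joinedIn_fix_smul (K := y.H) g⁻¹
      (fun k hk => (hg _).2 (by simpa [mul_assoc] using hk)) h
    rw [inv_smul_smul] at this
    exact this.symm)
  hom_inv_id := PiZero.hom_ext (by
    rw [PiZero.homMap_comp, MulActionHom.comp_apply, PiZero.homMap_homOf, PiZero.homMap_homOf,
      cosetMap_mk, cosetMap_mk, one_mul, mul_inv_cancel]
    rfl)
  inv_hom_id := PiZero.hom_ext (by
    rw [PiZero.homMap_comp, MulActionHom.comp_apply, PiZero.homMap_homOf, PiZero.homMap_homOf,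
      cosetMap_mk, cosetMap_mk, one_mul, inv_mul_cancel]
    rfl)

/-- A morphism between objects with isotropy groups of the same finite order is an
isomorphism. -/
theorem PiZero.isIso_of_card_le {x y : PiZero G X} [Finite y.H] (f : x ⟶ y)
    (hc : Nat.card y.H ≤ Nat.card x.H) : IsIso f := by
  let e := PiZero.isoOf (repElt (PiZero.homMap f))
    (PiZero.mem_iff_of_card_le f hc (mk_repElt _)) (PiZero.hom_joined f (mk_repElt _))
  have h : e.hom = f := PiZero.hom_ext (by
    refine (?_ : ((1 * repElt (PiZero.homMap f) : G) : G ⧸ y.H) = _)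
    rw [one_mul, mk_repElt])
  exact h ▸ inferInstance

/-- The condition for objects `x : G/H → X` and `y : G/K → X` to be isomorphic. -/
theorem PiZero.nonempty_iso_iff {x y : PiZero G X} [Finite x.H] [Finite y.H] : Nonempty (x ≅ y) ↔
    ∃ g : G, (∀ h, h ∈ x.H ↔ g⁻¹ * h * g ∈ y.H) ∧
      JoinedIn (Fix x.H X) (g • (y.pt : X)) x.pt := by
  constructor
  · rintro ⟨e⟩
    exact ⟨_, PiZero.mem_iff_of_card_le e.hom (PiZero.card_eq e).ge (mk_repElt _),
      PiZero.hom_joined e.hom (mk_repElt _)⟩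
  · rintro ⟨g, hg, h⟩
    exact ⟨PiZero.isoOf g hg h⟩

end Isomorphisms

/-! ### The Hattori-Stallings isomorphism of colimits -/

section HattoriStallings

variable {G : Type u} [Group G] (X : ProperGCW.{u, v} G)

theorem classIncl_map {X : ProperGCW.{u, v} G} {x y : PiZero G X} (f : x ⟶ y) (a : ClassQ x.H) :
    classIncl y (classMap (conjHom (PiZero.homMap f)) a) = classIncl x a :=
  colimIncl_map (k := ℚ) (C := PiZero G X) (M := fun x => ClassQ x.H)
    (t := fun _ _ f => classMap (conjHom (PiZero.homMap f))) f a

/-- The map of colimits induced by the Hattori-Stallings rank. -/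
def repToClass : (ℚ ⊗[ℤ] X.RepColim) →ₗ[ℚ] X.ClassColim :=
  LinearMap.liftBaseChange ℚ (colimDesc
    (fun x => ((classIncl x).restrictScalars ℤ).comp (hattoriStallings x.H)) (by
      intro x y f a
      change classIncl y (hattoriStallings y.H (indR (conjHom (PiZero.homMap f)) a))
        = classIncl x (hattoriStallings x.H a)
      rw [hattoriStallings_indR, classIncl_map]))

theorem repToClass_tmul {X : ProperGCW.{u, v} G} (q : ℚ) (x : PiZero G X) (a : RepRing x.H) :
    X.repToClass (q ⊗ₜ repIncl x a) = q • classIncl x (hattoriStallings x.H a) := by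
  rw [repToClass, LinearMap.liftBaseChange_tmul]
  congr 1
  unfold repIncl
  rw [colimDesc_incl]
  rfl

/-- The map `class_ℚ(H) ≅ ℚ ⊗ R_ℚ(H) → ℚ ⊗ colim R_ℚ` belonging to `x : G/H → X`. -/
def classToRepAt {X : ProperGCW.{u, v} G} (x : PiZero G X) :
    ClassQ x.H →ₗ[ℚ] (ℚ ⊗[ℤ] X.RepColim) :=
  ((repIncl x).baseChange ℚ).comp (ratEquiv x.H).symm.toLinearMap

theorem classToRepAt_ratEquiv {X : ProperGCW.{u, v} G} (x : PiZero G X) (q : ℚ) (a : RepRing x.H) :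
    classToRepAt x (ratEquiv x.H (q ⊗ₜ a)) = q ⊗ₜ repIncl x a := by
  rw [classToRepAt, LinearMap.comp_apply, LinearEquiv.coe_coe, LinearEquiv.symm_apply_apply,
    LinearMap.baseChange_tmul]

theorem exists_ratEquiv {H : Type u} [Group H] [Finite H] (a : ClassQ H) :
    ∃ (q : ℚ) (r : RepRing H), a = ratEquiv H (q ⊗ₜ r) := by
  obtain ⟨b, rfl⟩ := (ratEquiv H).surjective a
  obtain ⟨n, r, -, rfl⟩ := exists_eq_inv_tmul b
  exact ⟨_, r, rfl⟩

theorem classToRepAt_map {X : ProperGCW.{u, v} G} {x y : PiZero G X} (f : x ⟶ y) (a : ClassQ x.H) :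
    classToRepAt y (classMap (conjHom (PiZero.homMap f)) a) = classToRepAt x a := by
  obtain ⟨q, r, rfl⟩ := exists_ratEquiv a
  have h : classMap (conjHom (PiZero.homMap f)) (ratEquiv x.H (q ⊗ₜ r))
      = ratEquiv y.H (q ⊗ₜ repPush (PiZero.homMap f) r) := by
    rw [ratEquiv_tmul, ratEquiv_tmul, map_smul, repPush, hattoriStallings_indR]
  rw [h, classToRepAt_ratEquiv, classToRepAt_ratEquiv, repIncl_repPush]

/-- The inverse of the map of colimits induced by the Hattori-Stallings rank. -/
def classToRep : X.ClassColim →ₗ[ℚ] (ℚ ⊗[ℤ] X.RepColim) :=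
  colimDesc (k := ℚ) (C := PiZero G X) (M := fun x => ClassQ x.H) classToRepAt
    fun _ _ f a => classToRepAt_map f a

theorem classToRep_incl {X : ProperGCW.{u, v} G} (x : PiZero G X) (a : ClassQ x.H) :
    X.classToRep (classIncl x a) = classToRepAt x a :=
  colimDesc_incl (k := ℚ) (C := PiZero G X) (M := fun x => ClassQ x.H) _ _ x a

theorem repColim_rat_ext {X : ProperGCW.{u, v} G} {N : Type*} [AddCommGroup N] [Module ℚ N]
    {φ ψ : (ℚ ⊗[ℤ] X.RepColim) →ₗ[ℚ] N}
    (h : ∀ x a, φ (1 ⊗ₜ repIncl x a) = ψ (1 ⊗ₜ repIncl x a)) : φ = ψ := by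
  refine TensorProduct.AlgebraTensorModule.curry_injective (LinearMap.ext_ring ?_)
  exact colim_hom_ext (M := fun x : PiZero G X => RepRing x.H)
    (t := fun (x y : PiZero G X) f => repPush (PiZero.homMap f)) h

theorem classColim_hom_ext {X : ProperGCW.{u, v} G} {N : Type*} [AddCommGroup N] [Module ℚ N]
    {φ ψ : X.ClassColim →ₗ[ℚ] N} (h : ∀ x a, φ (classIncl x a) = ψ (classIncl x a)) : φ = ψ :=
  colim_hom_ext (k := ℚ) (C := PiZero G X) (M := fun x => ClassQ x.H) h

theorem repToClass_classToRep {X : ProperGCW.{u, v} G} (x : PiZero G X) (a : ClassQ x.H) :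
    X.repToClass (X.classToRep (classIncl x a)) = classIncl x a := by
  obtain ⟨q, r, rfl⟩ := exists_ratEquiv a
  rw [classToRep_incl, classToRepAt_ratEquiv, repToClass_tmul, ratEquiv_tmul, map_smul]

theorem classToRep_repToClass {X : ProperGCW.{u, v} G} (x : PiZero G X) (a : RepRing x.H) :
    X.classToRep (X.repToClass (1 ⊗ₜ repIncl x a)) = 1 ⊗ₜ repIncl x a := by
  have : hattoriStallings x.H a = ratEquiv x.H (1 ⊗ₜ a) := by rw [ratEquiv_tmul, one_smul]
  rw [repToClass_tmul, one_smul, classToRep_incl, this, classToRepAt_ratEquiv]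

/-- The isomorphism of colimits given by the Hattori-Stallings rank. -/
def hsEquiv : (ℚ ⊗[ℤ] X.RepColim) ≃ₗ[ℚ] X.ClassColim :=
  LinearEquiv.ofLinearMap X.repToClass X.classToRep
    (classColim_hom_ext repToClass_classToRep) (repColim_rat_ext classToRep_repToClass)

theorem hsEquiv_tmul {X : ProperGCW.{u, v} G} (x : PiZero G X) (a : RepRing x.H) :
    X.hsEquiv (1 ⊗ₜ repIncl x a) = classIncl x (hattoriStallings x.H a) :=
  (repToClass_tmul 1 x a).trans (one_smul _ _)

theorem hsEquiv_symm_classIncl {X : ProperGCW.{u, v} G} (x : PiZero G X) (q : ℚ)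
    (r : RepRing x.H) :
    X.hsEquiv.symm (classIncl x (ratEquiv x.H (q ⊗ₜ r))) = q ⊗ₜ repIncl x r :=
  (classToRep_incl x _).trans (classToRepAt_ratEquiv x q r)

/-- The homomorphism `e₁`, which sends `[x : G/H → X]` to the class of the trivial representation
of `H`. -/
def eOne : X.U →ₗ[ℤ] X.BredonH0 :=
  Finsupp.linearCombination ℤ (Quotient.lift
    (fun x => X.betaEquiv (repIncl x (repClass (trivialRep x.H)))) (by
      rintro x y ⟨e⟩
      rw [← repIncl_repPush e.hom, repPush, indR_trivialRep _ (PiZero.conjHom_bijective e)]))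

theorem eOne_single {X : ProperGCW.{u, v} G} (x : PiZero G X) :
    X.eOne (Finsupp.single x.cls 1) = X.betaEquiv (repIncl x (repClass (trivialRep x.H))) := by
  rw [eOne, Finsupp.linearCombination_single, one_smul]
  rfl

end HattoriStallings

/-! ### Isomorphism classes of the component category -/

section Index

variable {G : Type u} [Group G] {X : ProperGCW.{u, v} G}

theorem Idx.obj_pt (j : Idx G X) : ZerothHomotopy.mk j.obj.pt = j.comp := by
  unfold Idx.obj
  rw [PiZero.ofPt_pt]
  exact Quotient.out_eq _

theorem mk_eq_mk_iff {H : Subgroup G} {p q : Fix H X} :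
    (ZerothHomotopy.mk p = ZerothHomotopy.mk q) ↔ JoinedIn (Fix H X) (p : X) q := by
  rw [joinedIn_iff_joined p.2 q.2]
  exact Quotient.eq

theorem Consub.exists_rep_eq (H : Subgroup G) :
    ∃ a : G, ∀ h, h ∈ Consub.rep (Quotient.mk _ H) ↔ a⁻¹ * h * a ∈ H := by
  have h0 : MulAction.orbitRel (ConjAct G) (Subgroup G)
      (Quotient.out (Quotient.mk _ H : Consub G)) H := Quotient.exact (Quotient.out_eq _)
  obtain ⟨a, ha⟩ := MulAction.orbitRel_apply.1 h0
  refine ⟨ConjAct.ofConjAct a, fun h => ?_⟩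
  change h ∈ Quotient.out (Quotient.mk _ H : Consub G) ↔ _
  rw [← ha]
  change h ∈ a • H ↔ _
  rw [Subgroup.mem_pointwise_smul_iff_inv_smul_mem, ConjAct.smul_def, ConjAct.ofConjAct_inv,
    inv_inv]

theorem Consub.eq_of_rep {c c' : Consub G} (g : G) (h : ∀ h, h ∈ c.rep ↔ g⁻¹ * h * g ∈ c'.rep) :
    c = c' := by
  rw [← Quotient.out_eq c, ← Quotient.out_eq c']
  refine Quotient.sound (MulAction.orbitRel_apply.2 ⟨ConjAct.toConjAct g, ?_⟩)
  ext k
  change k ∈ ConjAct.toConjAct g • c'.rep ↔ k ∈ c.rep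
  rw [Subgroup.mem_pointwise_smul_iff_inv_smul_mem, ConjAct.smul_def, ConjAct.ofConjAct_inv,
    ConjAct.ofConjAct_toConjAct, inv_inv, h]

/-- The object chosen for the orbit of the component of `p` is isomorphic to `gH ↦ gp`. -/
theorem nonempty_iso_obj_mk (c : Consub G) (p : Fix c.rep X) :
    Nonempty (Idx.obj (X := X) ⟨c, Quotient.mk _ (ZerothHomotopy.mk p)⟩ ≅ PiZero.ofPt c.rep p) := by
  let j : Idx G X := ⟨c, Quotient.mk _ (ZerothHomotopy.mk p)⟩
  obtain ⟨w, hw⟩ := MulAction.orbitRel_apply.1 (Quotient.exact (Quotient.out_eq j.2))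
  obtain ⟨n, rfl⟩ := QuotientGroup.mk_surjective w
  have h1 : ZerothHomotopy.mk ((n : Weyl c.rep) • p) = ZerothHomotopy.mk j.obj.pt :=
    hw.trans (Idx.obj_pt j).symm
  refine ⟨PiZero.isoOf n (fun h => ?_) ?_⟩
  · have h2 := (Subgroup.mem_normalizer_iff.1 (n⁻¹).2 h)
    have h3 : h ∈ c.rep ↔ (n⁻¹ : G) * h * n ∈ c.rep := by simpa using h2
    exact h3
  · have h2 := mk_eq_mk_iff.1 h1
    rw [weyl_mk_smul] at h2
    rw [PiZero.ofPt_pt]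
    exact h2

/-- Sending the orbit of a component `C` of `X^H` to the class of an object `x : G/H → X` with
`X^H(x) = C` is a bijection onto the isomorphism classes of objects. -/
theorem idx_bijective (X : ProperGCW.{u, v} G) :
    Function.Bijective fun j : Idx G X => j.obj.cls := by
  constructor
  · rintro ⟨c, o⟩ ⟨c', o'⟩ h
    obtain ⟨g, hg, hj⟩ := PiZero.nonempty_iso_iff.1 (PiZero.cls_eq_iff.1 h)
    obtain rfl : c = c' := Consub.eq_of_rep g hg
    congr 1
    have hn : g ∈ Subgroup.normalizer (c.rep : Set G) := by
      rw [← inv_mem_iff, Subgroup.mem_normalizer_iff]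
      intro k
      rw [inv_inv]
      exact hg k
    change JoinedIn (Fix c.rep X) _ _ at hj
    have h1 : ((⟨g, hn⟩ : Subgroup.normalizer (c.rep : Set G)) : Weyl c.rep)
        • (Idx.comp ⟨c, o'⟩) = Idx.comp ⟨c, o⟩ := by
      rw [← Idx.obj_pt, ← Idx.obj_pt]
      exact mk_eq_mk_iff.2 hj
    have h2 : (Quotient.mk _ (Idx.comp ⟨c, o⟩) : MulAction.orbitRel.Quotient (Weyl c.rep) _)
        = Quotient.mk _ (Idx.comp ⟨c, o'⟩) :=
      Quotient.sound (MulAction.orbitRel_apply.2 ⟨_, h1⟩)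
    exact ((Quotient.out_eq o).symm.trans h2).trans (Quotient.out_eq o')
  · intro z
    induction z using Quotient.inductionOn with
    | h x =>
      obtain ⟨a, ha⟩ := Consub.exists_rep_eq x.H
      have hp : a • (x.pt : X) ∈ Fix (Consub.rep (Quotient.mk _ x.H)) X := by
        intro h hh
        have h2 := x.pt.2 _ ((ha h).1 hh)
        rwa [mul_smul, mul_smul, inv_smul_eq_iff] at h2
      obtain ⟨e⟩ := nonempty_iso_obj_mk (Quotient.mk _ x.H) ⟨_, hp⟩
      refine ⟨_, PiZero.cls_eq_iff.2
        ⟨e ≪≫ PiZero.isoOf (x := PiZero.ofPt _ ⟨_, hp⟩) (y := x) a ha ?_⟩⟩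
      rw [PiZero.ofPt_pt]
      exact JoinedIn.refl hp

/-- The identification of `∐_{(H)} WH \ π₀(X^H)` with `Is Π₀(G, X)`. -/
def idxEquiv (X : ProperGCW.{u, v} G) : Idx G X ≃ IsPiZero G X :=
  Equiv.ofBijective _ (idx_bijective X)

/-- The index of the isomorphism class of an object. -/
def idxOf (x : PiZero G X) : Idx G X := (idxEquiv X).symm x.cls

theorem idxOf_eq_iff {x : PiZero G X} {j : Idx G X} : idxOf x = j ↔ Nonempty (j.obj ≅ x) := by
  rw [idxOf, Equiv.symm_apply_eq, eq_comm]
  exact PiZero.cls_eq_iff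

theorem nonempty_iso_idxOf (x : PiZero G X) : Nonempty ((idxOf x).obj ≅ x) :=
  idxOf_eq_iff.1 rfl

theorem idxOf_obj (j : Idx G X) : idxOf j.obj = j := idxOf_eq_iff.2 ⟨Iso.refl _⟩

theorem idxOf_eq_idxOf {x y : PiZero G X} (h : Nonempty (x ≅ y)) : idxOf x = idxOf y :=
  congrArg (idxEquiv X).symm (PiZero.cls_eq_iff.2 h)

end Index

/-! ### The colimit of the spaces of rational class functions -/

section Alpha

variable {G : Type u} [Group G] {X : ProperGCW.{u, v} G}

/-- The object `G/⟨h⟩ → X`, `1⟨h⟩ ↦ x(1H)`, for an element `h` of `H` and `x : G/H → X`. -/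
def cycObj (x : PiZero G X) (h : x.H) : PiZero G X :=
  PiZero.ofPt (Subgroup.zpowers (h : G)) ⟨x.pt, fun _ hk =>
    x.pt.2 _ ((Subgroup.zpowers_le.2 h.2) hk)⟩

theorem cycObj_H (x : PiZero G X) (h : x.H) : (cycObj x h).H = Subgroup.zpowers (h : G) := rfl

theorem cycObj_pt (x : PiZero G X) (h : x.H) : ((cycObj x h).pt : X) = x.pt :=
  congrArg Subtype.val (PiZero.ofPt_pt _ _)

theorem mem_zpowers_conj_iff (g h k : G) :
    k ∈ Subgroup.zpowers h ↔ g⁻¹ * k * g ∈ Subgroup.zpowers (g⁻¹ * h * g) := by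
  simp only [Subgroup.mem_zpowers_iff]
  refine exists_congr fun n => ?_
  have h1 : (g⁻¹ * h * g) ^ n = g⁻¹ * h ^ n * g := by
    have := conj_zpow (i := n) (a := g⁻¹) (b := h)
    rwa [inv_inv] at this
  rw [h1, mul_left_inj, mul_right_inj]

/-- A morphism `x ⟶ y` identifies the objects belonging to an element and its image. -/
theorem nonempty_iso_cycObj {x y : PiZero G X} (f : x ⟶ y) {g : G}
    (hg : (g : G ⧸ y.H) = PiZero.homMap f ((1 : G) : G ⧸ x.H)) (h : x.H) :
    Nonempty (cycObj x h ≅ cycObj y ⟨g⁻¹ * h * g, conj_mem_of_coset _ hg h.2⟩) := by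
  refine PiZero.nonempty_iso_iff.2 ⟨g, fun k => mem_zpowers_conj_iff _ _ _, ?_⟩
  rw [cycObj_pt, cycObj_pt]
  exact (PiZero.hom_joined f hg).mono fun p hp k hk => hp k ((Subgroup.zpowers_le.2 h.2) hk)

theorem idxOf_cycObj_of_conQ_eq {x : PiZero G X} {h k : x.H} (hk : conQ h = conQ k) :
    idxOf (cycObj x h) = idxOf (cycObj x k) := by
  obtain ⟨a, ha⟩ := conQ_eq_iff.1 hk
  have ha' := congrArg (Subgroup.map x.H.subtype) ha
  rw [MonoidHom.map_zpowers, MonoidHom.map_zpowers] at ha'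
  refine idxOf_eq_idxOf (PiZero.nonempty_iso_iff.2 ⟨a, fun l => ?_, ?_⟩)
  · rw [cycObj_H, cycObj_H, mem_zpowers_conj_iff (a⁻¹ : G)⁻¹ (k : G)]
    have : l ∈ Subgroup.zpowers (h : G) ↔ l ∈ Subgroup.zpowers ((a * k * a⁻¹ : x.H) : G) := by
      rw [show Subgroup.zpowers (h : G) = _ from ha'.symm]; rfl
    rw [this]
    have h1 : ((a⁻¹ : G)⁻¹)⁻¹ * (k : G) * (a⁻¹ : G)⁻¹ = (a : G)⁻¹ * k * a := by group
    have h2 : ((a⁻¹ : G)⁻¹)⁻¹ * ((a : G)⁻¹ * l * a) * (a⁻¹ : G)⁻¹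
        = (a : G)⁻¹ * ((a : G)⁻¹ * l * a) * a := by group
    rw [mem_zpowers_conj_iff (a : G) _ l]
    have h3 : (a : G)⁻¹ * ((a * k * a⁻¹ : x.H) : G) * a = k := by push_cast; group
    rw [h3, mem_zpowers_conj_iff (a : G) (k : G)]
    simp
  · rw [cycObj_pt, cycObj_pt, x.pt.2 a a.2]
    exact JoinedIn.refl (cycObj x h |>.pt.2 |> fun h2 => by rwa [cycObj_pt] at h2)

theorem isCyclic_idxOf_cycObj (x : PiZero G X) (h : x.H) :
    Finite (idxOf (cycObj x h)).1.rep ∧ IsCyclic (idxOf (cycObj x h)).1.rep := by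
  obtain ⟨e⟩ := nonempty_iso_idxOf (cycObj x h)
  refine ⟨X.finite_obj (idxOf (cycObj x h)).obj, ?_⟩
  have : IsCyclic (cycObj x h).H := inferInstanceAs (IsCyclic (Subgroup.zpowers (h : G)))
  exact isCyclic_of_surjective (MulEquiv.ofBijective _ (PiZero.conjHom_bijective e)).symm
    (MulEquiv.surjective _)

/-- The index of `G/⟨h⟩ → X`, `1⟨h⟩ ↦ x(1H)`. -/
def cycIdx (x : PiZero G X) (h : x.H) : CycIdx G X :=
  ⟨idxOf (cycObj x h), isCyclic_idxOf_cycObj x h⟩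

/-- The map `class_ℚ(H) → ⊕ ℚ` that sends the class of `h` to the index of `G/⟨h⟩ → X`. -/
def classToIdxAt (x : PiZero G X) : ClassQ x.H →ₗ[ℚ] (CycIdx G X →₀ ℚ) :=
  Finsupp.lmapDomain ℚ ℚ (Quotient.lift (cycIdx x) fun _ _ h =>
    Subtype.ext (idxOf_cycObj_of_conQ_eq (Quotient.sound h)))

theorem classToIdxAt_single (x : PiZero G X) (h : x.H) (q : ℚ) :
    classToIdxAt x (Finsupp.single (conQ h) q) = Finsupp.single (cycIdx x h) q := by
  rw [classToIdxAt, Finsupp.lmapDomain_apply, Finsupp.mapDomain_single]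
  rfl

theorem classMap_single {H K : Type u} [Group H] [Group K] (f : H →* K) (h : H) (q : ℚ) :
    classMap f (Finsupp.single (conQ h) q) = Finsupp.single (conQ (f h)) q := by
  rw [classMap, Finsupp.lmapDomain_apply, Finsupp.mapDomain_single, conQMap_conQ]

variable (X) in
/-- The inverse of `α`. -/
def classToIdx : X.ClassColim →ₗ[ℚ] (CycIdx G X →₀ ℚ) :=
  colimDesc (k := ℚ) (C := PiZero G X) (M := fun x => ClassQ x.H) classToIdxAt (by
    intro x y f a
    refine LinearMap.congr_fun (f := (classToIdxAt y).comp (classMap (conjHom (PiZero.homMap f))))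
      (ext_conQ fun h => ?_) a
    rw [LinearMap.comp_apply, classMap_single, classToIdxAt_single, classToIdxAt_single]
    congr 1
    exact Subtype.ext (idxOf_eq_idxOf (nonempty_iso_cycObj f (mk_repElt _) h)).symm)

theorem classToIdx_incl (x : PiZero G X) (a : ClassQ x.H) :
    X.classToIdx (classIncl x a) = classToIdxAt x a :=
  colimDesc_incl (k := ℚ) (C := PiZero G X) (M := fun x => ClassQ x.H) _ _ x a

variable (X) in
/-- The map `α`. -/
def idxToClass : (CycIdx G X →₀ ℚ) →ₗ[ℚ] X.ClassColim := Finsupp.linearCombination ℚ genElt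

theorem idxToClass_single (j : CycIdx G X) : X.idxToClass (Finsupp.single j 1) = genElt j := by
  rw [idxToClass, Finsupp.linearCombination_single, one_smul]

theorem exists_genClass (L : Type u) [Group L] [IsCyclic L] :
    ∃ l : L, (∀ x, x ∈ Subgroup.zpowers l) ∧ genClass L = conQ l :=
  ⟨_, (IsCyclic.exists_generator (α := L)).choose_spec, rfl⟩

/-- The class of an element `h` at `x : G/H → X` is `α` of the index belonging to `h`. -/
theorem genElt_cycIdx (x : PiZero G X) (h : x.H) :
    genElt (cycIdx x h) = classIncl x (Finsupp.single (conQ h) 1) := by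
  let j := cycIdx x h
  have hc : IsCyclic j.1.obj.H := j.2.2
  obtain ⟨l, hl, hl'⟩ := exists_genClass j.1.obj.H
  obtain ⟨e⟩ := nonempty_iso_idxOf (cycObj x h)
  obtain ⟨g, hg, hj⟩ := PiZero.nonempty_iso_iff.1 ⟨e⟩
  change ∀ k, k ∈ j.1.obj.H ↔ _ at hg
  rw [cycObj_H] at hg
  rw [cycObj_pt] at hj
  have hle : Subgroup.zpowers (h : G) ≤ x.H := Subgroup.zpowers_le.2 h.2
  let f : j.1.obj ⟶ x := PiZero.homOf g (fun k hk => hle ((hg k).1 hk)) hj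
  have hf : (g : G ⧸ x.H) = PiZero.homMap f ((1 : G) : G ⧸ j.1.obj.H) := by
    refine (?_ : (g : G ⧸ x.H) = ((1 * g : G) : G ⧸ x.H))
    rw [one_mul]
  change classIncl j.1.obj (Finsupp.single (genClass j.1.obj.H) 1) = _
  rw [hl', ← classIncl_map f, classMap_single, conQ_conjHom _ hf]
  congr 2
  refine conQ_eq_iff.2 ⟨1, ?_⟩
  rw [one_mul, inv_one, mul_one]
  refine Subgroup.map_injective x.H.subtype_injective ?_
  rw [MonoidHom.map_zpowers, MonoidHom.map_zpowers]
  change Subgroup.zpowers (h : G) = Subgroup.zpowers (g⁻¹ * l * g)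
  refine le_antisymm (Subgroup.zpowers_le.2 ?_) (Subgroup.zpowers_le.2 ((hg l).1 l.2))
  have h1 : g * h * g⁻¹ ∈ j.1.obj.H := (hg _).2 (by
    have : g⁻¹ * (g * h * g⁻¹) * g = (h : G) := by group
    rw [this]; exact Subgroup.mem_zpowers _)
  have h2 : g * h * g⁻¹ ∈ Subgroup.zpowers (l : G) := by
    have := hl ⟨_, h1⟩
    obtain ⟨n, hn⟩ := this
    exact ⟨n, congrArg Subtype.val hn⟩
  have h3 := (mem_zpowers_conj_iff g (l : G) _).1 h2
  have h4 : g⁻¹ * (g * h * g⁻¹) * g = (h : G) := by group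
  rwa [h4] at h3

theorem classToIdx_genElt (j : CycIdx G X) : X.classToIdx (genElt j) = Finsupp.single j 1 := by
  have hc : IsCyclic j.1.obj.H := j.2.2
  obtain ⟨l, hl, hl'⟩ := exists_genClass j.1.obj.H
  change X.classToIdx (classIncl j.1.obj (Finsupp.single (genClass j.1.obj.H) 1)) = _
  rw [hl', classToIdx_incl, classToIdxAt_single]
  congr 1
  refine Subtype.ext (idxOf_eq_iff.2 (PiZero.nonempty_iso_iff.2 ⟨1, fun h => ?_, ?_⟩))
  · rw [cycObj_H, inv_one, one_mul, mul_one]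
    refine ⟨fun hh => ?_, fun hh => (Subgroup.zpowers_le.2 l.2) hh⟩
    obtain ⟨n, hn⟩ := hl ⟨h, hh⟩
    exact ⟨n, congrArg Subtype.val hn⟩
  · rw [cycObj_pt, one_smul]
    exact JoinedIn.refl j.1.obj.pt.2

theorem idxToClass_classToIdx (x : PiZero G X) (a : ClassQ x.H) :
    X.idxToClass (X.classToIdx (classIncl x a)) = classIncl x a := by
  rw [classToIdx_incl]
  refine LinearMap.congr_fun (f := X.idxToClass.comp (classToIdxAt x)) (ext_conQ fun h => ?_) a
  rw [LinearMap.comp_apply, classToIdxAt_single, idxToClass_single, genElt_cycIdx]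

variable (X) in
/-- The isomorphism `α`. -/
def alphaEquiv : (CycIdx G X →₀ ℚ) ≃ₗ[ℚ] X.ClassColim :=
  LinearEquiv.ofLinearMap X.idxToClass X.classToIdx
    (classColim_hom_ext idxToClass_classToIdx)
    (Finsupp.lhom_ext' fun j => LinearMap.ext_ring
      ((congrArg X.classToIdx (idxToClass_single j)).trans (classToIdx_genElt j)))

theorem alphaEquiv_single (j : CycIdx G X) : X.alphaEquiv (Finsupp.single j 1) = genElt j :=
  idxToClass_single j

end Alpha

end ProperGCW

/-! ### Weighted orbit counts -/

section OrbitSums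

variable {Γ Γ' : Type*} [Group Γ] [Group Γ'] {M N : Type*} [MulAction Γ M] [MulAction Γ' N]

theorem card_stabilizer_out (m : M) :
    Nat.card (MulAction.stabilizer Γ
      (Quotient.out (Quotient.mk _ m : MulAction.orbitRel.Quotient Γ M)))
      = Nat.card (MulAction.stabilizer Γ m) :=
  Nat.card_congr (MulAction.stabilizerEquivStabilizerOfOrbitRel
    (Quotient.exact (Quotient.out_eq (Quotient.mk _ m : MulAction.orbitRel.Quotient Γ M)))).toEquiv

/-- Weighted orbit counts agree along an injection `e` that is equivariant with respect to a
bijection `φ` of the groups; `φ` need not be a homomorphism. -/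
theorem finsum_orbit_eq (φ : Γ ≃ Γ') (e : M → N) (he : Function.Injective e)
    (h : ∀ (γ : Γ) m, e (γ • m) = φ γ • e m) :
    ∑ᶠ o : MulAction.orbitRel.Quotient Γ M,
      (Nat.card (MulAction.stabilizer Γ (Quotient.out o)) : ℚ)⁻¹
    = ∑ᶠ o ∈ {o : MulAction.orbitRel.Quotient Γ' N | ∃ s ∈ Set.range e, o = Quotient.mk _ s},
      (Nat.card (MulAction.stabilizer Γ' (Quotient.out o)) : ℚ)⁻¹ := by
  let E : MulAction.orbitRel.Quotient Γ M → MulAction.orbitRel.Quotient Γ' N :=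
    Quotient.map e (by
      rintro _ m ⟨γ, rfl⟩
      exact ⟨φ γ, (h γ m).symm⟩)
  have hE : Function.Injective E := by
    rintro ⟨m⟩ ⟨m'⟩ hmm
    obtain ⟨γ, hγ⟩ := MulAction.orbitRel_apply.1 (Quotient.exact hmm)
    refine Quotient.sound (MulAction.orbitRel_apply.2 ⟨φ.symm γ, he ?_⟩)
    rw [← hγ]
    refine (h _ _).trans ?_
    rw [Equiv.apply_symm_apply]
  have hr : {o : MulAction.orbitRel.Quotient Γ' N | ∃ s ∈ Set.range e, o = Quotient.mk _ s}
      = Set.range E := by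
    ext o
    constructor
    · rintro ⟨_, ⟨m, rfl⟩, rfl⟩
      exact ⟨Quotient.mk _ m, rfl⟩
    · rintro ⟨⟨m⟩, rfl⟩
      exact ⟨e m, ⟨m, rfl⟩, rfl⟩
  rw [hr, finsum_mem_range hE]
  refine finsum_congr fun o => ?_
  induction o using Quotient.inductionOn with
  | h m =>
    rw [card_stabilizer_out]
    change _ = (Nat.card (MulAction.stabilizer Γ'
      (Quotient.out (Quotient.mk _ (e m) : MulAction.orbitRel.Quotient Γ' N))) : ℚ)⁻¹
    rw [card_stabilizer_out]
    congr 2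
    refine Nat.card_congr (φ.subtypeEquiv fun γ => ?_)
    rw [MulAction.mem_stabilizer_iff, MulAction.mem_stabilizer_iff, ← h]
    exact ⟨fun hh => congrArg e hh, fun hh => he hh⟩

theorem finsum_orbit_congr (e : M ≃ N) (φ : Γ ≃ Γ') (h : ∀ (γ : Γ) m, e (γ • m) = φ γ • e m) :
    ∑ᶠ o : MulAction.orbitRel.Quotient Γ M,
      (Nat.card (MulAction.stabilizer Γ (Quotient.out o)) : ℚ)⁻¹
    = ∑ᶠ o : MulAction.orbitRel.Quotient Γ' N,
      (Nat.card (MulAction.stabilizer Γ' (Quotient.out o)) : ℚ)⁻¹ := by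
  have hs : {o : MulAction.orbitRel.Quotient Γ' N | ∃ s ∈ Set.range e, o = Quotient.mk _ s}
      = Set.univ := by
    refine Set.eq_univ_of_forall ?_
    rintro ⟨n⟩
    exact ⟨n, e.surjective n, rfl⟩
  rw [finsum_orbit_eq φ e e.injective h, hs, finsum_mem_univ]

end OrbitSums

namespace ProperGCW

/-! ### The character map -/

section CharacterMap

variable {G : Type u} [Group G] {X : ProperGCW.{u, v} G}

theorem chComponent_congr {x x' : PiZero G X} (e : x ≅ x') (j : Idx G X) :
    chComponent x j = chComponent x' j :=
  finsum_orbit_congr (M := j.obj ⟶ x) (N := j.obj ⟶ x')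
    { toFun := fun f => f ≫ e.hom
      invFun := fun f => f ≫ e.inv
      left_inv := fun f => by simp
      right_inv := fun f => by simp } (Equiv.refl (Aut j.obj))
      fun s f => Category.assoc s.inv f e.hom

theorem nonempty_hom_of_chComponent_ne_zero {x : PiZero G X} {j : Idx G X}
    (h : chComponent x j ≠ 0) : Nonempty (j.obj ⟶ x) := by
  by_contra hc
  rw [not_nonempty_iff] at hc
  have : IsEmpty (MulAction.orbitRel.Quotient (Aut j.obj) (j.obj ⟶ x)) :=
    ⟨fun o => hc.false (Quotient.out o)⟩
  exact h (finsum_of_isEmpty _)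

/-- The restriction `G/L → X`, `1L ↦ x(1H)`, of an object `x : G/H → X` to a subgroup
`L ⊆ H`. -/
def subObj (x : PiZero G X) (L : Subgroup x.H) : PiZero G X :=
  PiZero.ofPt (L.map x.H.subtype) ⟨x.pt, fun _ hk => by
    obtain ⟨l, _, rfl⟩ := hk
    exact x.pt.2 _ l.2⟩

theorem mem_map_range_conjHom {H K : Subgroup G} (s : (G ⧸ H) →[G] (G ⧸ K)) (h : G) :
    h ∈ H ↔ (repElt s)⁻¹ * h * repElt s ∈ (conjHom s).range.map K.subtype := by
  constructor
  · intro hh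
    exact ⟨conjHom s ⟨h, hh⟩, ⟨_, rfl⟩, rfl⟩
  · rintro ⟨_, ⟨l, rfl⟩, hl⟩
    have h1 : (repElt s)⁻¹ * (l : G) * repElt s = (repElt s)⁻¹ * h * repElt s := hl
    have h2 : (l : G) = h := mul_left_cancel (mul_right_cancel h1)
    exact h2 ▸ l.2

/-- Up to isomorphism, the objects that map to `x : G/H → X` are its restrictions to subgroups
of `H`. -/
theorem exists_idxOf_subObj {x : PiZero G X} {j : Idx G X} (f : j.obj ⟶ x) :
    ∃ L, idxOf (subObj x L) = j := by
  refine ⟨(conjHom (PiZero.homMap f)).range, idxOf_eq_iff.2 (PiZero.nonempty_iso_iff.2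
    ⟨repElt (PiZero.homMap f), mem_map_range_conjHom _, ?_⟩)⟩
  have h1 : ((subObj x (conjHom (PiZero.homMap f)).range).pt : X) = x.pt :=
    congrArg Subtype.val (PiZero.ofPt_pt _ _)
  rw [h1]
  exact PiZero.hom_joined f (mk_repElt _)

theorem finite_hom_idx (x : PiZero G X) : {j : Idx G X | Nonempty (j.obj ⟶ x)}.Finite := by
  refine (Set.finite_range fun L : Subgroup x.H => idxOf (subObj x L)).subset ?_
  rintro j ⟨f⟩
  exact exists_idxOf_subObj f

theorem finite_support_chComponent (x : PiZero G X) :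
    (Function.support (chComponent x)).Finite :=
  (finite_hom_idx x).subset fun _ => nonempty_hom_of_chComponent_ne_zero

/-- The endomorphisms of an object are automorphisms, and these form one free orbit. -/
theorem chComponent_self (j : Idx G X) : chComponent j.obj j = 1 := by
  have key (s t : j.obj ⟶ j.obj) : ∃ a : Aut j.obj, a • s = t := by
    have hs := PiZero.isIso_of_card_le s le_rfl
    have ht := PiZero.isIso_of_card_le t le_rfl
    refine ⟨asIso s ≪≫ (asIso t).symm, ?_⟩
    change (asIso s ≪≫ (asIso t).symm).inv ≫ s = t
    simp
  let o : MulAction.orbitRel.Quotient (Aut j.obj) (j.obj ⟶ j.obj) := Quotient.mk _ (𝟙 _)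
  unfold chComponent
  rw [finsum_eq_single _ o, card_stabilizer_out]
  · have hs : MulAction.stabilizer (Aut j.obj) (𝟙 j.obj) = ⊥ := by
      rw [eq_bot_iff]
      intro a ha
      have h1 : a.inv ≫ 𝟙 _ = 𝟙 j.obj := MulAction.mem_stabilizer_iff.1 ha
      rw [Category.comp_id] at h1
      rw [Subgroup.mem_bot]
      have h2 := a.hom_inv_id
      rw [h1, Category.comp_id] at h2
      exact Iso.ext h2
    rw [hs]
    simp
  · rintro ⟨s⟩ hne
    obtain ⟨a, ha⟩ := key (𝟙 _) s
    exact absurd (Quotient.sound (MulAction.orbitRel_apply.2 ⟨a, ha⟩)) hne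

/-- The character map is unitriangular with respect to the order of the isotropy groups. -/
theorem eq_or_card_lt_of_chComponent_ne_zero {j k : Idx G X} (h : chComponent k.obj j ≠ 0) :
    j = k ∨ Nat.card j.obj.H < Nat.card k.obj.H := by
  obtain ⟨f⟩ := nonempty_hom_of_chComponent_ne_zero h
  rcases (PiZero.card_le f).lt_or_eq with hlt | heq
  · exact Or.inr hlt
  · have := PiZero.isIso_of_card_le f heq.ge
    refine Or.inl ?_
    rw [← idxOf_obj j, ← idxOf_obj k]
    exact idxOf_eq_idxOf ⟨asIso f⟩

variable (X) in
/-- The character map `ch`. -/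
def charMap : X.U →ₗ[ℤ] (Idx G X →₀ ℚ) :=
  Finsupp.linearCombination ℤ (Quotient.lift
    (fun x => Finsupp.ofSupportFinite (chComponent x) (finite_support_chComponent x)) (by
      rintro x y ⟨e⟩
      exact Finsupp.ext fun j => chComponent_congr e j))

theorem charMap_single (x : PiZero G X) (n : ℤ) (j : Idx G X) :
    X.charMap (Finsupp.single x.cls n) j = n * chComponent x j := by
  rw [charMap, Finsupp.linearCombination_single, Finsupp.smul_apply, zsmul_eq_mul]
  rfl

/-- An element in the kernel of `ch` vanishes at every class whose isotropy group has maximal order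
among the classes in its support. -/
theorem charMap_injective : Function.Injective X.charMap := by
  classical
  rw [injective_iff_map_eq_zero]
  intro z hz
  by_contra hne
  obtain ⟨c, hc, hmax⟩ := z.support.exists_max_image
    (fun c => Nat.card ((idxEquiv X).symm c).obj.H) (Finsupp.support_nonempty_iff.2 hne)
  let j := (idxEquiv X).symm c
  have hcj (c : IsPiZero G X) : ((idxEquiv X).symm c).obj.cls = c := (idxEquiv X).apply_symm_apply c
  have h1 : X.charMap z j = z c := by
    conv_lhs => rw [← Finsupp.sum_single z, Finsupp.sum, map_sum, Finsupp.finsetSum_apply]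
    rw [Finset.sum_eq_single c]
    · rw [← hcj c, charMap_single, hcj c]
      change _ * chComponent j.obj j = _
      rw [chComponent_self, mul_one]
    · intro d hd hdc
      rw [← hcj d, charMap_single]
      by_contra h2
      rcases eq_or_card_lt_of_chComponent_ne_zero (right_ne_zero_of_mul h2) with h3 | h3
      · exact hdc ((idxEquiv X).symm.injective h3.symm)
      · exact absurd (hmax d hd) (not_le.2 h3)
    · intro h
      exact absurd hc h
  rw [hz, Finsupp.zero_apply] at h1
  exact (Finsupp.mem_support_iff.1 hc) (by exact_mod_cast h1.symm)

/-- The basis elements lie in the image of `id ⊗ ch` by induction on the order of the isotropy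
group. -/
theorem charMap_bijective : Function.Bijective (X.charMap.liftBaseChange ℚ) := by
  classical
  refine liftBaseChange_bijective _ charMap_injective ?_
  have key (n : ℕ) : ∀ j : Idx G X, Nat.card j.obj.H = n →
      Finsupp.single j (1 : ℚ) ∈ Submodule.span ℚ (Set.range X.charMap) := by
    induction n using Nat.strong_induction_on with
    | _ n ih =>
      intro j hj
      let a := X.charMap (Finsupp.single j.obj.cls 1)
      have ha (k : Idx G X) : a k = chComponent j.obj k := by
        rw [charMap_single, Int.cast_one, one_mul]
      have h1 : Finsupp.single j (1 : ℚ) = a - a.erase j := by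
        rw [eq_sub_iff_add_eq]
        have h2 := Finsupp.single_add_erase j a
        rwa [ha, chComponent_self] at h2
      rw [h1]
      refine Submodule.sub_mem _ (Submodule.subset_span ⟨_, rfl⟩) ?_
      rw [← Finsupp.sum_single (a.erase j)]
      refine Submodule.sum_mem _ fun k hk => ?_
      rw [Finsupp.support_erase, Finset.mem_erase, Finsupp.mem_support_iff, ha] at hk
      rw [← Finsupp.smul_single_one]
      refine Submodule.smul_mem _ _ (ih _ ?_ k rfl)
      rcases eq_or_card_lt_of_chComponent_ne_zero hk.2 with h3 | h3
      · exact absurd h3 hk.1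
      · rwa [← hj]
  rw [eq_top_iff]
  rintro z -
  rw [← Finsupp.sum_single z]
  refine Submodule.sum_mem _ fun j _ => ?_
  rw [← Finsupp.smul_single_one]
  exact Submodule.smul_mem _ _ (key _ j rfl)

end CharacterMap

end ProperGCW

/-! ### Free actions and orbit counts -/

section FreeActions

variable {Γ : Type*} [Group Γ] {M E : Type*} [MulAction Γ M] [MulAction Γ E]

/-- If `Γ` acts freely on `E` and `q : E → M` is equivariant with all fibres of the same positive
size `c`, then the orbits of `E` are counted by the orbits `Γ · s` of `M` with weights
`c · |Γ_s|⁻¹`. -/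
theorem card_orbits_eq_finsum (q : E → M) (hq : ∀ (γ : Γ) e, q (γ • e) = γ • q e)
    (hfree : ∀ (γ : Γ) (e : E), γ • e = e → γ = 1) {c : ℕ} (hc : c ≠ 0)
    (hfib : ∀ s, Nat.card {e // q e = s} = c) [Finite (MulAction.orbitRel.Quotient Γ E)] :
    (Nat.card (MulAction.orbitRel.Quotient Γ E) : ℚ)
      = c * ∑ᶠ o : MulAction.orbitRel.Quotient Γ M,
        (Nat.card (MulAction.stabilizer Γ (Quotient.out o)) : ℚ)⁻¹ := by
  classical
  let Q : MulAction.orbitRel.Quotient Γ E → MulAction.orbitRel.Quotient Γ M :=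
    Quotient.map q (by
      rintro _ m ⟨γ, rfl⟩
      exact ⟨γ, (hq γ m).symm⟩)
  have hex (s : M) : Nonempty {e // q e = s} := by
    by_contra h
    rw [not_nonempty_iff] at h
    exact hc ((hfib s).symm.trans Nat.card_of_isEmpty)
  have hQ : Function.Surjective Q := by
    rintro ⟨s⟩
    obtain ⟨e, he⟩ := hex s
    exact ⟨Quotient.mk _ e, congrArg _ he⟩
  have : Finite (MulAction.orbitRel.Quotient Γ M) := Finite.of_surjective Q hQ
  have := Fintype.ofFinite (MulAction.orbitRel.Quotient Γ M)
  -- the fibre of `Q` over the orbit of `s` is the quotient of the fibre of `q` over `s` by `Γ_s`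
  have key (s : M) : Nat.card {t // Q t = Quotient.mk _ s} * Nat.card (MulAction.stabilizer Γ s)
      = c := by
    have hsec (t : {t // Q t = Quotient.mk _ s}) : ∃ e : E, Quotient.mk _ e = t.1 ∧ q e = s := by
      obtain ⟨⟨e⟩, he⟩ := t
      obtain ⟨γ, hγ⟩ := MulAction.orbitRel_apply.1 (Quotient.exact he.symm)
      exact ⟨γ • e, Quotient.sound (MulAction.orbitRel_apply.2 ⟨γ, rfl⟩), (hq γ e).trans hγ⟩
    choose σ hσ hσs using hsec
    rw [← hfib s, ← Nat.card_prod]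
    refine Nat.card_eq_of_bijective (fun p => ⟨(p.2 : Γ) • σ p.1, by
      rw [hq, hσs]; exact p.2.2⟩) ⟨?_, ?_⟩
    · rintro ⟨t, γ⟩ ⟨t', γ'⟩ h
      have h1 : (γ : Γ) • σ t = (γ' : Γ) • σ t' := congrArg Subtype.val h
      have h2 : t = t' := by
        refine Subtype.ext ?_
        rw [← hσ t, ← hσ t']
        refine Quotient.sound (MulAction.orbitRel_apply.2 ⟨(γ : Γ)⁻¹ * γ', ?_⟩)
        change ((γ : Γ)⁻¹ * γ') • σ t' = σ t
        rw [mul_smul, ← h1, inv_smul_smul]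
      subst h2
      have h3 : ((γ : Γ)⁻¹ * γ') = 1 := hfree _ (σ t) (by rw [mul_smul, ← h1, inv_smul_smul])
      exact Prod.ext rfl (Subtype.ext (inv_mul_eq_one.1 h3))
    · rintro ⟨e, he⟩
      let t : {t // Q t = Quotient.mk _ s} := ⟨Quotient.mk _ e, congrArg _ he⟩
      obtain ⟨δ, hδ⟩ := MulAction.orbitRel_apply.1 (Quotient.exact (hσ t))
      have hδ' : δ • e = σ t := hδ
      have h1 : δ • s = s := by rw [← he, ← hq, hδ', hσs, he]
      refine ⟨(t, ⟨δ⁻¹, MulAction.mem_stabilizer_iff.2 (by rw [inv_smul_eq_iff, h1])⟩), ?_⟩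
      refine Subtype.ext ?_
      change δ⁻¹ • σ t = e
      rw [← hδ', inv_smul_smul]
  rw [Nat.card_congr (Equiv.sigmaFiberEquiv Q).symm, Nat.card_sigma, finsum_eq_sum_of_fintype,
    Finset.mul_sum, Nat.cast_sum]
  refine Finset.sum_congr rfl fun o _ => ?_
  have h1 := key (Quotient.out o)
  rw [Quotient.out_eq] at h1
  have h2 : (Nat.card (MulAction.stabilizer Γ (Quotient.out o)) : ℚ) ≠ 0 := by
    intro h
    rw [Nat.cast_eq_zero] at h
    rw [h, mul_zero] at h1
    exact hc h1.symm
  rw [← h1, Nat.cast_mul, mul_inv_cancel_right₀ h2]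

end FreeActions

namespace ProperGCW

/-! ### The diagram for the trivial representation -/

section Diagram

variable {G : Type u} [Group G] {X : ProperGCW.{u, v} G}

/-- The morphism from `G/⟨h⟩ → X` to `x : G/H → X` for `h` in `H`. -/
def cycHom (x : PiZero G X) (h : x.H) : cycObj x h ⟶ x :=
  PiZero.homOf 1 (fun k hk => by
    rw [inv_one, one_mul, mul_one]
    exact (Subgroup.zpowers_le.2 h.2) hk) (by
    rw [one_smul, cycObj_pt]
    exact JoinedIn.refl (cycObj_pt x h ▸ (cycObj x h).pt.2))

/-- The pairs of an element `h` of `H` and an isomorphism from `y` to the object `G/⟨h⟩ → X`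
belonging to `h` and `x : G/H → X`. -/
def CycPair (y x : PiZero G X) : Type u := Σ h : x.H, y ≅ cycObj x h

instance (y x : PiZero G X) : MulAction (Aut y) (CycPair y x) where
  smul s e := ⟨e.1, s.symm ≪≫ e.2⟩
  one_smul e := Sigma.ext rfl (heq_of_eq (Iso.ext (Category.id_comp e.2.hom)))
  mul_smul s t e := Sigma.ext rfl (heq_of_eq (Iso.ext (Category.assoc s.inv t.inv e.2.hom)))

/-- The morphism `y ⟶ x` belonging to a pair. -/
def CycPair.toHom {y x : PiZero G X} (e : CycPair y x) : y ⟶ x := e.2.hom ≫ cycHom x e.1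

theorem CycPair.toHom_smul {y x : PiZero G X} (s : Aut y) (e : CycPair y x) :
    (s • e).toHom = s • e.toHom := Category.assoc s.inv e.2.hom _

theorem CycPair.ext_repElt {y x : PiZero G X} {h : x.H} {φ φ' : y ≅ cycObj x h}
    (hφ : PiZero.homMap φ.hom ((1 : G) : G ⧸ y.H) = PiZero.homMap φ'.hom ((1 : G) : G ⧸ y.H)) :
    (⟨h, φ⟩ : CycPair y x) = ⟨h, φ'⟩ :=
  Sigma.ext rfl (heq_of_eq (Iso.ext (PiZero.hom_ext hφ)))

theorem homMap_cycHom (x : PiZero G X) (h : x.H) (a : G) :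
    PiZero.homMap (cycHom x h) (a : G ⧸ (cycObj x h).H) = (a : G ⧸ x.H) := by
  refine (?_ : ((a * 1 : G) : G ⧸ x.H) = _)
  rw [mul_one]

theorem CycPair.toHom_one {y x : PiZero G X} (e : CycPair y x) :
    PiZero.homMap e.toHom ((1 : G) : G ⧸ y.H)
      = ((repElt (PiZero.homMap e.2.hom) : G) : G ⧸ x.H) := by
  rw [CycPair.toHom, PiZero.homMap_comp, MulActionHom.comp_apply,
    ← mk_repElt (PiZero.homMap e.2.hom), homMap_cycHom]

theorem zpowers_eq_top_iff {L : Subgroup G} (l : L) :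
    Subgroup.zpowers l = ⊤ ↔ ∀ k, k ∈ L ↔ k ∈ Subgroup.zpowers (l : G) := by
  have h1 : (Subgroup.zpowers l).map L.subtype = Subgroup.zpowers (l : G) :=
    MonoidHom.map_zpowers _ _
  rw [← h1, ← SetLike.ext_iff (p := L)]
  constructor
  · intro h
    rw [h, ← MonoidHom.range_eq_map, Subgroup.range_subtype]
  · intro h
    refine Subgroup.map_injective L.subtype_injective ?_
    rw [← h, ← MonoidHom.range_eq_map, Subgroup.range_subtype]

/-- The fibres of `CycPair y x → mor(y, x)`, where `y : G/L → X` and `x : G/H → X`, have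
`|H| |Gen(L)| / |L|` elements. -/
theorem card_cycPair_fibre {y x : PiZero G X} (s : y ⟶ x) :
    Nat.card {e : CycPair y x // e.toHom = s} * Nat.card y.H
      = Nat.card x.H * Nat.card {l : y.H // Subgroup.zpowers l = ⊤} := by
  let g := repElt (PiZero.homMap s)
  have hg : (g : G ⧸ x.H) = PiZero.homMap s ((1 : G) : G ⧸ y.H) := mk_repElt _
  -- the pairs `(k, h)` in `H × H` for which `gk` conjugates `⟨h⟩` onto `L`, where `s(1L) = gH`;
  -- here `k` is arbitrary and then `h` corresponds to a generator of `L`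
  let R : Type u := {p : x.H × x.H //
    ∀ u, u ∈ y.H ↔ (g * (p.1 : G))⁻¹ * u * (g * (p.1 : G)) ∈ Subgroup.zpowers (p.2 : G)}
  have h1 : Nat.card (x.H × {l : y.H // Subgroup.zpowers l = ⊤}) = Nat.card R := by
    refine Nat.card_eq_of_bijective (fun p => ⟨(p.1, p.1⁻¹ * ⟨g⁻¹ * p.2.1 * g,
      conj_mem_of_coset _ hg p.2.1.2⟩ * p.1), fun u => ?_⟩) ⟨?_, ?_⟩
    · rw [(zpowers_eq_top_iff p.2.1).1 p.2.2, mem_zpowers_conj_iff (g * (p.1 : G))]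
      have : (g * (p.1 : G))⁻¹ * (p.2.1 : G) * (g * (p.1 : G))
          = ((p.1⁻¹ * ⟨g⁻¹ * p.2.1 * g, conj_mem_of_coset _ hg p.2.1.2⟩ * p.1 : x.H) : G) := by
        push_cast; group
      rw [this]
    · rintro ⟨k, l⟩ ⟨k', l'⟩ h
      have h2 := congrArg Subtype.val h
      obtain ⟨rfl, h3⟩ := Prod.mk.inj h2
      have h4 : (g⁻¹ * l.1 * g : G) = g⁻¹ * l'.1 * g :=
        congrArg Subtype.val (mul_left_cancel (mul_right_cancel h3))
      exact Prod.ext rfl (Subtype.ext (Subtype.ext (mul_left_cancel (mul_right_cancel h4))))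
    · rintro ⟨⟨k, h⟩, hR⟩
      have hl : g * k * h * (g * k)⁻¹ ∈ y.H := (hR _).2 (by
        have : (g * (k : G))⁻¹ * (g * k * h * (g * k)⁻¹) * (g * k) = h := by group
        rw [this]; exact Subgroup.mem_zpowers _)
      refine ⟨(k, ⟨⟨_, hl⟩, (zpowers_eq_top_iff _).2 fun u => ?_⟩), ?_⟩
      · refine (hR u).trans ?_
        rw [mem_zpowers_conj_iff (g * (k : G)) (g * k * h * (g * k)⁻¹)]
        have : (g * (k : G))⁻¹ * (g * k * h * (g * k)⁻¹) * (g * k) = h := by group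
        rw [this]
      · refine Subtype.ext (Prod.ext rfl (Subtype.ext ?_))
        push_cast
        group
  rw [← Nat.card_prod, ← Nat.card_prod, h1]
  -- an isomorphism `1L ↦ g'⟨h⟩` over `s` and `u ∈ L` correspond to the pair `(g⁻¹ug', h)`: the
  -- elements `ug'` are the representatives of the coset `g'⟨h⟩ = Lg'`
  have hmem (e : CycPair y x) (u : G) :
      u ∈ y.H ↔ (repElt (PiZero.homMap e.2.hom))⁻¹ * u * repElt (PiZero.homMap e.2.hom)
        ∈ Subgroup.zpowers (e.1 : G) :=
    PiZero.mem_iff_of_card_le e.2.hom (PiZero.card_eq e.2).ge (mk_repElt _) u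
  have hk (e : CycPair y x) (he : e.toHom = s) (u : y.H) :
      g⁻¹ * u * repElt (PiZero.homMap e.2.hom) ∈ x.H := by
    have h2 := CycPair.toHom_one e
    rw [he, ← hg] at h2
    have h3 := QuotientGroup.eq.1 h2
    have h4 := x.H.mul_mem (conj_mem_of_coset _ hg u.2) h3
    have h5 : g⁻¹ * u * g * (g⁻¹ * repElt (PiZero.homMap e.2.hom))
      = g⁻¹ * u * repElt (PiZero.homMap e.2.hom) := by group
    rwa [h5] at h4
  refine Nat.card_eq_of_bijective (fun p => ⟨(⟨_, hk p.1.1 p.1.2 p.2⟩, p.1.1.1), fun v => ?_⟩)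
    ⟨?_, ?_⟩
  · have h2 : v ∈ y.H ↔ (p.2 : G)⁻¹ * v * p.2 ∈ y.H := by
      rw [y.H.mul_mem_cancel_right p.2.2, y.H.mul_mem_cancel_left (y.H.inv_mem p.2.2)]
    rw [h2, hmem p.1.1]
    have h3 : g * (g⁻¹ * (p.2 : G) * repElt (PiZero.homMap p.1.1.2.hom))
      = (p.2 : G) * repElt (PiZero.homMap p.1.1.2.hom) := by group
    rw [h3, mul_inv_rev]
    simp only [mul_assoc]
  · rintro ⟨⟨⟨h, φ⟩, hφ⟩, u⟩ ⟨⟨⟨h', φ'⟩, hφ'⟩, u'⟩ heq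
    obtain ⟨h2, rfl⟩ := Prod.mk.inj (congrArg Subtype.val heq)
    have h3 : g⁻¹ * u * repElt (PiZero.homMap φ.hom)
        = g⁻¹ * u' * repElt (PiZero.homMap φ'.hom) := congrArg Subtype.val h2
    rw [mul_assoc, mul_assoc] at h3
    have h4 := mul_left_cancel h3
    have h5 : (⟨h, φ⟩ : CycPair y x) = ⟨h, φ'⟩ := by
      refine CycPair.ext_repElt ?_
      rw [← mk_repElt, ← mk_repElt (PiZero.homMap φ'.hom)]
      refine QuotientGroup.eq.2 ?_
      have h6 : (repElt (PiZero.homMap φ.hom))⁻¹ * ((u : G)⁻¹ * u') * repElt (PiZero.homMap φ.hom)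
          ∈ Subgroup.zpowers (h : G) :=
        (hmem ⟨h, φ⟩ ((u : G)⁻¹ * u')).1 (y.H.mul_mem (y.H.inv_mem u.2) u'.2)
      have h7 : repElt (PiZero.homMap φ'.hom)
          = (u' : G)⁻¹ * (u * repElt (PiZero.homMap φ.hom)) := by rw [h4]; group
      have h8 := (Subgroup.zpowers (h : G)).inv_mem h6
      have h9 : (repElt (PiZero.homMap φ.hom))⁻¹ * ((u' : G)⁻¹ * (u * repElt (PiZero.homMap φ.hom)))
          = ((repElt (PiZero.homMap φ.hom))⁻¹ * ((u : G)⁻¹ * u') *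
            repElt (PiZero.homMap φ.hom))⁻¹ := by group
      rw [h7, h9]
      exact h8
    cases h5
    have h6 := mul_right_cancel h4
    exact Prod.ext rfl (Subtype.ext h6)
  · rintro ⟨⟨k, h⟩, hR⟩
    have hj : JoinedIn (Fix y.H X) ((g * k) • ((cycObj x h).pt : X)) y.pt := by
      rw [cycObj_pt, mul_smul, x.pt.2 k k.2]
      exact PiZero.hom_joined s hg
    let φ : y ≅ cycObj x h := PiZero.isoOf (g * k) hR hj
    let e : CycPair y x := ⟨h, φ⟩
    have h1 : (((g * k : G)) : G ⧸ (cycObj x h).H)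
        = ((repElt (PiZero.homMap φ.hom) : G) : G ⧸ (cycObj x h).H) := by
      rw [mk_repElt]
      refine Eq.symm (?_ : ((1 * (g * k) : G) : G ⧸ (cycObj x h).H) = _)
      rw [one_mul]
    have h2 := QuotientGroup.eq.1 h1
    have he : e.toHom = s := by
      refine PiZero.hom_ext ?_
      rw [CycPair.toHom_one, ← hg]
      refine (QuotientGroup.eq.2 ?_).symm
      have h3 := x.H.mul_mem k.2 ((Subgroup.zpowers_le.2 h.2) h2)
      have h4 : (k : G) * ((g * k)⁻¹ * repElt (PiZero.homMap φ.hom))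
          = g⁻¹ * repElt (PiZero.homMap φ.hom) := by group
      rw [h4] at h3
      exact h3
    have hu : g * k * (repElt (PiZero.homMap φ.hom))⁻¹ ∈ y.H := by
      rw [hmem e]
      have h3 := (Subgroup.zpowers (h : G)).inv_mem h2
      have h4 : ((g * k)⁻¹ * repElt (PiZero.homMap φ.hom))⁻¹ = (repElt (PiZero.homMap φ.hom))⁻¹ *
          (g * k * (repElt (PiZero.homMap φ.hom))⁻¹) * repElt (PiZero.homMap φ.hom) := by group
      rw [h4] at h3
      exact h3
    refine ⟨(⟨e, he⟩, ⟨_, hu⟩), Subtype.ext (Prod.ext (Subtype.ext ?_) rfl)⟩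
    change g⁻¹ * (g * k * (repElt (PiZero.homMap φ.hom))⁻¹) * repElt (PiZero.homMap φ.hom) = k
    group

theorem cycIdx_eq_iff {x : PiZero G X} {h : x.H} {j : CycIdx G X} :
    cycIdx x h = j ↔ Nonempty (j.1.obj ≅ cycObj x h) :=
  Subtype.ext_iff.trans idxOf_eq_iff

/-- The number of elements `h` of `H` with `G/⟨h⟩ → X` in a given isomorphism class. -/
theorem card_cycIdx_eq (x : PiZero G X) (j : CycIdx G X) :
    (Nat.card {h : x.H // cycIdx x h = j} : ℚ) * Nat.card j.1.1.rep
      = Nat.card x.H *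
        (Nat.card {l : j.1.1.rep // Subgroup.zpowers l = ⊤} * chComponent x j.1) := by
  let y := j.1.obj
  have hy : IsCyclic y.H := j.2.2
  have hfinL : Finite {l : y.H // Subgroup.zpowers l = ⊤} := inferInstance
  obtain ⟨l, hl⟩ := IsCyclic.exists_generator (α := y.H)
  have hne : Nonempty {l : y.H // Subgroup.zpowers l = ⊤} := ⟨⟨l, eq_top_iff.2 fun k _ => hl k⟩⟩
  let N := Nat.card x.H * Nat.card {l : y.H // Subgroup.zpowers l = ⊤}
  have hN : N ≠ 0 := mul_ne_zero Nat.card_pos.ne' Nat.card_pos.ne'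
  let c := N / Nat.card y.H
  have hA : Nat.card (MulAction.orbitRel.Quotient (Aut y) (CycPair y x))
      = Nat.card {h : x.H // cycIdx x h = j} ∧
      Finite (MulAction.orbitRel.Quotient (Aut y) (CycPair y x)) := by
    let F : MulAction.orbitRel.Quotient (Aut y) (CycPair y x) → {h : x.H // cycIdx x h = j} :=
      Quotient.lift (fun e => ⟨e.1, cycIdx_eq_iff.2 ⟨e.2⟩⟩) (by
        rintro _ e ⟨s, rfl⟩
        rfl)
    have hF : Function.Bijective F := by
      constructor
      · rintro ⟨⟨h, φ⟩⟩ ⟨⟨h', φ'⟩⟩ heq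
        obtain rfl : h = h' := congrArg Subtype.val heq
        refine Quotient.sound (MulAction.orbitRel_apply.2 ⟨φ' ≪≫ φ.symm, ?_⟩)
        refine Sigma.ext rfl (heq_of_eq ?_)
        change (φ' ≪≫ φ.symm).symm ≪≫ φ' = φ
        ext
        simp
      · rintro ⟨h, hh⟩
        obtain ⟨φ⟩ := cycIdx_eq_iff.1 hh
        exact ⟨Quotient.mk _ ⟨h, φ⟩, rfl⟩
    exact ⟨Nat.card_eq_of_bijective F hF, Finite.of_injective F hF.1⟩
  have := hA.2
  rcases isEmpty_or_nonempty (y ⟶ x) with hem | ⟨⟨s₀⟩⟩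
  · have h1 : IsEmpty {h : x.H // cycIdx x h = j} := by
      refine ⟨fun ⟨h, hh⟩ => ?_⟩
      obtain ⟨φ⟩ := cycIdx_eq_iff.1 hh
      exact hem.false (φ.hom ≫ cycHom x h)
    have h2 : chComponent x j.1 = 0 := by
      by_contra hc
      exact not_nonempty_iff.2 hem (nonempty_hom_of_chComponent_ne_zero hc)
    rw [h2, Nat.card_of_isEmpty]
    simp
  · have hc : c * Nat.card y.H = N := by
      have := card_cycPair_fibre s₀
      exact Nat.div_mul_cancel ⟨_, (this.symm.trans (mul_comm _ _))⟩
    have hc0 : c ≠ 0 := by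
      intro h
      rw [h, zero_mul] at hc
      exact hN hc.symm
    have key := card_orbits_eq_finsum (Γ := Aut y) (M := y ⟶ x) (E := CycPair y x) CycPair.toHom
      CycPair.toHom_smul (fun s e h => by
        obtain ⟨h', φ⟩ := e
        have h1 : s.symm ≪≫ φ = φ := eq_of_heq (Sigma.mk.inj h).2
        have h2 : s.inv ≫ φ.hom = φ.hom := congrArg Iso.hom h1
        have h3 : s.inv = 𝟙 y := by
          rw [← cancel_mono φ.hom, h2, Category.id_comp]
        have h4 := s.hom_inv_id
        rw [h3, Category.comp_id] at h4
        exact Iso.ext h4) hc0 (fun s => by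
        have := card_cycPair_fibre s
        exact Nat.eq_of_mul_eq_mul_right Nat.card_pos (this.trans hc.symm))
    rw [← hA.1, key]
    have hc' : (c : ℚ) * Nat.card y.H
        = Nat.card x.H * Nat.card {l : y.H // Subgroup.zpowers l = ⊤} := by
      exact_mod_cast hc
    change (c : ℚ) * chComponent x j.1 * Nat.card y.H = _
    rw [mul_right_comm, hc', mul_assoc]
    rfl

theorem dMap_pr_apply (z : Idx G X →₀ ℚ) (j : CycIdx G X) : X.dMap (X.pr z) j
    = z j.1 * ((Nat.card {l : j.1.1.rep // Subgroup.zpowers l = ⊤} : ℚ) / Nat.card j.1.1.rep) := by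
  classical
  rw [dMap, Finsupp.linearCombination_apply, Finsupp.sum_apply, Finsupp.sum, Finset.sum_eq_single j]
  · rw [Finsupp.smul_apply, Finsupp.single_eq_same, smul_eq_mul]
    rfl
  · intro k _ hk
    rw [Finsupp.smul_apply, Finsupp.single_eq_of_ne hk.symm, smul_zero]
  · intro h
    rw [Finsupp.notMem_support_iff.1 h, zero_smul, Finsupp.zero_apply]

/-- The Hattori-Stallings rank of the trivial representation in terms of the character map. -/
theorem idxToClass_dMap_pr_charMap (x : PiZero G X) :
    X.idxToClass (X.dMap (X.pr (X.charMap (Finsupp.single x.cls 1))))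
      = classIncl x (hattoriStallings x.H (repClass (trivialRep x.H))) := by
  classical
  rw [← idxToClass_classToIdx, classToIdx_incl]
  congr 1
  have := Fintype.ofFinite x.H
  rw [hattoriStallings_repClass, hsElt_trivialRep, map_smul, map_sum]
  simp only [classToIdxAt_single]
  refine Finsupp.ext fun j => ?_
  have hL : (Nat.card j.1.1.rep : ℚ) ≠ 0 :=
    Nat.cast_ne_zero.2 (Nat.card_pos (α := j.1.obj.H)).ne'
  have hH : (Nat.card x.H : ℚ) ≠ 0 := Nat.cast_ne_zero.2 Nat.card_pos.ne'
  rw [dMap_pr_apply, charMap_single, Int.cast_one, one_mul, Finsupp.smul_apply,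
    Finsupp.finsetSum_apply, smul_eq_mul]
  simp only [Finsupp.single_apply]
  rw [Finset.sum_boole, ← Fintype.card_subtype, ← Nat.card_eq_fintype_card]
  have := card_cycIdx_eq x j
  field_simp
  linear_combination -this

end Diagram

/-! ### Orbits of cells -/

section Cells

open Topology.RelCWComplex (cell openCell)

variable {G : Type u} [Group G] {X : ProperGCW.{u, v} G} {n m : ℕ} {s t : Set X} {p q : X}

theorem openCells_nonempty (hs : s ∈ X.openCells n) : s.Nonempty := by
  obtain ⟨e, rfl⟩ := hs
  exact Topology.RelCWComplex.openCell_nonempty n e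

theorem smul_mem_openCells (g : G) (hs : s ∈ X.openCells n) : g • s ∈ X.openCells n := by
  obtain ⟨e, rfl⟩ := hs
  obtain ⟨e', he'⟩ := X.perm g n e
  exact ⟨e', he'.symm⟩

theorem eq_of_mem_openCells (hs : s ∈ X.openCells n) (ht : t ∈ X.openCells m) (hp : p ∈ s)
    (hp' : p ∈ t) : n = m ∧ s = t := by
  obtain ⟨e, rfl⟩ := hs
  obtain ⟨e', rfl⟩ := ht
  have h2 := Topology.RelCWComplex.eq_of_not_disjoint_openCell
    (Set.not_disjoint_iff.2 ⟨_, hp, hp'⟩)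
  cases h2
  exact ⟨rfl, rfl⟩

theorem smul_eq_of_mem_openCells (hs : s ∈ X.openCells n) (hp : p ∈ s) {g : G} (hg : g • p ∈ s)
    (hq : q ∈ s) : g • q = q := by
  obtain ⟨e, rfl⟩ := hs
  exact smul_eq_of_mem_openCell hp hg q hq

theorem smul_set_eq_iff (hs : s ∈ X.openCells n) (hp : p ∈ s) (g : G) :
    g • s = s ↔ g • p = p := by
  constructor
  · intro h
    exact smul_eq_of_mem_openCells hs hp (h ▸ Set.smul_mem_smul_set hp) hp
  · intro h
    have h1 : p ∈ g • s := by
      have h2 := Set.smul_mem_smul_set (a := g) hp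
      rwa [h] at h2
    exact (eq_of_mem_openCells (smul_mem_openCells g hs) hs h1 hp).2

theorem joinedIn_of_mem_openCells (hs : s ∈ X.openCells n) (hp : p ∈ s) (hq : q ∈ s) :
    JoinedIn s p q := by
  obtain ⟨e, rfl⟩ := hs
  have h : IsPathConnected (openCell n e) :=
    ((convex_ball (0 : Fin n → ℝ) 1).isPathConnected
      ⟨0, Metric.mem_ball_self zero_lt_one⟩).image'
      ((Topology.RelCWComplex.continuousOn n e).mono Metric.ball_subset_closedBall)
  exact h.joinedIn p hp q hq

theorem subset_fix_of_mem_openCells (hs : s ∈ X.openCells n) (hp : p ∈ s) {H : Subgroup G}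
    (hpH : p ∈ Fix H X) : s ⊆ Fix H X := by
  obtain ⟨e, rfl⟩ := hs
  exact X.openCell_subset_fix H n e p hp hpH

/-- The inclusion of a component `C` of `X^H` into `X`. -/
def compVal {H : Subgroup G} {C : ZerothHomotopy (Fix H X)} (p : Comp C) : X := p.1.1

theorem compVal_injective {H : Subgroup G} {C : ZerothHomotopy (Fix H X)} :
    Function.Injective (compVal : Comp C → X) :=
  Subtype.val_injective.comp Subtype.val_injective

theorem image_compVal_preimage {L : Subgroup G} (y : Fix L X) (hs : s ∈ X.openCells n)
    (hp : p ∈ s) (h : JoinedIn (Fix L X) p y) :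
    (compVal : Comp (ZerothHomotopy.mk y) → X) '' (compVal ⁻¹' s) = s := by
  rw [Set.image_preimage_eq_iff]
  intro q hq
  have hF := subset_fix_of_mem_openCells hs hp h.source_mem
  exact ⟨⟨⟨q, hF hq⟩, mk_eq_mk_iff.2 (((joinedIn_of_mem_openCells hs hq hp).mono hF).trans h)⟩, rfl⟩

theorem mem_normalizer_of_iff {H : Subgroup G} {g : G} (h : ∀ k, k ∈ H ↔ g⁻¹ * k * g ∈ H) :
    g ∈ Subgroup.normalizer (H : Set G) := by
  rw [← inv_mem_iff, Subgroup.mem_normalizer_iff]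
  intro k
  rw [inv_inv]
  exact h k

/-- The element of `WH_C` represented by an element of `G` that normalizes `H` and maps some point
of `C` into `C`. -/
def weylElt {H : Subgroup G} {C : ZerothHomotopy (Fix H X)} (g : G)
    (hg : g ∈ Subgroup.normalizer (H : Set G)) (p q : Comp C) (hpq : g • compVal p = compVal q) :
    MulAction.stabilizer (Weyl H) C :=
  ⟨((⟨g, hg⟩ : Subgroup.normalizer (H : Set G)) : Weyl H), by
    rw [MulAction.mem_stabilizer_iff]
    have h1 : ((⟨g, hg⟩ : Subgroup.normalizer (H : Set G)) : Weyl H) • p.1 = q.1 :=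
      Subtype.ext hpq
    conv_lhs => rw [← p.2]
    exact (congrArg ZerothHomotopy.mk h1).trans q.2⟩

theorem exists_rep_stabilizer {H : Subgroup G} {C : ZerothHomotopy (Fix H X)}
    (w : MulAction.stabilizer (Weyl H) C) : ∃ g : Subgroup.normalizer (H : Set G),
      (g : Weyl H) = w.1 ∧ ∀ p : Comp C, compVal (w • p) = (g : G) • compVal p := by
  obtain ⟨w, hw⟩ := w
  obtain ⟨g, rfl⟩ := QuotientGroup.mk_surjective w
  exact ⟨g, rfl, fun p => rfl⟩

theorem image_compVal_smul {H : Subgroup G} {C : ZerothHomotopy (Fix H X)}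
    {w : MulAction.stabilizer (Weyl H) C} {g : G}
    (h : ∀ p : Comp C, compVal (w • p) = g • compVal p) (t : Set (Comp C)) :
    compVal '' (w • t) = g • (compVal '' t) := by
  change compVal '' ((fun p => w • p) '' t) = (fun p => g • p) '' (compVal '' t)
  rw [Set.image_image, Set.image_image]
  exact Set.image_congr fun p _ => h p

variable (X) in
/-- The set of `G`-orbits of open `n`-cells. -/
def orbCells (n : ℕ) : Set (MulAction.orbitRel.Quotient G (Set X)) :=
  {o | ∃ s ∈ X.openCells n, o = Quotient.mk _ s}

theorem out_mem_openCells (o : X.orbCells n) : (Quotient.out o.1 : Set X) ∈ X.openCells n := by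
  obtain ⟨o, s, hs, rfl⟩ := o
  obtain ⟨g, hg⟩ := MulAction.orbitRel_apply.1
    (Quotient.exact (Quotient.out_eq (Quotient.mk _ s : MulAction.orbitRel.Quotient G (Set X))))
  change (Quotient.out (Quotient.mk _ s : MulAction.orbitRel.Quotient G (Set X)) : Set X) ∈ _
  rw [← hg]
  exact smul_mem_openCells g hs

/-- A point of the chosen cell in an orbit of cells. -/
def orbPt (o : X.orbCells n) : X := (openCells_nonempty (out_mem_openCells o)).some

theorem orbPt_mem (o : X.orbCells n) : orbPt o ∈ (Quotient.out o.1 : Set X) :=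
  (openCells_nonempty (out_mem_openCells o)).some_mem

/-- The object `G/H → X`, `gH ↦ gp`, for a point `p` with isotropy group `H` of the chosen cell in
an orbit of cells. -/
def orbObj (o : X.orbCells n) : PiZero G X :=
  PiZero.ofPt (MulAction.stabilizer G (orbPt o)) ⟨orbPt o, fun _ hg => hg⟩

theorem orbObj_pt (o : X.orbCells n) : ((orbObj o).pt : X) = orbPt o :=
  congrArg Subtype.val (PiZero.ofPt_pt _ _)

theorem mem_orbObj_H (o : X.orbCells n) (g : G) : g ∈ (orbObj o).H ↔ g • orbPt o = orbPt o :=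
  MulAction.mem_stabilizer_iff

theorem conj_smul_eq_iff (g h : G) (p : X) : (g⁻¹ * h * g) • p = p ↔ h • g • p = g • p := by
  rw [mul_smul, mul_smul, inv_smul_eq_iff]

/-- Two maps that identify the same elements of a set have images of the same size. -/
theorem ncard_image_eq_of_iff {A B C : Type*} {S : Set A} {f : A → B} {k : A → C}
    (h : ∀ a ∈ S, ∀ b ∈ S, f a = f b ↔ k a = k b) : (f '' S).ncard = (k '' S).ncard := by
  refine Set.ncard_congr (fun b hb => k hb.choose) ?_ ?_ ?_
  · intro b hb
    exact ⟨_, hb.choose_spec.1, rfl⟩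
  · intro b b' hb hb' heq
    rw [← hb.choose_spec.2, ← hb'.choose_spec.2]
    exact (h _ hb.choose_spec.1 _ hb'.choose_spec.1).2 heq
  · rintro _ ⟨a, ha, rfl⟩
    have hb : f a ∈ f '' S := ⟨a, ha, rfl⟩
    exact ⟨f a, hb, (h _ hb.choose_spec.1 _ ha).1 hb.choose_spec.2⟩

/-- The open cells of `WH_x\X^H(x)` that are not in `WH_x\X^{>H}(x)` correspond to the `G`-orbits of
cells of type `x`. -/
theorem ncard_cells_eq (x : PiZero G X) (n : ℕ) :
    {t : Set (MulAction.orbitRel.Quotient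
        (MulAction.stabilizer (Weyl x.H) (ZerothHomotopy.mk x.pt))
        (Comp (ZerothHomotopy.mk x.pt))) |
      ∃ s ∈ X.compCells x.H (ZerothHomotopy.mk x.pt) n,
        Disjoint s (X.compSing x.H (ZerothHomotopy.mk x.pt)) ∧ t = (Quotient.mk _) '' s}.ncard
      = Nat.card {o : X.orbCells n // (orbObj o).cls = x.cls} := by
  let C := ZerothHomotopy.mk x.pt
  let S : Set (Set (Comp C)) := {s | s ∈ X.compCells x.H C n ∧ Disjoint s (X.compSing x.H C)}
  let f : Set (Comp C) → Set (MulAction.orbitRel.Quotient (MulAction.stabilizer (Weyl x.H) C)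
    (Comp C)) := fun s => (Quotient.mk _) '' s
  let k : Set (Comp C) → MulAction.orbitRel.Quotient G (Set X) :=
    fun s => Quotient.mk _ (compVal '' s)
  have hstab {s : Set (Comp C)} (hs : s ∈ S) {p : Comp C} (hp : p ∈ s) (g : G) :
      g ∈ x.H ↔ g • compVal p = compVal p := by
    refine ⟨fun hg => p.1.2 g hg, fun hg => ?_⟩
    by_contra hn
    have hlt : x.H < MulAction.stabilizer G (compVal p) :=
      lt_of_le_of_ne (fun a ha => p.1.2 a ha) fun heq => hn (heq ▸ hg)
    exact Set.disjoint_left.1 hs.2 hp hlt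
  have h1 : {t | ∃ s ∈ X.compCells x.H C n, Disjoint s (X.compSing x.H C) ∧
      t = (Quotient.mk _) '' s} = f '' S := by
    ext t
    constructor
    · rintro ⟨s, hs, hd, rfl⟩
      exact ⟨s, ⟨hs, hd⟩, rfl⟩
    · rintro ⟨s, ⟨hs, hd⟩, rfl⟩
      exact ⟨s, hs, hd, rfl⟩
  have h2 : {o | ∃ h : o ∈ X.orbCells n, (orbObj ⟨o, h⟩).cls = x.cls} = k '' S := by
    ext o
    constructor
    · rintro ⟨ho, hx⟩
      obtain ⟨g, hg, hj⟩ := PiZero.nonempty_iso_iff.1 (PiZero.cls_eq_iff.1 hx.symm)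
      rw [orbObj_pt] at hj
      have hc := smul_mem_openCells g (out_mem_openCells ⟨o, ho⟩)
      have hp := Set.smul_mem_smul_set (a := g) (orbPt_mem ⟨o, ho⟩)
      have hi := image_compVal_preimage x.pt hc hp hj
      refine ⟨compVal ⁻¹' (g • (Quotient.out o : Set X)), ⟨?_, ?_⟩, ?_⟩
      · exact (congrArg (· ∈ X.openCells n) hi).mpr hc
      · refine Set.disjoint_left.2 fun p hps
          (hlt : x.H < MulAction.stabilizer G (compVal p)) => hlt.not_ge fun a ha => ?_
        have ha' : a • compVal p = compVal p := ha
        rw [hg, mem_orbObj_H, conj_smul_eq_iff]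
        exact smul_eq_of_mem_openCells hc hps (ha'.symm ▸ hps) hp
      · change Quotient.mk _ (compVal '' _) = o
        rw [hi]
        conv_rhs => rw [← Quotient.out_eq o]
        exact Quotient.sound (MulAction.orbitRel_apply.2 ⟨g, rfl⟩)
    · rintro ⟨s, hs, rfl⟩
      have ho : k s ∈ X.orbCells n := ⟨compVal '' s, hs.1, rfl⟩
      refine ⟨ho, (PiZero.cls_eq_iff.2 ?_).symm⟩
      obtain ⟨g, hg⟩ := MulAction.orbitRel_apply.1 (Quotient.exact (Quotient.out_eq (k s)).symm)
      have hg' : g • (Quotient.out (k s) : Set X) = compVal '' s := hg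
      have hp := Set.smul_mem_smul_set (a := g) (orbPt_mem ⟨k s, ho⟩)
      rw [hg'] at hp
      obtain ⟨p, hps, hpv⟩ := hp
      refine PiZero.nonempty_iso_iff.2 ⟨g, fun h => ?_, ?_⟩
      · rw [hstab hs hps, mem_orbObj_H, conj_smul_eq_iff, hpv]
      · rw [orbObj_pt, ← hpv]
        exact mk_eq_mk_iff.1 p.2
  have h3 : Nat.card {o : X.orbCells n // (orbObj o).cls = x.cls} = (k '' S).ncard := by
    rw [← h2, ← Nat.card_coe_set_eq]
    exact Nat.card_congr (Equiv.subtypeSubtypeEquivSubtypeExists _ _)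
  rw [h3]
  refine (congrArg Set.ncard h1).trans (ncard_image_eq_of_iff fun s hs s' hs' => ?_)
  have hne : (compVal '' s').Nonempty := openCells_nonempty hs'.1
  constructor
  · intro hf
    obtain ⟨p', hp'⟩ := hne.of_image
    obtain ⟨p, hp, hpp⟩ : Quotient.mk _ p' ∈ f s := hf.symm ▸ ⟨p', hp', rfl⟩
    obtain ⟨w, hw⟩ := MulAction.orbitRel_apply.1 (Quotient.exact hpp)
    obtain ⟨g, -, hg⟩ := exists_rep_stabilizer w
    have h4 : (g : G) • compVal p' = compVal p := by rw [← hg]; exact congrArg compVal hw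
    refine Quotient.sound (MulAction.orbitRel_apply.2 ⟨g, ?_⟩)
    refine (eq_of_mem_openCells (smul_mem_openCells (g : G) hs'.1) hs.1
      (p := compVal p) ?_ ⟨p, hp, rfl⟩).2
    rw [← h4]
    exact Set.smul_mem_smul_set ⟨p', hp', rfl⟩
  · intro hk
    obtain ⟨g, hg⟩ := MulAction.orbitRel_apply.1 (Quotient.exact hk)
    have hg' : g • (compVal '' s') = compVal '' s := hg
    obtain ⟨p', hp'⟩ := hne.of_image
    obtain ⟨p, hp, hpp⟩ : g • compVal p' ∈ compVal '' s :=
      hg' ▸ Set.smul_mem_smul_set ⟨p', hp', rfl⟩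
    have hn : g ∈ Subgroup.normalizer (x.H : Set G) := mem_normalizer_of_iff fun h => by
      rw [hstab hs hp, hstab hs' hp', conj_smul_eq_iff, hpp]
    let w := weylElt g hn p' p hpp.symm
    have h4 : w • s' = s := by
      refine compVal_injective.image_injective ?_
      rw [image_compVal_smul (w := w) (g := g) (fun p => rfl), hg']
    ext z
    constructor
    · rintro ⟨a, ha, rfl⟩
      rw [← h4] at ha
      obtain ⟨b, hb, rfl⟩ := ha
      exact ⟨b, hb, (Quotient.sound (MulAction.orbitRel_apply.2 ⟨w, rfl⟩)).symm⟩
    · rintro ⟨b, hb, rfl⟩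
      exact ⟨w • b, h4 ▸ Set.smul_mem_smul_set hb,
        Quotient.sound (MulAction.orbitRel_apply.2 ⟨w, rfl⟩)⟩

end Cells

/-! ### Orbifold Euler characteristics of components -/

section Euler

variable {G : Type u} [Group G] {X : ProperGCW.{u, v} G}

theorem PiZero.homMap_isoOf_one {x y : PiZero G X} (g : G) (hg : ∀ h, h ∈ x.H ↔ g⁻¹ * h * g ∈ y.H)
    (h : JoinedIn (Fix x.H X) (g • (y.pt : X)) x.pt) :
    PiZero.homMap (PiZero.isoOf g hg h).hom ((1 : G) : G ⧸ x.H) = (g : G ⧸ y.H) := by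
  refine (?_ : ((1 * g : G) : G ⧸ y.H) = _)
  rw [one_mul]

/-- The orbit of a morphism from `y : G/L → X` to `x : G/H → X` under the automorphisms of `y` is
determined by the image of `L` in `H`. -/
theorem finite_hom_orbits (y x : PiZero G X) :
    Finite (MulAction.orbitRel.Quotient (Aut y) (y ⟶ x)) := by
  refine Finite.of_injective
    (fun o : MulAction.orbitRel.Quotient (Aut y) (y ⟶ x) =>
      (conjHom (PiZero.homMap (Quotient.out o))).range) fun o o' h => ?_
  rw [← Quotient.out_eq o, ← Quotient.out_eq o']
  simp only at h
  generalize Quotient.out o = s at h ⊢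
  generalize Quotient.out o' = s' at h ⊢
  have hr := mem_map_range_conjHom (PiZero.homMap s)
  have hr' := mem_map_range_conjHom (PiZero.homMap s')
  have hj := PiZero.hom_joined s (mk_repElt _)
  have hj' := PiZero.hom_joined s' (mk_repElt _)
  have hs := mk_repElt (PiZero.homMap s)
  rw [← h] at hr'
  generalize repElt (PiZero.homMap s) = g at hr hj hs
  obtain ⟨g', hg'⟩ : ∃ g', repElt (PiZero.homMap s') = g' := ⟨_, rfl⟩
  rw [hg'] at hr' hj'
  have hn (k : G) : k ∈ y.H ↔ (g * g'⁻¹)⁻¹ * k * (g * g'⁻¹) ∈ y.H := by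
    have h1 : g'⁻¹ * ((g * g'⁻¹)⁻¹ * k * (g * g'⁻¹)) * g' = g⁻¹ * k * g := by group
    rw [hr' ((g * g'⁻¹)⁻¹ * k * (g * g'⁻¹)), h1, ← hr]
  have hjn : JoinedIn (Fix y.H X) ((g * g'⁻¹) • (y.pt : X)) y.pt := by
    have h1 := joinedIn_fix_smul (g * g'⁻¹) (fun k hk => (hn k).1 hk) hj'
    rw [smul_smul, inv_mul_cancel_right] at h1
    exact h1.symm.trans hj
  refine Quotient.sound (MulAction.orbitRel_apply.2 ⟨(PiZero.isoOf _ hn hjn).symm, ?_⟩)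
  refine PiZero.hom_ext (f := (PiZero.isoOf _ hn hjn).hom ≫ s') ?_
  rw [PiZero.homMap_comp, MulActionHom.comp_apply, PiZero.homMap_isoOf_one, map_coset, ← hs,
    ← mk_repElt, hg']
  refine (?_ : ((g * g'⁻¹ * g' : G) : G ⧸ x.H) = _)
  rw [inv_mul_cancel_right]

/-- The element of `WH_y` by which the inverse of an automorphism of `y : G/H → X` acts. -/
def autToWeyl {y : PiZero G X} (a : Aut y) :
    MulAction.stabilizer (Weyl y.H) (ZerothHomotopy.mk y.pt) :=
  weylElt (repElt (PiZero.homMap a.inv))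
    (mem_normalizer_of_iff (PiZero.mem_iff_of_card_le a.inv le_rfl (mk_repElt _)))
    ⟨y.pt, rfl⟩ ⟨⟨_, (PiZero.hom_joined a.inv (mk_repElt _)).source_mem⟩,
      mk_eq_mk_iff.2 (PiZero.hom_joined a.inv (mk_repElt _))⟩ rfl

theorem autToWeyl_bijective (y : PiZero G X) : Function.Bijective (autToWeyl (y := y)) := by
  constructor
  · intro a b hab
    have h1 := QuotientGroup.eq.1 (congrArg Subtype.val hab)
    rw [Subgroup.mem_subgroupOf] at h1
    have h2 : a.inv = b.inv := PiZero.hom_ext (by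
      rw [← mk_repElt, ← mk_repElt (PiZero.homMap b.inv)]
      exact QuotientGroup.eq.2 h1)
    exact Iso.ext_inv h2
  · intro w
    obtain ⟨g, hg, hw⟩ := exists_rep_stabilizer w
    have hn (k : G) : k ∈ y.H ↔ (g : G)⁻¹ * k * g ∈ y.H := by
      have := Subgroup.mem_normalizer_iff.1 (g⁻¹).2 k
      simpa using this
    have hj : JoinedIn (Fix y.H X) ((g : G) • (y.pt : X)) y.pt := by
      have h1 := hw ⟨y.pt, rfl⟩
      have h2 := mk_eq_mk_iff.1 (w • (⟨y.pt, rfl⟩ : Comp (ZerothHomotopy.mk y.pt))).2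
      change JoinedIn _ (compVal _) _ at h2
      rw [h1] at h2
      exact h2
    refine ⟨(PiZero.isoOf (g : G) hn hj).symm, Subtype.ext ?_⟩
    rw [← hg]
    refine QuotientGroup.eq.2 (Subgroup.mem_subgroupOf.2 ?_)
    refine QuotientGroup.eq.1 ((mk_repElt _).trans ?_)
    exact PiZero.homMap_isoOf_one _ hn hj

/-- The cell `g · s` inside `C` that belongs to a morphism `y ⟶ x`, `1L ↦ gH`, where `y(1L)` lies
in `C` and `x` is the object belonging to the orbit of the cell `s`. -/
def homToCell {n : ℕ} {y : PiZero G X} {o : X.orbCells n} (f : y ⟶ orbObj o) :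
    Set (Comp (ZerothHomotopy.mk y.pt)) :=
  compVal ⁻¹' (repElt (PiZero.homMap f) • (Quotient.out o.1 : Set X))

theorem image_homToCell {n : ℕ} {y : PiZero G X} {o : X.orbCells n} (f : y ⟶ orbObj o) :
    compVal '' (homToCell f) = repElt (PiZero.homMap f) • (Quotient.out o.1 : Set X) := by
  refine image_compVal_preimage y.pt (smul_mem_openCells _ (out_mem_openCells o))
    (Set.smul_mem_smul_set (orbPt_mem o)) ?_
  rw [← orbObj_pt]
  exact PiZero.hom_joined f (mk_repElt _)

theorem smul_out_eq_iff {n : ℕ} {o : X.orbCells n} {g g' : G} :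
    g • (Quotient.out o.1 : Set X) = g' • (Quotient.out o.1 : Set X)
      ↔ (g : G ⧸ (orbObj o).H) = (g' : G ⧸ (orbObj o).H) := by
  rw [QuotientGroup.eq, mem_orbObj_H, ← smul_set_eq_iff (out_mem_openCells o) (orbPt_mem o),
    mul_smul, inv_smul_eq_iff, eq_comm]

theorem homToCell_injective {n : ℕ} {y : PiZero G X} {o : X.orbCells n} :
    Function.Injective (homToCell (y := y) (o := o)) := by
  intro f f' h
  have h1 := congrArg (compVal '' ·) h
  simp only [image_homToCell] at h1
  rw [smul_out_eq_iff, mk_repElt, mk_repElt] at h1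
  exact PiZero.hom_ext h1

theorem homToCell_smul {n : ℕ} {y : PiZero G X} {o : X.orbCells n} (a : Aut y)
    (f : y ⟶ orbObj o) : homToCell (a • f) = autToWeyl a • homToCell f := by
  refine compVal_injective.image_injective ?_
  rw [image_compVal_smul (g := repElt (PiZero.homMap a.inv)) (fun p => rfl), image_homToCell,
    image_homToCell, smul_smul, smul_out_eq_iff, mk_repElt]
  change PiZero.homMap (a.inv ≫ f) _
    = repElt (PiZero.homMap a.inv) • ((repElt (PiZero.homMap f) : G) : G ⧸ (orbObj o).H)
  rw [PiZero.homMap_comp, MulActionHom.comp_apply, ← mk_repElt, map_coset, mk_repElt]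

/-- The open cells of `C` are the cells `g · s` belonging to the morphisms from the object of `C` to
the objects of the orbits of cells. -/
theorem mem_compCells_iff {n : ℕ} {y : PiZero G X} {s : Set (Comp (ZerothHomotopy.mk y.pt))} :
    s ∈ X.compCells y.H (ZerothHomotopy.mk y.pt) n
      ↔ ∃ (o : X.orbCells n) (f : y ⟶ orbObj o), homToCell f = s := by
  constructor
  · intro hs
    have hs' : compVal '' s ∈ X.openCells n := hs
    let o : X.orbCells n := ⟨Quotient.mk _ (compVal '' s), _, hs', rfl⟩
    obtain ⟨g, hg⟩ := MulAction.orbitRel_apply.1 (Quotient.exact (Quotient.out_eq o.1).symm)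
    have hg' : g • (Quotient.out o.1 : Set X) = compVal '' s := hg
    have hp := Set.smul_mem_smul_set (a := g) (orbPt_mem o)
    rw [hg'] at hp
    obtain ⟨p, hps, hpv⟩ := hp
    let f : y ⟶ orbObj o := PiZero.homOf g (fun h hh => by
      rw [mem_orbObj_H, conj_smul_eq_iff, ← hpv]
      exact p.1.2 h hh) (by
      rw [orbObj_pt, ← hpv]
      exact mk_eq_mk_iff.1 p.2)
    refine ⟨o, f, compVal_injective.image_injective ?_⟩
    rw [image_homToCell, ← hg', smul_out_eq_iff, mk_repElt]
    refine (?_ : ((1 * g : G) : G ⧸ (orbObj o).H) = _)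
    rw [one_mul]
  · rintro ⟨o, f, rfl⟩
    exact (congrArg (· ∈ X.openCells n) (image_homToCell f)).mpr
      (smul_mem_openCells _ (out_mem_openCells o))

/-- The weighted count of the `WL_C`-orbits of open `n`-cells of a component `C` is the sum of
the values of the character map at the objects of the `G`-orbits of `n`-cells. -/
theorem finsum_compCells {n : ℕ} [Finite (X.orbCells n)] (y : PiZero G X)
    {C : ZerothHomotopy (Fix y.H X)} (hC : ZerothHomotopy.mk y.pt = C) :
    ∑ᶠ o ∈ {o : MulAction.orbitRel.Quotient (MulAction.stabilizer (Weyl y.H) C) (Set (Comp C)) |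
        ∃ s ∈ X.compCells y.H C n, o = Quotient.mk _ s},
      (Nat.card (MulAction.stabilizer (MulAction.stabilizer (Weyl y.H) C)
        (Quotient.out o : Set (Comp C))) : ℚ)⁻¹
    = ∑ᶠ o : X.orbCells n, ∑ᶠ o' : MulAction.orbitRel.Quotient (Aut y) (y ⟶ orbObj o),
        (Nat.card (MulAction.stabilizer (Aut y) (Quotient.out o')) : ℚ)⁻¹ := by
  subst hC
  let S (o : X.orbCells n) : Set (MulAction.orbitRel.Quotient
      (MulAction.stabilizer (Weyl y.H) (ZerothHomotopy.mk y.pt))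
      (Set (Comp (ZerothHomotopy.mk y.pt)))) :=
    {o' | ∃ s ∈ Set.range (homToCell (y := y) (o := o)), o' = Quotient.mk _ s}
  have hS : {o : MulAction.orbitRel.Quotient (MulAction.stabilizer (Weyl y.H)
      (ZerothHomotopy.mk y.pt)) (Set (Comp (ZerothHomotopy.mk y.pt))) |
        ∃ s ∈ X.compCells y.H (ZerothHomotopy.mk y.pt) n, o = Quotient.mk _ s} = ⋃ o, S o := by
    ext o'
    simp only [Set.mem_iUnion]
    constructor
    · rintro ⟨s, hs, rfl⟩
      obtain ⟨o, f, rfl⟩ := mem_compCells_iff.1 hs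
      exact ⟨o, _, ⟨f, rfl⟩, rfl⟩
    · rintro ⟨o, _, ⟨f, rfl⟩, rfl⟩
      exact ⟨_, mem_compCells_iff.2 ⟨o, f, rfl⟩, rfl⟩
  rw [hS, finsum_mem_iUnion]
  · refine finsum_congr fun o => ?_
    exact (finsum_orbit_eq (Equiv.ofBijective _ (autToWeyl_bijective y)) homToCell
      homToCell_injective homToCell_smul).symm
  · intro o₁ o₂ hne
    refine Set.disjoint_left.2 ?_
    rintro _ ⟨_, ⟨f, rfl⟩, rfl⟩ ⟨_, ⟨f', rfl⟩, h⟩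
    refine hne (Subtype.ext ?_)
    obtain ⟨w, hw⟩ := MulAction.orbitRel_apply.1 (Quotient.exact h)
    obtain ⟨g, -, hg⟩ := exists_rep_stabilizer w
    have h1 := congrArg (compVal '' ·) hw
    simp only [image_compVal_smul hg, image_homToCell] at h1
    rw [← Quotient.out_eq o₁.1, ← Quotient.out_eq o₂.1]
    refine Quotient.sound (MulAction.orbitRel_apply.2
      ⟨(repElt (PiZero.homMap f))⁻¹ * g * repElt (PiZero.homMap f'), ?_⟩)
    change _ • (Quotient.out o₂.1 : Set X) = Quotient.out o₁.1
    rw [mul_smul, mul_smul, inv_smul_eq_iff, h1]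
  · intro o
    have := finite_hom_orbits y (orbObj o)
    refine (Set.finite_range fun o' : MulAction.orbitRel.Quotient (Aut y) (y ⟶ orbObj o) =>
      (Quotient.mk _ (homToCell (Quotient.out o')) : MulAction.orbitRel.Quotient
      (MulAction.stabilizer (Weyl y.H) (ZerothHomotopy.mk y.pt)) _)).subset ?_
    rintro _ ⟨_, ⟨f, rfl⟩, rfl⟩
    refine ⟨Quotient.mk _ f, ?_⟩
    obtain ⟨a, ha⟩ := MulAction.orbitRel_apply.1 (Quotient.exact
      (Quotient.out_eq (Quotient.mk _ f : MulAction.orbitRel.Quotient (Aut y) (y ⟶ orbObj o))))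
    refine Quotient.sound (MulAction.orbitRel_apply.2 ⟨autToWeyl a, ?_⟩)
    change autToWeyl a • homToCell f = _
    rw [← homToCell_smul]
    exact congrArg homToCell ha

/-- For a finite complex, the orbifold Euler characteristics of the components are the values of the
character map at the universal equivariant Euler characteristic. -/
theorem exists_euler (hX : X.IsFinite) : ∃ chi : X.U,
    (∀ x : PiZero G X, chi x.cls = chiComponent x) ∧
    ∀ j : Idx G X, X.charMap chi j = X.compEuler j.1.rep j.comp := by
  classical
  have hfin (n : ℕ) : Finite (X.orbCells n) :=
    (hX.subset fun o ho => ⟨n, ho⟩).to_subtype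
  have hD : {n : ℕ | (X.orbCells n).Nonempty}.Finite := by
    refine (hX.biUnion (t := fun o => {n | o ∈ X.orbCells n}) fun o _ =>
      Set.Subsingleton.finite fun n hn m hm => ?_).subset ?_
    · obtain ⟨p, hp⟩ := openCells_nonempty (out_mem_openCells ⟨o, hn⟩)
      exact (eq_of_mem_openCells (out_mem_openCells ⟨o, hn⟩) (out_mem_openCells ⟨o, hm⟩) hp hp).1
    · rintro n ⟨o, ho⟩
      exact Set.mem_biUnion (show o ∈ _ from ⟨n, ho⟩) ho
  let _ (n : ℕ) : Fintype (X.orbCells n) := Fintype.ofFinite _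
  have hempty {n : ℕ} (hn : n ∉ hD.toFinset) : IsEmpty (X.orbCells n) := by
    rw [Set.Finite.mem_toFinset] at hn
    exact Set.isEmpty_coe_sort.2 (Set.not_nonempty_iff_eq_empty.1 hn)
  -- `χ^G(X)` is the alternating sum of the classes of the orbits of cells
  let chi : X.U := ∑ n ∈ hD.toFinset, ∑ o : X.orbCells n,
    Finsupp.single (orbObj o).cls ((-1 : ℤ) ^ n)
  refine ⟨chi, fun x => ?_, fun j => ?_⟩
  · unfold chiComponent quotientEuler
    rw [finsum_eq_sum_of_support_subset (s := hD.toFinset)]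
    · rw [Finsupp.finsetSum_apply]
      refine Finset.sum_congr rfl fun n _ => ?_
      rw [ncard_cells_eq, Finsupp.finsetSum_apply]
      simp only [Finsupp.single_apply]
      rw [← Finset.sum_filter, Finset.sum_const, nsmul_eq_mul, mul_comm, ← Fintype.card_subtype,
        ← Nat.card_eq_fintype_card]
    · intro n hn
      by_contra hn'
      have := hempty hn'
      refine hn ?_
      simp only
      rw [ncard_cells_eq, Nat.card_of_isEmpty, Nat.cast_zero, mul_zero]
  · unfold compEuler orbifoldEuler
    rw [finsum_eq_sum_of_support_subset (s := hD.toFinset)]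
    · rw [map_sum, Finsupp.finsetSum_apply]
      refine Finset.sum_congr rfl fun n _ => ?_
      have h1 := finsum_compCells (n := n) j.obj (Idx.obj_pt j)
      refine Eq.trans ?_ (congrArg (fun z => (-1 : ℚ) ^ n * z) h1.symm)
      rw [finsum_eq_sum_of_fintype, map_sum, Finsupp.finsetSum_apply, Finset.mul_sum]
      refine Finset.sum_congr rfl fun o _ => ?_
      rw [charMap_single]
      push_cast
      rfl
    · intro n hn
      by_contra hn'
      have := hempty hn'
      refine hn ?_
      have h1 := finsum_compCells (n := n) j.obj (Idx.obj_pt j)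
      replace h1 := h1.trans (finsum_of_isEmpty _)
      exact (congrArg (fun z => (-1 : ℚ) ^ n * z) h1).trans (mul_zero _)

end Euler

/-! ### The isomorphism `γ` and its naturality -/

section Gamma

variable {G : Type u} [Group G] (X : ProperGCW.{u, v} G)

theorem dMap_single {X : ProperGCW.{u, v} G} (j : CycIdx G X) (q : ℚ) :
    X.dMap (Finsupp.single j q) = Finsupp.single j
      (q * ((Nat.card {l : j.1.1.rep // Subgroup.zpowers l = ⊤} : ℚ) / Nat.card j.1.1.rep)) := by
  rw [dMap, Finsupp.linearCombination_single, Finsupp.smul_single, smul_eq_mul]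

theorem gen_ratio_ne_zero {X : ProperGCW.{u, v} G} (j : CycIdx G X) :
    (Nat.card {l : j.1.1.rep // Subgroup.zpowers l = ⊤} : ℚ) / Nat.card j.1.1.rep ≠ 0 := by
  have hfin : Finite j.1.1.rep := j.2.1
  have hc : IsCyclic j.1.1.rep := j.2.2
  obtain ⟨l, hl⟩ := IsCyclic.exists_generator (α := j.1.1.rep)
  have hne : Nonempty {l : j.1.1.rep // Subgroup.zpowers l = ⊤} :=
    ⟨⟨l, eq_top_iff.2 fun k _ => hl k⟩⟩
  exact div_ne_zero (Nat.cast_ne_zero.2 Nat.card_pos.ne') (Nat.cast_ne_zero.2 Nat.card_pos.ne')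

/-- The automorphism `D`. -/
def dEquiv : (CycIdx G X →₀ ℚ) ≃ₗ[ℚ] (CycIdx G X →₀ ℚ) :=
  LinearEquiv.ofLinearMap X.dMap
    (Finsupp.linearCombination ℚ fun j => Finsupp.single j
      ((Nat.card {l : j.1.1.rep // Subgroup.zpowers l = ⊤} : ℚ) / Nat.card j.1.1.rep)⁻¹)
    (Finsupp.lhom_ext' fun j => LinearMap.ext_ring (by
      simp only [LinearMap.comp_apply, Finsupp.lsingle_apply, Finsupp.linearCombination_single,
        one_smul, LinearMap.id_apply]
      rw [dMap_single, inv_mul_cancel₀ (gen_ratio_ne_zero j)]))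
    (Finsupp.lhom_ext' fun j => LinearMap.ext_ring (by
      simp only [LinearMap.comp_apply, Finsupp.lsingle_apply, LinearMap.id_apply]
      rw [dMap_single, one_mul, Finsupp.linearCombination_single, Finsupp.smul_single, smul_eq_mul,
        mul_inv_cancel₀ (gen_ratio_ne_zero j)]))

/-- The isomorphism `γ = β ∘ HS⁻¹ ∘ α ∘ D`. -/
def gammaEquiv : (CycIdx G X →₀ ℚ) ≃ₗ[ℚ] (ℚ ⊗[ℤ] X.BredonH0) :=
  X.dEquiv ≪≫ₗ X.alphaEquiv ≪≫ₗ X.hsEquiv.symm ≪≫ₗ LinearEquiv.baseChange ℤ ℚ _ _ X.betaEquiv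

theorem gammaEquiv_apply {X : ProperGCW.{u, v} G} (z : CycIdx G X →₀ ℚ) :
    X.gammaEquiv z
      = X.betaEquiv.toLinearMap.baseChange ℚ (X.hsEquiv.symm (X.alphaEquiv (X.dMap z))) := rfl

/-- The composition `β ∘ HS⁻¹`. -/
def classToH0 : X.ClassColim →ₗ[ℚ] (ℚ ⊗[ℤ] X.BredonH0) :=
  X.betaEquiv.toLinearMap.baseChange ℚ ∘ₗ X.hsEquiv.symm.toLinearMap

variable {X} {Y : ProperGCW.{u, v} G}

theorem gammaEquiv_eq_classToH0 (z : CycIdx G X →₀ ℚ) :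
    X.gammaEquiv z = X.classToH0 (X.alphaEquiv (X.dMap z)) := rfl

theorem classToH0_classIncl (x : PiZero G X) (q : ℚ) (r : RepRing x.H) :
    X.classToH0 (classIncl x (ratEquiv x.H (q ⊗ₜ r))) = q ⊗ₜ X.betaEquiv (repIncl x r) := by
  rw [classToH0, LinearMap.comp_apply, LinearEquiv.coe_coe, hsEquiv_symm_classIncl,
    LinearMap.baseChange_tmul]
  rfl

/-- The formula `e₁ = γ ∘ pr ∘ ch`, after rationalization. -/
theorem eOne_eq_gammaEquiv (z : ℚ ⊗[ℤ] X.U) :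
    X.eOne.baseChange ℚ z = X.gammaEquiv (X.pr (X.charMap.liftBaseChange ℚ z)) := by
  refine LinearMap.congr_fun (g := X.gammaEquiv.toLinearMap ∘ₗ X.pr ∘ₗ X.charMap.liftBaseChange ℚ)
    ?_ z
  refine TensorProduct.AlgebraTensorModule.curry_injective (LinearMap.ext_ring ?_)
  refine Finsupp.lhom_ext' fun c => LinearMap.ext_ring ?_
  induction c using Quotient.inductionOn with
  | h x =>
    change X.eOne.baseChange ℚ (1 ⊗ₜ Finsupp.single x.cls 1)
      = X.gammaEquiv (X.pr (X.charMap.liftBaseChange ℚ (1 ⊗ₜ Finsupp.single x.cls 1)))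
    have h1 : X.alphaEquiv (X.dMap (X.pr (X.charMap (Finsupp.single x.cls 1))))
        = X.hsEquiv (1 ⊗ₜ repIncl x (repClass (trivialRep x.H))) :=
      (idxToClass_dMap_pr_charMap x).trans (hsEquiv_tmul x _).symm
    rw [LinearMap.baseChange_tmul, eOne_single, LinearMap.liftBaseChange_tmul, one_smul,
      gammaEquiv_apply, h1, LinearEquiv.symm_apply_apply, LinearMap.baseChange_tmul]
    rfl

/-- The object `f ∘ x : G/H → Y` for a `G`-map `f : X → Y` and an object `x : G/H → X`. -/
def GMap.mapObj (f : GMap X Y) (x : PiZero G X) : PiZero G Y :=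
  PiZero.ofPt x.H ⟨f.toMap x.pt, f.mapsTo_fix x.H x.pt.2⟩

theorem GMap.mapObj_pt (f : GMap X Y) (x : PiZero G X) :
    ((f.mapObj x).pt : Y) = f.toMap x.pt := congrArg Subtype.val (PiZero.ofPt_pt _ _)

theorem GMap.joinedIn (f : GMap X Y) {H : Subgroup G} {p q : X} (h : JoinedIn (Fix H X) p q) :
    JoinedIn (Fix H Y) (f.toMap p) (f.toMap q) := by
  have h2 := JoinedIn.map h (f := f.toMap) f.toMap.continuous
  refine h2.mono ?_
  rintro _ ⟨p, hp, rfl⟩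
  exact f.mapsTo_fix H hp

theorem GMap.Homotopic.joinedIn {f f' : GMap X Y} (h : f.Homotopic f') {H : Subgroup G} {p : X}
    (hp : p ∈ Fix H X) : JoinedIn (Fix H Y) (f.toMap p) (f'.toMap p) := by
  obtain ⟨F⟩ := h
  refine ⟨⟨⟨fun t => F (t, p), by fun_prop⟩, F.apply_zero p, F.apply_one p⟩, fun t k hk => ?_⟩
  have h1 := F.prop t k p
  rw [hp k hk] at h1
  exact h1.symm

theorem bredonH0Map_ptBredon (f : GMap X Y) (hf : f.Cellular) (H : FinSub G) {p : X}
    (hp : p ∈ X.skel 1 ∩ Fix H.1 X) (a : RepRing H.1) :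
    f.bredonH0Map hf (X.ptBredon H p hp a)
      = Y.ptBredon H (f.toMap p) ((hf 1).inter_inter (f.mapsTo_fix H.1) hp) a := by
  unfold ProperGCW.ptBredon
  refine (Submodule.mapQ_apply _ _ _ _).trans (congrArg Submodule.Quotient.mk ?_)
  unfold GMap.bredonMap
  rw [bredonInd_mk]
  have h : f.cellMap hf 0 H.1 (ptClass (X.skel 0 ∩ Fix H.1 X) p hp)
      = ptClass (Y.skel 0 ∩ Fix H.1 Y) (f.toMap p) ((hf 1).inter_inter (f.mapsTo_fix H.1) hp) :=
    congrArg Submodule.Quotient.mk (Subtype.ext (Finsupp.mapDomain_single))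
  rw [h]

/-- Naturality of `β`. -/
theorem bredonH0Map_betaEquiv (f : GMap X Y) (hf : f.Cellular) (x : PiZero G X) (a : RepRing x.H) :
    f.bredonH0Map hf (X.betaEquiv (repIncl x a)) = Y.betaEquiv (repIncl (f.mapObj x) a) := by
  have h1 : X.betaEquiv (repIncl x a) = X.ptBredon (finSub x) (vertexOf x) (vertexOf_mem x) a :=
    colimToBredon_incl x (vertexOf_mem x) (joinedIn_vertexOf x) a
  rw [h1, bredonH0Map_ptBredon]
  refine (colimToBredon_incl (f.mapObj x) ((hf 1).inter_inter (f.mapsTo_fix x.H) (vertexOf_mem x))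
    ?_ a).symm
  rw [GMap.mapObj_pt]
  exact f.joinedIn (joinedIn_vertexOf x)

/-- A `G`-map acts on the indices of cyclic groups by composition, and this depends only on its
`G`-homotopy class. -/
theorem cycIdx_mapObj {f f' : GMap X Y} (h : f.Homotopic f') (j : CycIdx G X) (l : j.1.obj.H)
    (hl : ∀ k, k ∈ Subgroup.zpowers l) :
    cycIdx (f'.mapObj j.1.obj) (show (f'.mapObj j.1.obj).H from l) = f.cycMap j := by
  let p : Fix j.1.1.rep Y := ⟨f.toMap j.1.obj.pt, f.mapsTo_fix _ j.1.obj.pt.2⟩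
  have h1 : f.idxMap j.1 = ⟨j.1.1, Quotient.mk _ (ZerothHomotopy.mk p)⟩ := by
    unfold GMap.idxMap
    congr 1
    have h2 : j.1.2 = Quotient.mk _ j.1.comp := (Quotient.out_eq _).symm
    rw [h2, Quotient.map_mk, ← Idx.obj_pt]
    rfl
  refine Subtype.ext (idxOf_eq_iff.2 ?_)
  change Nonempty ((f.idxMap j.1).obj ≅ _)
  rw [h1]
  obtain ⟨e⟩ := nonempty_iso_obj_mk (X := Y) j.1.1 p
  refine ⟨e ≪≫ PiZero.isoOf (x := PiZero.ofPt j.1.1.rep p) 1 (fun k => ?_) ?_⟩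
  · rw [cycObj_H, inv_one, one_mul, mul_one]
    refine ⟨fun hh => ?_, fun hh => (Subgroup.zpowers_le.2 l.2) hh⟩
    obtain ⟨n, hn⟩ := hl ⟨k, hh⟩
    exact ⟨n, congrArg Subtype.val hn⟩
  · rw [cycObj_pt, one_smul, GMap.mapObj_pt, PiZero.ofPt_pt]
    exact (h.joinedIn j.1.obj.pt.2).symm

theorem genElt_cycMap {f f' : GMap X Y} (h : f.Homotopic f') (j : CycIdx G X) (l : j.1.obj.H)
    (hl : ∀ k, k ∈ Subgroup.zpowers l) :
    genElt (f.cycMap j) = classIncl (f'.mapObj j.1.obj)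
      (show ClassQ j.1.obj.H from Finsupp.single (conQ l) 1) := by
  rw [← cycIdx_mapObj h j l hl]
  exact genElt_cycIdx _ _

/-- The basis element of `j` is sent by `α` to the class of some generator of the cyclic group. -/
theorem genElt_eq_classIncl (j : CycIdx G X) : ∃ l : j.1.obj.H, (∀ k, k ∈ Subgroup.zpowers l) ∧
    genElt j = classIncl j.1.obj (Finsupp.single (conQ l) 1) := by
  have hc : IsCyclic j.1.obj.H := j.2.2
  obtain ⟨l, hl, hl'⟩ := exists_genClass j.1.obj.H
  exact ⟨l, hl, by rw [← hl']; rfl⟩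

/-- Naturality of `β ∘ HS⁻¹`. -/
theorem bredonH0Map_classToH0 (f : GMap X Y) (hf : f.Cellular) (x : PiZero G X) (a : ClassQ x.H) :
    (f.bredonH0Map hf).baseChange ℚ (X.classToH0 (classIncl x a))
      = Y.classToH0 (classIncl (f.mapObj x) a) := by
  obtain ⟨q, r, rfl⟩ := exists_ratEquiv a
  refine Eq.trans ?_ (classToH0_classIncl (f.mapObj x) q r).symm
  rw [classToH0_classIncl, LinearMap.baseChange_tmul, bredonH0Map_betaEquiv]

theorem gammaEquiv_single (j : CycIdx G X) : X.gammaEquiv (Finsupp.single j 1)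
    = ((Nat.card {l : j.1.1.rep // Subgroup.zpowers l = ⊤} : ℚ) / Nat.card j.1.1.rep) •
      X.classToH0 (genElt j) := by
  have h : Finsupp.single j ((Nat.card {l : j.1.1.rep // Subgroup.zpowers l = ⊤} : ℚ) /
      Nat.card j.1.1.rep) = ((Nat.card {l : j.1.1.rep // Subgroup.zpowers l = ⊤} : ℚ) /
      Nat.card j.1.1.rep) • Finsupp.single j 1 := (Finsupp.smul_single_one _ _).symm
  rw [gammaEquiv_eq_classToH0, dMap_single, one_mul, h, LinearEquiv.map_smul, LinearMap.map_smul,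
    alphaEquiv_single]

/-- Naturality of `γ`. -/
theorem gammaEquiv_natural {f f' : GMap X Y} (hf' : f'.Cellular) (h : f.Homotopic f')
    (z : CycIdx G X →₀ ℚ) :
    Y.gammaEquiv (z.mapDomain f.cycMap) = (f'.bredonH0Map hf').baseChange ℚ (X.gammaEquiv z) := by
  refine LinearMap.congr_fun (f := Y.gammaEquiv.toLinearMap ∘ₗ Finsupp.lmapDomain ℚ ℚ f.cycMap)
    (g := (f'.bredonH0Map hf').baseChange ℚ ∘ₗ X.gammaEquiv.toLinearMap) ?_ z
  refine Finsupp.lhom_ext' fun j => LinearMap.ext_ring ?_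
  change Y.gammaEquiv (Finsupp.mapDomain f.cycMap (Finsupp.single j 1))
    = (f'.bredonH0Map hf').baseChange ℚ (X.gammaEquiv (Finsupp.single j 1))
  obtain ⟨l, hl, hj⟩ := genElt_eq_classIncl j
  have h1 := bredonH0Map_classToH0 f' hf' j.1.obj (Finsupp.single (conQ l) 1)
  rw [Finsupp.mapDomain_single, gammaEquiv_single, gammaEquiv_single, LinearMap.map_smul, hj, h1,
    genElt_cycMap h j l hl]
  rfl

end Gamma

end ProperGCW

end

end EquivEuler

theorem theorem0p3 {G : Type u} [Group G] :
    ∃ (β : ∀ X : ProperGCW.{u, v} G, X.RepColim ≃ₗ[ℤ] X.BredonH0)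
      (HS : ∀ X : ProperGCW.{u, v} G, (ℚ ⊗[ℤ] X.RepColim) ≃ₗ[ℚ] X.ClassColim)
      (α : ∀ X : ProperGCW.{u, v} G, (CycIdx G X →₀ ℚ) ≃ₗ[ℚ] X.ClassColim)
      (e₁ : ∀ X : ProperGCW.{u, v} G, X.U →ₗ[ℤ] X.BredonH0)
      (ch : ∀ X : ProperGCW.{u, v} G, X.U →ₗ[ℤ] (Idx G X →₀ ℚ))
      (γ : ∀ X : ProperGCW.{u, v} G, (CycIdx G X →₀ ℚ) ≃ₗ[ℚ] (ℚ ⊗[ℤ] X.BredonH0)),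
      -- `β` is induced by the maps `R_ℚ(H) = H_0(G/H; R_ℚ) → H_0(X; R_ℚ)` of the objects
      -- `x : G/H → X`; the latter is computed by a cellular `G`-map homotopic to `x`
      (∀ (X : ProperGCW.{u, v} G) (x : PiZero G X) (p : X) (hp : p ∈ X.skel 1 ∩ Fix x.H X),
        JoinedIn (Fix x.H X) (x.pt : X) p → ∀ a : RepRing x.H,
          β X (ProperGCW.repIncl x a) = X.ptBredon ⟨x.H, inferInstance⟩ p hp a) ∧
      -- `HS` is given by the Hattori-Stallings rank
      (∀ (X : ProperGCW.{u, v} G) (x : PiZero G X) (V : FinRep x.H) (n : ℕ)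
        (A : Matrix (Fin n) (Fin n) (MonoidAlgebra ℚ x.H)), Presents A V →
          HS X (1 ⊗ₜ[ℤ] ProperGCW.repIncl x (repClass V))
            = ProperGCW.classIncl x ((univTrace A).mapDomain conProj)) ∧
      -- `α` sends the basis element of `(L), WL · C` to the class of a generator of `L`
      (∀ (X : ProperGCW.{u, v} G) (j : CycIdx G X),
        α X (Finsupp.single j 1) = ProperGCW.genElt j) ∧
      -- `γ = β ∘ HS⁻¹ ∘ α ∘ D`
      (∀ (X : ProperGCW.{u, v} G) (z : CycIdx G X →₀ ℚ),
        γ X z = (β X).toLinearMap.baseChange ℚ ((HS X).symm (α X (X.dMap z)))) ∧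
      -- `e₁` sends `[x : G/H → X]` to the image of the trivial representation of `H`
      (∀ (X : ProperGCW.{u, v} G) (x : PiZero G X),
        e₁ X (Finsupp.single x.cls 1)
          = β X (ProperGCW.repIncl x (repClass (trivialRep x.H)))) ∧
      -- `ch` is the character map
      (∀ (X : ProperGCW.{u, v} G) (x : PiZero G X) (j : Idx G X),
        ch X (Finsupp.single x.cls 1) j = ProperGCW.chComponent x j) ∧
      -- the identification of `Is Π₀(G, X)` with `∐_{(H)} WH \ π₀(X^H)`
      (∀ X : ProperGCW.{u, v} G, Function.Bijective fun j : Idx G X => j.obj.cls) ∧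
      -- the diagram commutes and its vertical arrows are isomorphisms
      (∀ X : ProperGCW.{u, v} G, Function.Bijective ((ch X).liftBaseChange ℚ)) ∧
      (∀ (X : ProperGCW.{u, v} G) (z : ℚ ⊗[ℤ] X.U),
        (e₁ X).baseChange ℚ z = γ X (X.pr ((ch X).liftBaseChange ℚ z))) ∧
      -- `γ` is natural in `X`; `H_0` of a `G`-map is computed by a homotopic cellular `G`-map
      (∀ (X Y : ProperGCW.{u, v} G) (f f' : ProperGCW.GMap X Y) (hf' : f'.Cellular),
        f.Homotopic f' → ∀ z : CycIdx G X →₀ ℚ,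
          γ Y (z.mapDomain f.cycMap) = (f'.bredonH0Map hf').baseChange ℚ (γ X z)) ∧
      -- `γ` sends the orbifold Euler characteristics to the image of `χ^G(X)`
      (∀ X : ProperGCW.{u, v} G, X.IsFinite →
        ∃ (chi : X.U) (orb : CycIdx G X →₀ ℚ),
          (∀ x : PiZero G X, chi x.cls = ProperGCW.chiComponent x) ∧
          (∀ j : CycIdx G X, orb j = X.compEuler j.1.1.rep j.1.comp) ∧
          γ X orb = 1 ⊗ₜ[ℤ] e₁ X chi) := by
  refine ⟨ProperGCW.betaEquiv, ProperGCW.hsEquiv, ProperGCW.alphaEquiv, ProperGCW.eOne,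
    ProperGCW.charMap, ProperGCW.gammaEquiv, ?_, ?_, ?_, ?_, ?_, ?_, ?_, ?_, ?_, ?_, ?_⟩
  · intro X x p hp h a
    exact ProperGCW.colimToBredon_incl x hp h a
  · intro X x V n A hA
    rw [ProperGCW.hsEquiv_tmul, hattoriStallings_repClass, univTrace_eq_hsElt hA]
  · intro X j
    exact ProperGCW.alphaEquiv_single j
  · intro X z
    exact ProperGCW.gammaEquiv_apply z
  · intro X x
    exact ProperGCW.eOne_single x
  · intro X x j
    rw [ProperGCW.charMap_single, Int.cast_one, one_mul]
  · intro X
    exact ProperGCW.idx_bijective X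
  · intro X
    exact ProperGCW.charMap_bijective
  · intro X z
    exact ProperGCW.eOne_eq_gammaEquiv z
  · intro X Y f f' hf' h z
    exact ProperGCW.gammaEquiv_natural hf' h z
  · intro X hX
    obtain ⟨chi, h1, h2⟩ := ProperGCW.exists_euler hX
    refine ⟨chi, X.pr (X.charMap chi), h1, fun j => h2 j.1, ?_⟩
    have h3 := ProperGCW.eOne_eq_gammaEquiv (X := X) (1 ⊗ₜ chi)
    rw [LinearMap.baseChange_tmul, LinearMap.liftBaseChange_tmul, one_smul] at h3
    exact h3.symm
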